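/- **Notation.** Let $d\ge 1$. On $d$-tuples $X=(X^1,\dots,X^d)$ of complex $n\times n$ matrices use the Frobenius norm $\|X\|_F^2=\sum_{r,i,j}|X^r_{ij}|^2$ and the corresponding real inner product. Let $V^d_n=\{X: X^rX^s=X^sX^r\ \text{for all } r,s\}$, let $V^d_{n,\mathrm{gen}}$ be the set of $X\in V^d_n$ such that each $X^r$ has $n$ distinct eigenvalues, let $T^d_n$ be the set of $X\in V^d_n$ with all $X^r$ upper triangular, and put $T^d_{n,\mathrm{gen}}=T^d_n\cap V^d_{n,\mathrm{gen}}$. Write $UXU^*=(UX^1U^*,\dots,UX^dU^*)$ for $U$ in the unitary group $U(n)$. Hausdorff measures are normalized to agree with Lebesgue measure on Euclidean spaces: $dX$ is Hausdorff measure of dimension $2n^2+2(d-1)n$ on $V^d_n$, and $dQ$ is Hausdorff measure of dimension $n^2+(2d-1)n$ on $T^d_{n,\mathrm{gen}}$. Let $\mathbb T^n\subset U(n)$ be the group of diagonal unitaries and $\nu$ the probability measure on $U(n)/\mathbb T^n$ that is the image of Haar measure. Let $\mathfrak a_n$ be the real Euclidean space of skew-Hermitian $n\times n$ matrices with zero diagonal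 (Frobenius norm). For $Q\in T^d_{n,\mathrm{gen}}$ let $\mathrm{ad}_Q(S)=([Q^1,S],\dots,[Q^d,S])$, let $P^\perp$ be the orthogonal projection onto the orthogonal complement of the tangent space $T_Q T^d_n$, and let $\Lambda_Q:\mathfrak a_n\to\mathfrak a_n$ be the real linear map with $\langle \Lambda_QS_1,S_2\rangle=\langle P^\perp \mathrm{ad}_Q(S_1),\mathrm{ad}_Q(S_2)\rangle$ for all $S_1,S_2\in\mathfrak a_n$. A unitarily invariant weight is a measurable $w:V^d_n\to[0,\infty)$ with $w(UXU^*)=w(X)$ for all $U\in U(n)$ and $\int_{V^d_n}w\,dX=1$. A section is a map $\sigma:U(n)/\mathbb T^n\to U(n)$ with $\sigma(u)\in u$ for all $u$. **Proposition.** For each $n$ the limit $$C_n=\lim_{\varepsilon\to0^+}\frac{\mathrm{vol}\{S\in\mathfrak a_n:\|S\|_F<\varepsilon\}}{\nu\{[e^S]:S\in\mathfrak a_n,\ \|S\|_F<\varepsilon\}}$$ exists and $0<C_n<\infty$. Put $\kappa(Q)=C_n\sqrt{|\det\Lambda_Q|}$. Let $d\ge1$, assume that $V^d_n$ is irreducible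 (as an algebraic subset of $\mathbb C^{dn^2}$), and let $w$ be a unitarily invariant weight on $V^d_n$. Then, with $X=UQU^*$, $$w(X)\,dX=\kappa(Q)\,w(Q)\,dQ\,d\nu$$ in the following sense. 1. For every section $\sigma$ and every measurable function $f$ on the tuples with values in $[0,\infty]$, $$\int_{V^d_n}f(X)\,w(X)\,dX=\frac1{n!}\int_{U(n)/\mathbb T^n}\int_{T^d_{n,\mathrm{gen}}}f\big(\sigma(u)Q\sigma(u)^*\big)\,\kappa(Q)\,w(Q)\,dQ\,d\nu(u).$$ 2. If $\sigma$ is a measurable section, and $A\subseteq T^d_{n,\mathrm{gen}}$ and $N\subseteq U(n)/\mathbb T^n$ are measurable sets such that $g(Q,u)=\sigma(u)Q\sigma(u)^*$ is injective on $A\times N$, then for every such $f$ $$\int_{g(A\times N)}f(X)\,w(X)\,dX=\int_N\int_A f\big(\sigma(u)Q\sigma(u)^*\big)\,\kappa(Q)\,w(Q)\,dQ\,d\nu(u).$$ -/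

import Mathlib

open MeasureTheory Filter Topology
open scoped NNReal ENNReal

noncomputable section

namespace CommTuple

/-- The space of `d`-tuples of complex `n × n` matrices, with the Frobenius norm
`‖X‖² = ∑ r i j, |X r i j|²`.  It is used both as a complex and as a real Euclidean space. -/
abbrev Tuple (d n : ℕ) : Type := EuclideanSpace ℂ (Fin d × Fin n × Fin n)

variable {d n : ℕ}

/-- The `r`-th matrix of a tuple. -/
def comp (X : Tuple d n) (r : Fin d) : Matrix (Fin n) (Fin n) ℂ :=
  Matrix.of fun i j => X (r, i, j)

/-- The tuple with given matrices. -/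
def ofComp (M : Fin d → Matrix (Fin n) (Fin n) ℂ) : Tuple d n :=
  WithLp.toLp 2 fun k => M k.1 k.2.1 k.2.2

/-- `V^d_n`: the commuting `d`-tuples. -/
def commuting (d n : ℕ) : Set (Tuple d n) :=
  {X | ∀ r s, comp X r * comp X s = comp X s * comp X r}

/-- `V^d_{n,gen}`: the commuting `d`-tuples all of whose components have `n` distinct
eigenvalues. -/
def generic (d n : ℕ) : Set (Tuple d n) :=
  {X | X ∈ commuting d n ∧ ∀ r, (spectrum ℂ (comp X r)).ncard = n}

/-- `T^d_n`: the commuting `d`-tuples of upper triangular matrices. -/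
def triangular (d n : ℕ) : Set (Tuple d n) :=
  {X | X ∈ commuting d n ∧ ∀ r i j, j < i → comp X r i j = 0}

/-- Irreducibility of a subset of affine space in the Zariski topology: it is nonempty and is
not contained in the union of two algebraic sets unless it is contained in one of them. -/
def ZariskiIrreducible {ι : Type*} (V : Set (ι → ℂ)) : Prop :=
  V.Nonempty ∧ ∀ I J : Ideal (MvPolynomial ι ℂ),
    V ⊆ MvPolynomial.zeroLocus ℂ I ∪ MvPolynomial.zeroLocus ℂ J →
      V ⊆ MvPolynomial.zeroLocus ℂ I ∨ V ⊆ MvPolynomial.zeroLocus ℂ J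

/-- The assumption that `V^d_n`, as a subset of `ℂ^(d n²)`, is irreducible. -/
def CommutingIrreducible (d n : ℕ) : Prop :=
  ZariskiIrreducible ((fun X : Tuple d n => (X : Fin d × Fin n × Fin n → ℂ)) '' commuting d n)

/-- The measure `dX`: Hausdorff measure of dimension `2n² + 2(d-1)n` on `V^d_n`, normalised to
agree with Lebesgue measure on Euclidean spaces.  (To be used for `d ≥ 1`.) -/
def dX (d n : ℕ) : Measure (Tuple d n) :=
  (μHE[2 * n ^ 2 + 2 * (d - 1) * n]).restrict (commuting d n)

/-- The measure `dQ` on the generic upper triangular commuting tuples: Hausdorff measure of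
dimension `n² + (2d-1)n`, with the same normalisation.  (To be used for `d ≥ 1`.) -/
def dQ (d n : ℕ) : Measure (Tuple d n) :=
  (μHE[n ^ 2 + (2 * d - 1) * n]).restrict (triangular d n ∩ generic d n)

/-! ### The unitary group and its quotient by the diagonal torus -/

/-- The unitary group `U(n)`. -/
abbrev UGroup (n : ℕ) : Type := Matrix.unitaryGroup (Fin n) ℂ

/-- The Borel σ-algebra on `U(n)`. -/
instance : MeasurableSpace (UGroup n) := borel _

instance : BorelSpace (UGroup n) := ⟨rfl⟩

instance : CompactSpace (UGroup n) := by
  have hK : IsCompact (Set.univ.pi fun _ : Fin n => Set.univ.pi fun _ : Fin n =>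
      Metric.closedBall (0 : ℂ) 1) :=
    isCompact_univ_pi fun _ => isCompact_univ_pi fun _ => isCompact_closedBall _ _
  have hc : IsClosed ((Matrix.unitaryGroup (Fin n) ℂ : Set (Matrix (Fin n) (Fin n) ℂ))) := by
    have : ((Matrix.unitaryGroup (Fin n) ℂ : Set (Matrix (Fin n) (Fin n) ℂ)))
        = {A | A * star A = 1} := by
      ext A
      exact Matrix.mem_unitaryGroup_iff
    rw [this]
    exact isClosed_eq (by fun_prop) continuous_const
  refine isCompact_iff_compactSpace.1 (IsCompact.of_isClosed_subset hK hc ?_)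
  intro A hA i _ j _
  simpa using entry_norm_bound_of_unitary hA i j

/-- Haar measure on `U(n)`, of total mass `1`. -/
def haarU (n : ℕ) : Measure (UGroup n) := Measure.haarMeasure ⊤

/-- The torus `𝕋ⁿ` of diagonal unitary matrices. -/
def torus (n : ℕ) : Subgroup (UGroup n) where
  carrier := {U | (U : Matrix (Fin n) (Fin n) ℂ).IsDiag}
  one_mem' := by
    intro i j hij
    simp [hij]
  mul_mem' := by
    intro U V hU hV i j hij
    simp only [Matrix.UnitaryGroup.mul_val, Matrix.mul_apply]
    refine Finset.sum_eq_zero fun k _ => ?_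
    by_cases hik : i = k
    · subst hik
      simp [hV hij]
    · simp [hU hik]
  inv_mem' := by
    intro U hU
    simpa [Matrix.star_eq_conjTranspose] using Matrix.IsDiag.conjTranspose hU

/-- The probability measure `ν` on `U(n)/𝕋ⁿ`: the image of Haar measure. -/
def nu (n : ℕ) : Measure (UGroup n ⧸ torus n) :=
  (haarU n).map (QuotientGroup.mk : UGroup n → UGroup n ⧸ torus n)

/-- A choice of a representative in every coset of the torus. -/
def IsSection (σ : UGroup n ⧸ torus n → UGroup n) : Prop :=
  ∀ u, (QuotientGroup.mk (σ u) : UGroup n ⧸ torus n) = u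

/-- Componentwise conjugation `U X U*`. -/
def conj (U : UGroup n) (X : Tuple d n) : Tuple d n :=
  ofComp fun r => (U : Matrix (Fin n) (Fin n) ℂ) * comp X r * star (U : Matrix (Fin n) (Fin n) ℂ)

/-- A unitarily invariant weight on `V^d_n`: a nonnegative measurable function on `V^d_n` with
`w (U X U*) = w X` and `∫ w dX = 1`.  Values of `w` outside `V^d_n` play no role. -/
structure IsWeight (w : Tuple d n → ℝ≥0) : Prop where
  measurable : Measurable fun X : commuting d n => w X
  invariant : ∀ (U : UGroup n), ∀ X ∈ commuting d n, w (conj U X) = w X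
  lintegral_eq_one : ∫⁻ X, (w X : ℝ≥0∞) ∂(dX d n) = 1

/-! ### The density `κ` -/

/-- The tangent space of a set `S` at `x`: the (span of the) velocities at `x` of the `C¹` curves
that lie in `S` and pass through `x`. -/
def tangentSpaceOf {E : Type*} [NormedAddCommGroup E] [NormedSpace ℝ E] (S : Set E) (x : E) :
    Submodule ℝ E :=
  Submodule.span ℝ {Z | ∃ γ : ℝ → E, ContDiffAt ℝ 1 γ 0 ∧ (∀ᶠ t in 𝓝 0, γ t ∈ S) ∧
    γ 0 = x ∧ HasDerivAt γ Z 0}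

/-- The real Euclidean space of skew-Hermitian `n × n` matrices with zero diagonal, with the
Frobenius norm. -/
def skewZeroDiag (n : ℕ) : Submodule ℝ (EuclideanSpace ℂ (Fin n × Fin n)) where
  carrier := {S | (∀ i j, star (S (j, i)) = - S (i, j)) ∧ ∀ i, S (i, i) = 0}
  zero_mem' := by simp
  add_mem' := by
    rintro S T ⟨hS, hS'⟩ ⟨hT, hT'⟩
    refine ⟨fun i j => ?_, fun i => by simp [hS', hT']⟩
    simp only [PiLp.add_apply, star_add, hS, hT]
    ring
  smul_mem' := by
    rintro c S ⟨hS, hS'⟩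
    refine ⟨fun i j => ?_, fun i => by simp [hS']⟩
    simp only [PiLp.smul_apply, star_smul, hS, star_trivial, smul_neg]

/-- An element of `skewZeroDiag n` as a matrix. -/
def skewMat (S : skewZeroDiag n) : Matrix (Fin n) (Fin n) ℂ :=
  Matrix.of fun i j => (S : EuclideanSpace ℂ (Fin n × Fin n)) (i, j)

/-- `ad_Q S = ([Q¹, S], …, [Q^d, S])`, as a real linear map. -/
def ad (Q : Tuple d n) : skewZeroDiag n →ₗ[ℝ] Tuple d n where
  toFun S := ofComp fun r => comp Q r * skewMat S - skewMat S * comp Q r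
  map_add' S T := by
    have h : skewMat (S + T) = skewMat S + skewMat T := by
      ext i j
      simp [skewMat]
    ext k
    simp only [h, ofComp, mul_add, add_mul, Matrix.sub_apply, Matrix.add_apply, PiLp.add_apply]
    ring
  map_smul' c S := by
    have h : skewMat (c • S) = c • skewMat S := by
      ext i j
      simp [skewMat]
    ext k
    simp only [h, ofComp, mul_smul_comm, smul_mul_assoc, Matrix.sub_apply, Matrix.smul_apply,
      PiLp.smul_apply, RingHom.id_apply, smul_sub]

/-- `P^⊥`: the orthogonal projection onto the orthogonal complement of `T_Q (T^d_n)`.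
(`Λ_Q` uses it only on the vectors `ad_Q S`, which lie in `T_Q (V^d_n)`; there it is the
projection onto the orthogonal complement of `T_Q (T^d_n)` in `T_Q (V^d_n)`.) -/
def Pperp (Q : Tuple d n) : Tuple d n →ₗ[ℝ] Tuple d n :=
  ((tangentSpaceOf (triangular d n) Q)ᗮ.starProjection : Tuple d n →ₗ[ℝ] Tuple d n)

/-- The real linear map `Λ_Q` on `skewZeroDiag n`, characterised by `inner_Lam` below. -/
def Lam (Q : Tuple d n) : skewZeroDiag n →ₗ[ℝ] skewZeroDiag n :=
  (LinearMap.adjoint (𝕜 := ℝ) (E := skewZeroDiag n) (F := Tuple d n) (ad Q)).comp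
    ((Pperp Q).comp (ad Q))

theorem inner_Lam (Q : Tuple d n) (S₁ S₂ : skewZeroDiag n) :
    inner ℝ (Lam Q S₁) S₂ = inner ℝ (Pperp Q (ad Q S₁)) (ad Q S₂) := by
  unfold Lam
  rw [LinearMap.comp_apply, LinearMap.adjoint_inner_left]
  rfl

/-- `κ(Q) = C √|det Λ_Q|`. -/
def kappa (C : ℝ) (Q : Tuple d n) : ℝ :=
  C * Real.sqrt |LinearMap.det (Lam Q)|

/-- The set of cosets `[e^S]` in `U(n)/𝕋ⁿ`, where `S` is skew-Hermitian with zero diagonal and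
`‖S‖_F < ε`. -/
def expBall (n : ℕ) (ε : ℝ) : Set (UGroup n ⧸ torus n) :=
  {u | ∃ S : skewZeroDiag n, ‖S‖ < ε ∧ ∃ U : UGroup n,
    (U : Matrix (Fin n) (Fin n) ℂ) = NormedSpace.exp (skewMat S) ∧ QuotientGroup.mk U = u}

end CommTuple

end

/-! The proof has three ingredients.

Almost every commuting tuple is generic. In a generic tuple every matrix is a polynomial in the
first one, so the generic tuples are dominated by an affine space whose complex dimension is half of
the Hausdorff dimension in `dX`. If the variety is irreducible, the vanishing of the discriminants
cuts out something of smaller dimension, hence a null set (`euclideanHausdorffMeasure_inter_zero`).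
Irreducibility serves only for this.

For each of the `n!` orderings `π` of the eigenvalues of the first matrix, a generic `X` is `U Q U*`
with `Q` triangular and its diagonal in the order `π`; then the coset of `U` modulo the torus is
unique (`exists_conj_sorted`, `mem_torus_of_conj_eq`). Locally this gives coordinates `flow (e, S) =
e^S Q e^{-S}` with `Q = param e`. At `S = 0` the derivative is `D param` on the first factor and
`-ad_Q` on the second. A Gram determinant splits off the tangent space of the triangular tuples, so
the Jacobian is that of `param` times `√|det Λ_Q|` (`jac_flow`).

The remaining step uses invariance instead of a smooth structure on `U(n)/𝕋ⁿ`. Let `D` be a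
conjugation-invariant set of generic tuples. The slab `{e^S Q e^{-S} : Q ∈ D sorted, ‖S‖ < ε}` has
measure `|D| · ν(expBall ε)`, by averaging over `U(n)` (`genMeasure_slab`); the area formula
computes the same measure as an integral of the Jacobian. Dividing by the volume of the ball of
radius `ε` and letting `ε → 0` gives `tendsto_genMeasure_mul`. For one suitable set of single
matrices this shows that `C_n` exists in `(0, ∞)`; for general `D` it shows that Hausdorff measure
and `κ dQ` on the sorted tuples agree on invariant sets. An arbitrary integrand becomes invariant
when averaged over `U(n)`, and Fubini gives the integral formula over `U(n)`. Since `κ dQ` is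
invariant under the torus, `U` may be replaced by `σ(u)`; summing over the orderings produces `n!`.

Tuples have length `d + 1` below, so that there is a first matrix. -/

noncomputable section

namespace CommTuple

/-! ### The area formula for injective immersions -/

section Area

open Module

/-- If `g` is `K`-Lipschitz relative to `f` on `t`, then the Hausdorff measure of `g '' t` is
controlled by that of `f '' t`. -/
theorem euclideanHausdorffMeasure_image_le_of_dist_le {X Y Z : Type*}
    [MetricSpace Y] [MeasurableSpace Y] [BorelSpace Y] [MetricSpace Z] [MeasurableSpace Z]
    [BorelSpace Z] {f : X → Y} {g : X → Z} {t : Set X} {K : ℝ≥0} (k : ℕ)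
    (h : ∀ x ∈ t, ∀ y ∈ t, dist (g x) (g y) ≤ K * dist (f x) (f y)) :
    μHE[k] (g '' t) ≤ (K : ℝ≥0∞) ^ k * μHE[k] (f '' t) := by
  rcases t.eq_empty_or_nonempty with rfl | ⟨x₀, hx₀⟩
  · simp
  have : Nonempty X := ⟨x₀⟩
  have hinv : ∀ y ∈ f '' t, Function.invFunOn f t y ∈ t ∧ f (Function.invFunOn f t y) = y :=
    fun y hy => Function.invFunOn_pos hy
  -- The choice of preimages is harmless: points of `t` with equal `f`-image have equal `g`-image,
  -- so `g` factors through `f` on `t` by a `K`-Lipschitz map.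
  have hg : g '' t = (g ∘ Function.invFunOn f t) '' (f '' t) := by
    rw [Set.image_image]
    refine Set.image_congr fun x hx => ?_
    have h1 := hinv (f x) ⟨x, hx, rfl⟩
    have h2 := h x hx _ h1.1
    rw [h1.2, dist_self, mul_zero] at h2
    exact dist_le_zero.1 h2
  have hL : LipschitzOnWith K (g ∘ Function.invFunOn f t) (f '' t) := by
    refine LipschitzOnWith.of_dist_le_mul fun y hy z hz => ?_
    have := h _ (hinv y hy).1 _ (hinv z hz).1
    rwa [(hinv y hy).2, (hinv z hz).2] at this
  have := hL.hausdorffMeasure_image_le (d := (k : ℝ)) (by positivity)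
  rw [hg]
  simp only [Measure.euclideanHausdorffMeasure_def, Measure.smul_apply, ENNReal.smul_def,
    smul_eq_mul]
  rw [ENNReal.rpow_natCast] at this
  rw [mul_left_comm]
  gcongr

variable {ι E H : Type*} [Fintype ι] [DecidableEq ι] [NormedAddCommGroup E] [NormedSpace ℝ E]
  [NormedAddCommGroup H] [InnerProductSpace ℝ H]

/-- The volume factor of a linear map into an inner product space, relative to a basis. -/
def jac (b : Basis ι ℝ E) (L : E →L[ℝ] H) : ℝ :=
  √(Matrix.gram ℝ fun i => L (b i)).det

theorem jac_pos (b : Basis ι ℝ E) {L : E →L[ℝ] H} (hL : Function.Injective L) : 0 < jac b L := by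
  refine Real.sqrt_pos.2 (Matrix.PosDef.det_pos ?_)
  refine Matrix.posDef_gram_iff_linearIndependent.2 ?_
  exact b.linearIndependent.map' (L : E →ₗ[ℝ] H) (LinearMap.ker_eq_bot.2 hL)

theorem injective_of_jac_ne_zero (b : Basis ι ℝ E) {L : E →L[ℝ] H} (hL : jac b L ≠ 0) :
    Function.Injective L := by
  have h : LinearIndependent ℝ fun i => L (b i) :=
    Matrix.linearIndependent_of_det_gram_ne_zero (𝕜 := ℝ) fun h => hL (by simp [jac, h])
  rw [injective_iff_map_eq_zero]
  intro x hx
  rw [← b.sum_repr x] at hx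
  simp only [map_sum, map_smul] at hx
  have := Fintype.linearIndependent_iff.1 h _ hx
  rw [← b.sum_repr x]
  simp [this]

theorem continuous_jac (b : Basis ι ℝ E) : Continuous fun L : E →L[ℝ] H => jac b L := by
  refine Real.continuous_sqrt.comp (Continuous.matrix_det ?_)
  refine continuous_matrix fun i j => ?_
  simp only [Matrix.gram_apply]
  exact Continuous.inner (ContinuousLinearMap.apply ℝ H (b i)).continuous
    (ContinuousLinearMap.apply ℝ H (b j)).continuous

variable [MeasurableSpace E] [BorelSpace E] [MeasurableSpace H] [BorelSpace H]

/-- Sending the standard orthonormal basis to `b` reduces this to a linear map on Euclidean space,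
whose volume factor squared is a Gram determinant. The normalisation of `μHE` makes the constant
one. -/
theorem euclideanHausdorffMeasure_linear_image (b : Basis ι ℝ E) (L : E →L[ℝ] H) (s : Set E) :
    μHE[Fintype.card ι] (L '' s) = ENNReal.ofReal (jac b L) * b.addHaar s := by
  have : FiniteDimensional ℝ E := b.finiteDimensional_of_finite
  let e : EuclideanSpace ℝ ι ≃L[ℝ] E :=
    ((EuclideanSpace.basisFun ι ℝ).toBasis.equiv b (Equiv.refl ι)).toContinuousLinearEquiv
  have he : ∀ i, e (EuclideanSpace.basisFun ι ℝ i) = b i := fun i => by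
    have := Basis.equiv_apply (EuclideanSpace.basisFun ι ℝ).toBasis i b (Equiv.refl ι)
    rwa [OrthonormalBasis.coe_toBasis] at this
  have hs : L '' s = ((L : E →ₗ[ℝ] H) ∘ₗ (e : EuclideanSpace ℝ ι →ₗ[ℝ] E)) '' (e ⁻¹' s) := by
    rw [LinearMap.coe_comp, Set.image_comp]
    congr 1
    exact (Set.image_preimage_eq s e.surjective).symm
  have hb : b.addHaar s = volume (e ⁻¹' s) := by
    have h1 : b = (EuclideanSpace.basisFun ι ℝ).toBasis.map e.toLinearEquiv := by
      ext i
      exact (he i).symm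
    conv_lhs => rw [h1]
    rw [← Basis.map_addHaar, OrthonormalBasis.addHaar_eq_volume]
    exact e.toHomeomorph.toMeasurableEquiv.map_apply s
  have hd : Fintype.card ι = finrank ℝ (EuclideanSpace ℝ ι) := by simp
  rw [hs, hb, hd, LinearMap.euclideanHausdorffMeasure_image_eq_normDet_mul_volume]
  congr 2
  rw [jac, ← Real.sqrt_sq (LinearMap.normDet_nonneg _)]
  congr 1
  have := LinearMap.normDet_sq_eq_det_gram
    ((L : E →ₗ[ℝ] H) ∘ₗ (e : EuclideanSpace ℝ ι →ₗ[ℝ] E)) (EuclideanSpace.basisFun ι ℝ)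
  simp only [RCLike.ofReal_real_eq_id, id_eq] at this
  rw [this]
  congr 2
  funext i
  exact congrArg L (he i)

/-- Near `x₀` the map is bi-Lipschitz relative to its derivative there, with a constant `K` such
that `K ^ k < η`; this costs one factor `η`. Freezing the Jacobian at `x₀` costs the other. -/
theorem exists_nhds_euclideanHausdorffMeasure_image_le (b : Basis ι ℝ E) {G : E → H}
    (hG : ContDiff ℝ 1 G) {x₀ : E} (hx₀ : Function.Injective (fderiv ℝ G x₀)) {η : ℝ}
    (hη : 1 < η) :
    ∃ u, IsOpen u ∧ x₀ ∈ u ∧ ∀ t ⊆ u, MeasurableSet t →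
      μHE[Fintype.card ι] (G '' t) ≤
          ENNReal.ofReal (η * η) * ∫⁻ x in t, ENNReal.ofReal (jac b (fderiv ℝ G x)) ∂b.addHaar ∧
        ∫⁻ x in t, ENNReal.ofReal (jac b (fderiv ℝ G x)) ∂b.addHaar ≤
          ENNReal.ofReal (η * η) * μHE[Fintype.card ι] (G '' t) := by
  have : FiniteDimensional ℝ E := b.finiteDimensional_of_finite
  have hη0 : 0 < η := by linarith
  set L := fderiv ℝ G x₀
  set k := Fintype.card ι
  obtain ⟨K, hK1, hKk⟩ : ∃ K : ℝ≥0, 1 < K ∧ (K : ℝ) ^ k < η := by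
    have h : Tendsto (fun K : ℝ≥0 => (K : ℝ) ^ k) (𝓝 1) (𝓝 (((1 : ℝ≥0) : ℝ) ^ k)) :=
      ((NNReal.continuous_coe.pow k).tendsto 1)
    have h2 : ∀ᶠ K : ℝ≥0 in 𝓝 1, (K : ℝ) ^ k < η := h.eventually_lt_const (by simpa using hη)
    obtain ⟨K, hK, hK'⟩ := ((h2.filter_mono nhdsWithin_le_nhds).and
      (self_mem_nhdsWithin : Set.Ioi (1 : ℝ≥0) ∈ 𝓝[>] 1)).exists
    exact ⟨K, hK', hK⟩
  obtain ⟨A, hA0, hA⟩ := LinearMap.exists_antilipschitzWith (L : E →ₗ[ℝ] H)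
    (LinearMap.ker_eq_bot.2 hx₀)
  have hK0 : (0 : ℝ) < K := by
    have : (0 : ℝ≥0) < K := lt_trans zero_lt_one hK1
    exact_mod_cast this
  have hK1' : (1 : ℝ) < K := by exact_mod_cast hK1
  -- As `L` expands distances by at least `1 / A`, a linearisation error of `(1 - K⁻¹) / A` per unit
  -- length is at most `(1 - K⁻¹) ‖L (x - y)‖`. This bounds `‖G x - G y‖` between `K⁻¹` and `2 - K⁻¹
  -- ≤ K` times `‖L (x - y)‖`.
  have hδ : 0 < (1 - K⁻¹) / A := by
    refine div_pos (tsub_pos_of_lt ?_) hA0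
    exact inv_lt_one_of_one_lt₀ hK1
  have hst : HasStrictFDerivAt G L x₀ := hG.contDiffAt.hasStrictFDerivAt one_ne_zero
  obtain ⟨u₁, hu₁, hap⟩ := hst.approximates_deriv_on_nhds (Or.inr hδ)
  have hAL : ∀ v, ‖v‖ ≤ A * ‖L v‖ := fun v => by
    simpa using hA.le_mul_dist v 0
  have hclose : ∀ x ∈ u₁, ∀ y ∈ u₁, ‖G x - G y - L (x - y)‖ ≤ (1 - (K : ℝ)⁻¹) * ‖L (x - y)‖ := by
    intro x hx y hy
    refine (hap x hx y hy).trans ?_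
    have h1 : (((1 - K⁻¹) / A : ℝ≥0) : ℝ) = (1 - (K : ℝ)⁻¹) / A := by
      rw [NNReal.coe_div, NNReal.coe_sub (inv_lt_one_of_one_lt₀ hK1).le]
      simp
    rw [h1]
    have hA0' : (0 : ℝ) < A := hA0
    rw [div_mul_eq_mul_div, div_le_iff₀ hA0', mul_assoc, mul_comm _ (A : ℝ)]
    refine mul_le_mul_of_nonneg_left (hAL _) ?_
    have := inv_lt_one_of_one_lt₀ hK1'
    linarith
  have hle1 : ∀ x ∈ u₁, ∀ y ∈ u₁, dist (G x) (G y) ≤ K * dist (L x) (L y) := by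
    intro x hx y hy
    have h := hclose x hx y hy
    have h2 : ‖G x - G y‖ ≤ ‖G x - G y - L (x - y)‖ + ‖L (x - y)‖ := by
      simpa using norm_add_le (G x - G y - L (x - y)) (L (x - y))
    rw [dist_eq_norm, dist_eq_norm, ← map_sub]
    have h3 : 1 - (K : ℝ)⁻¹ ≤ K - 1 := by
      have h4 : (K : ℝ) * (K : ℝ)⁻¹ = 1 := mul_inv_cancel₀ hK0.ne'
      have h5 : 0 < (K : ℝ)⁻¹ := inv_pos.2 hK0
      nlinarith
    nlinarith [norm_nonneg (L (x - y))]
  have hle2 : ∀ x ∈ u₁, ∀ y ∈ u₁, dist (L x) (L y) ≤ K * dist (G x) (G y) := by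
    intro x hx y hy
    have h := hclose x hx y hy
    have h2 : ‖L (x - y)‖ ≤ ‖G x - G y‖ + ‖G x - G y - L (x - y)‖ := by
      have := norm_sub_le (G x - G y) (G x - G y - L (x - y))
      simpa using this
    rw [dist_eq_norm, dist_eq_norm, ← map_sub]
    have h3 : (K : ℝ)⁻¹ * ‖L (x - y)‖ ≤ ‖G x - G y‖ := by linarith
    rwa [inv_mul_le_iff₀ hK0] at h3
  have hj0 : 0 < jac b L := jac_pos b hx₀
  have hjc : Continuous fun x => jac b (fderiv ℝ G x) :=
    (continuous_jac b).comp (hG.continuous_fderiv one_ne_zero)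
  have hjm : Measurable fun x => ENNReal.ofReal (jac b (fderiv ℝ G x)) :=
    hjc.measurable.ennreal_ofReal
  have hev1 : ∀ᶠ x in 𝓝 x₀, jac b (fderiv ℝ G x) < η * jac b L :=
    hjc.continuousAt.eventually_lt_const (by nlinarith : jac b L < η * jac b L)
  have hev2 : ∀ᶠ x in 𝓝 x₀, jac b L < η * jac b (fderiv ℝ G x) :=
    (continuous_const.mul hjc).continuousAt.eventually_const_lt
      (by nlinarith : jac b L < η * jac b L)
  obtain ⟨u, huu, huo, hxu⟩ := mem_nhds_iff.1 (inter_mem hu₁ (hev1.and hev2))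
  refine ⟨u, huo, hxu, fun t ht htm => ?_⟩
  have htu₁ : t ⊆ u₁ := fun x hx => (huu (ht hx)).1
  have hKk' : (K : ℝ≥0∞) ^ k ≤ ENNReal.ofReal η := by
    rw [← ENNReal.coe_pow, ENNReal.ofReal, ENNReal.coe_le_coe]
    refine NNReal.le_toNNReal_of_coe_le ?_
    exact_mod_cast hKk.le
  have hm1 := euclideanHausdorffMeasure_image_le_of_dist_le k
    fun x hx y hy => hle1 x (htu₁ hx) y (htu₁ hy)
  have hm2 := euclideanHausdorffMeasure_image_le_of_dist_le k
    fun x hx y hy => hle2 x (htu₁ hx) y (htu₁ hy)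
  rw [euclideanHausdorffMeasure_linear_image b] at hm1 hm2
  have hi1 : ENNReal.ofReal (jac b L) * b.addHaar t ≤
      ENNReal.ofReal η * ∫⁻ x in t, ENNReal.ofReal (jac b (fderiv ℝ G x)) ∂b.addHaar := by
    rw [← setLIntegral_const, ← lintegral_const_mul _ hjm]
    refine setLIntegral_mono (hjm.const_mul _) fun x hx => ?_
    rw [← ENNReal.ofReal_mul hη0.le]
    exact ENNReal.ofReal_le_ofReal (huu (ht hx)).2.2.le
  have hi2 : ∫⁻ x in t, ENNReal.ofReal (jac b (fderiv ℝ G x)) ∂b.addHaar ≤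
      ENNReal.ofReal η * (ENNReal.ofReal (jac b L) * b.addHaar t) := by
    rw [← mul_assoc, ← setLIntegral_const]
    refine setLIntegral_mono measurable_const fun x hx => ?_
    rw [← ENNReal.ofReal_mul hη0.le]
    exact ENNReal.ofReal_le_ofReal (huu (ht hx)).2.1.le
  rw [ENNReal.ofReal_mul hη0.le, mul_assoc, mul_assoc]
  exact ⟨hm1.trans (mul_le_mul' hKk' hi1),
    hi2.trans (mul_le_mul' le_rfl (hm2.trans (mul_le_mul' hKk' le_rfl)))⟩

/-- The area formula for an injective `C¹` immersion into an inner product space. -/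
theorem area_formula [CompleteSpace H] (b : Basis ι ℝ E) {G : E → H} (hG : ContDiff ℝ 1 G)
    {s : Set E} (hs : MeasurableSet s) (hinj : Set.InjOn G s)
    (himm : ∀ x ∈ s, Function.Injective (fderiv ℝ G x)) :
    μHE[Fintype.card ι] (G '' s) =
      ∫⁻ x in s, ENNReal.ofReal (jac b (fderiv ℝ G x)) ∂b.addHaar := by
  have : FiniteDimensional ℝ E := b.finiteDimensional_of_finite
  have : CompleteSpace E := FiniteDimensional.complete ℝ E
  have : ProperSpace E := FiniteDimensional.proper ℝ E
  have key : ∀ η : ℝ, 1 < η → μHE[Fintype.card ι] (G '' s) ≤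
      ENNReal.ofReal (η * η) * ∫⁻ x in s, ENNReal.ofReal (jac b (fderiv ℝ G x)) ∂b.addHaar ∧
        ∫⁻ x in s, ENNReal.ofReal (jac b (fderiv ℝ G x)) ∂b.addHaar ≤
          ENNReal.ofReal (η * η) * μHE[Fintype.card ι] (G '' s) := by
    intro η hη
    choose! u huo hxu hu using fun x (hx : x ∈ s) =>
      exists_nhds_euclideanHausdorffMeasure_image_le b hG (himm x hx) hη
    rcases s.eq_empty_or_nonempty with rfl | hne
    · simp
    obtain ⟨t, hts, htc, htu⟩ := TopologicalSpace.countable_cover_nhdsWithin (f := u) (s := s)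
      fun x hx => mem_nhdsWithin_of_mem_nhds ((huo x hx).mem_nhds (hxu x hx))
    have htne : t.Nonempty := by
      rw [Set.nonempty_iff_ne_empty]
      rintro rfl
      obtain ⟨x, hx⟩ := hne
      simpa using htu hx
    obtain ⟨a, rfl⟩ := htc.exists_eq_range htne
    have ha : ∀ n, a n ∈ s := fun n => hts ⟨n, rfl⟩
    -- Disjoint measurable pieces, each inside one good neighbourhood. Injectivity keeps their
    -- images disjoint, so both sides of the formula are sums over the pieces.
    set p : ℕ → Set E := fun n => s ∩ disjointed (fun n => u (a n)) n
    have hpm : ∀ n, MeasurableSet (p n) := fun n =>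
      hs.inter (MeasurableSet.disjointed (fun n => (huo _ (ha n)).measurableSet) n)
    have hpu : ∀ n, p n ⊆ u (a n) := fun n x hx =>
      disjointed_subset (fun n => u (a n)) n hx.2
    have hpd : Pairwise (Function.onFun Disjoint p) := fun i j hij =>
      (disjoint_disjointed _ hij).mono Set.inter_subset_right Set.inter_subset_right
    have hps : s = ⋃ n, p n := by
      rw [← Set.inter_iUnion, iUnion_disjointed, eq_comm, Set.inter_eq_left]
      simpa using htu
    have hGm : ∀ n, MeasurableSet (G '' p n) := fun n =>
      (hpm n).image_of_continuousOn_injOn hG.continuous.continuousOn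
        (hinj.mono Set.inter_subset_left)
    have hGd : Pairwise (Function.onFun Disjoint fun n => G '' p n) := fun i j hij =>
      Set.disjoint_image_image fun x hx y hy h =>
        (Set.disjoint_left.1 (hpd hij)) hx (hinj hx.1 hy.1 h ▸ hy)
    have hsum1 : μHE[Fintype.card ι] (G '' s) = ∑' n, μHE[Fintype.card ι] (G '' p n) := by
      conv_lhs => rw [hps, Set.image_iUnion]
      exact measure_iUnion hGd hGm
    have hsum2 : ∫⁻ x in s, ENNReal.ofReal (jac b (fderiv ℝ G x)) ∂b.addHaar =
        ∑' n, ∫⁻ x in p n, ENNReal.ofReal (jac b (fderiv ℝ G x)) ∂b.addHaar := by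
      conv_lhs => rw [hps]
      exact lintegral_iUnion hpm hpd _
    rw [hsum1, hsum2, ← ENNReal.tsum_mul_left, ← ENNReal.tsum_mul_left]
    exact ⟨ENNReal.tsum_le_tsum fun n => (hu _ (ha n) _ (hpu n) (hpm n)).1,
      ENNReal.tsum_le_tsum fun n => (hu _ (ha n) _ (hpu n) (hpm n)).2⟩
  -- The bounds hold on all of `s` for every `η > 1`, also when a side is infinite; now `η → 1`.
  have lim : ∀ x : ℝ≥0∞, Tendsto (fun η : ℝ => ENNReal.ofReal (η * η) * x) (𝓝[>] 1) (𝓝 x) := by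
    intro x
    have h1 : Tendsto (fun η : ℝ => ENNReal.ofReal (η * η)) (𝓝[>] 1) (𝓝 1) := by
      have : Continuous fun η : ℝ => ENNReal.ofReal (η * η) :=
        ENNReal.continuous_ofReal.comp (by fun_prop)
      simpa using (this.tendsto 1).mono_left nhdsWithin_le_nhds
    simpa using ENNReal.Tendsto.mul_const h1 (Or.inl one_ne_zero) (b := x)
  refine le_antisymm (ge_of_tendsto (lim _) ?_) (ge_of_tendsto (lim _) ?_)
  · exact eventually_mem_nhdsWithin.mono fun η hη => (key η hη).1
  · exact eventually_mem_nhdsWithin.mono fun η hη => (key η hη).2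

end Area

/-! ### Volume factors on products -/

section JacProd

open Module

/-- Removing from each `v j` its component along the `u i` is a unipotent change of vectors, and it
makes the Gram matrix block diagonal. -/
theorem det_gram_sumElim {ι κ H : Type*} [Fintype ι] [DecidableEq ι] [Fintype κ] [DecidableEq κ]
    [NormedAddCommGroup H] [InnerProductSpace ℝ H] (u : ι → H) (v w : κ → H)
    (C : Matrix ι κ ℝ) (hv : ∀ j, v j = ∑ i, C i j • u i + w j)
    (hw : ∀ i j, inner ℝ (u i) (w j) = 0) :
    (Matrix.gram ℝ (Sum.elim u v)).det = (Matrix.gram ℝ u).det * (Matrix.gram ℝ w).det := by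
  have hw' : ∀ i j, inner ℝ (w j) (u i) = 0 := fun i j => by rw [real_inner_comm, hw]
  have h : Matrix.gram ℝ (Sum.elim u v) = Matrix.fromBlocks 1 0 C.transpose 1 *
      Matrix.fromBlocks (Matrix.gram ℝ u) 0 0 (Matrix.gram ℝ w) * Matrix.fromBlocks 1 C 0 1 := by
    rw [Matrix.fromBlocks_multiply, Matrix.fromBlocks_multiply]
    ext (i | i) (j | j)
    · simp
    · simp [Matrix.mul_apply, hv, inner_add_right, inner_sum, inner_smul_right, hw, mul_comm]
    · simp [Matrix.mul_apply, hv, inner_add_left, sum_inner, inner_smul_left, hw']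
    · simp [Matrix.mul_apply, hv, inner_add_left, sum_inner, inner_smul_left, hw', inner_add_right,
        inner_sum, inner_smul_right, hw, Finset.mul_sum, Finset.sum_mul]
      refine Finset.sum_congr rfl fun x _ => Finset.sum_congr rfl fun y _ => ?_
      ring
  rw [h, Matrix.det_mul, Matrix.det_mul]
  simp [Matrix.det_fromBlocks_zero₂₁]

/-- Base times height: only the part of `B` orthogonal to the range of `A` adds volume. The range is
a separate variable `R`, so that a tangent space can be put in its place. -/
theorem jac_prod {ι κ E F H : Type*} [Fintype ι] [DecidableEq ι] [Fintype κ] [DecidableEq κ]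
    [NormedAddCommGroup E] [NormedSpace ℝ E] [NormedAddCommGroup F] [NormedSpace ℝ F]
    [NormedAddCommGroup H] [InnerProductSpace ℝ H] (b : Basis ι ℝ E) (c : Basis κ ℝ F)
    (L : E × F →L[ℝ] H) (A : E →L[ℝ] H) (B : F →L[ℝ] H) (hL : ∀ x y, L (x, y) = A x + B y)
    (R : Submodule ℝ H) [R.HasOrthogonalProjection] (hR : R = LinearMap.range (A : E →ₗ[ℝ] H)) :
    jac (b.prod c) L = jac b A *
      √(Matrix.gram ℝ fun j => Rᗮ.starProjection (B (c j))).det := by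
  have hP : ∀ j, ∃ x : E, A x = R.starProjection (B (c j)) := fun j => by
    have := R.starProjection_apply_mem (B (c j))
    exact LinearMap.mem_range.1 ((SetLike.ext_iff.1 hR _).1 this)
  choose x hx using hP
  have hu : (fun i => L ((b.prod c) i)) = Sum.elim (fun i => A (b i)) fun j => B (c j) := by
    funext i
    rcases i with i | i
    · simp [hL]
    · simp [hL]
  rw [jac, jac, hu, ← Real.sqrt_mul (Matrix.posSemidef_gram ℝ _).det_nonneg]
  congr 1
  refine det_gram_sumElim _ _ _ (Matrix.of fun i j => b.repr (x j) i) (fun j => ?_) fun i j => ?_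
  · have h1 : ∑ i, b.repr (x j) i • A (b i) = A (x j) := by
      conv_rhs => rw [← b.sum_repr (x j)]
      simp only [map_sum, map_smul]
    simp only [Matrix.of_apply]
    rw [h1, hx, Submodule.starProjection_add_starProjection_orthogonal]
  · refine Submodule.inner_right_of_mem_orthogonal ?_ (Submodule.starProjection_apply_mem _ _)
    rw [hR]
    exact ⟨b i, rfl⟩

end JacProd

/-! ### Hausdorff null sets from algebraic dimension -/

section AlgebraicNull

open MvPolynomial

/-- The coordinates selected by `e` are algebraically independent modulo `p`. -/
def CoordIndep {ι : Type*} (p : Ideal (MvPolynomial ι ℂ)) {r : ℕ} (e : Fin r → ι) : Prop :=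
  ∀ F : MvPolynomial (Fin r) ℂ, rename e F ∈ p → F = 0

theorem CoordIndep.mono {ι : Type*} {p p' : Ideal (MvPolynomial ι ℂ)} (h : p ≤ p') {r : ℕ}
    {e : Fin r → ι} (he : CoordIndep p' e) : CoordIndep p e :=
  fun F hF => he F (h hF)

/-- The empty family is independent because `p` is proper, and adding coordinates one at a time must
stop by length `k`. -/
theorem exists_maximal_coordIndep {ι : Type*} {p : Ideal (MvPolynomial ι ℂ)} (hp : p ≠ ⊤) {k : ℕ}
    (hk : ∀ (r : ℕ) (e : Fin r → ι), CoordIndep p e → r ≤ k) :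
    ∃ (r : ℕ) (e : Fin r → ι), CoordIndep p e ∧ ∀ i, ¬ CoordIndep p (Fin.cons i e : _ → ι) := by
  by_contra! H
  have : ∀ r : ℕ, ∃ e : Fin r → ι, CoordIndep p e := by
    intro r
    induction r with
    | zero =>
      refine ⟨Fin.elim0, fun F hF => ?_⟩
      rw [MvPolynomial.eq_C_of_isEmpty F] at hF ⊢
      rw [rename_C] at hF
      by_contra hne
      refine hp (Ideal.eq_top_of_isUnit_mem _ hF ?_)
      refine IsUnit.map C (isUnit_iff_ne_zero.2 fun h => hne ?_)
      rw [h, map_zero]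
    | succ r ih =>
      obtain ⟨e, he⟩ := ih
      obtain ⟨i, hi⟩ := H r e he
      exact ⟨_, hi⟩
  obtain ⟨e, he⟩ := this (k + 1)
  exact absurd (hk _ e he) (by omega)

/-- A root of multiplicity `m` is a simple root of the derivative of order `m - 1`. Thus multiple
roots, too, come within reach of the implicit function argument. -/
theorem exists_iterate_derivative_root {g : Polynomial ℂ} (hg : g ≠ 0) {t : ℂ}
    (ht : g.eval t = 0) :
    ∃ j : ℕ, (Polynomial.derivative^[j] g).eval t = 0 ∧
      (Polynomial.derivative^[j + 1] g).eval t ≠ 0 := by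
  have hex : ∃ m, (Polynomial.derivative^[m] g).eval t ≠ 0 := by
    by_contra! H
    exact absurd ((Polynomial.lt_rootMultiplicity_iff_isRoot_iterate_derivative hg).2
      fun m _ => H m) (lt_irrefl (g.rootMultiplicity t))
  classical
  have h0 : Nat.find hex ≠ 0 := fun h => by
    have := Nat.find_spec hex
    rw [h] at this
    exact this ht
  obtain ⟨j, hj⟩ := Nat.exists_eq_succ_of_ne_zero h0
  refine ⟨j, ?_, ?_⟩
  · by_contra h
    exact Nat.find_min hex (by omega) h
  · have := Nat.find_spec hex
    rwa [hj] at this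

/-- The Lipschitz half of the implicit function theorem. With `b` the size of the partial derivative
in the last variable, a linearisation error of `b / 2` can be absorbed on the left, which leaves the
constant `1 + 2 ‖h'‖ / b`. -/
theorem exists_nhds_norm_sub_le {E : Type*} [NormedAddCommGroup E] [NormedSpace ℂ E]
    {h : E × ℂ → ℂ} {h' : E × ℂ →L[ℂ] ℂ} {z₀ : E × ℂ} (hh : HasStrictFDerivAt h h' z₀)
    (hne : h' (0, 1) ≠ 0) :
    ∃ C : ℝ≥0, ∃ U ∈ 𝓝 z₀, ∀ z ∈ U, ∀ w ∈ U, h z = 0 → h w = 0 →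
      ‖z.2 - w.2‖ ≤ C * ‖z.1 - w.1‖ := by
  set b := ‖h' (0, 1)‖ with hb
  have hb0 : 0 < b := norm_pos_iff.2 hne
  obtain ⟨U, hU, hap⟩ := hh.approximates_deriv_on_nhds (c := ⟨b / 2, by positivity⟩)
    (Or.inr (by change (0 : ℝ) < b / 2; positivity))
  refine ⟨⟨1 + 2 * ‖h'‖ / b, by positivity⟩, U, hU, fun z hz w hw hz0 hw0 => ?_⟩
  have h1 := hap z hz w hw
  rw [hz0, hw0, sub_self, zero_sub, norm_neg] at h1
  change _ ≤ b / 2 * _ at h1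
  have h2 : h' (z - w) = h' (z.1 - w.1, 0) + (z.2 - w.2) * h' (0, 1) := by
    rw [← smul_eq_mul, ← map_smul, ← map_add]
    congr 1
    ext <;> simp
  have h3 : ‖z.2 - w.2‖ * b ≤ ‖h' (z - w)‖ + ‖h'‖ * ‖z.1 - w.1‖ := by
    rw [hb, ← norm_mul]
    have : (z.2 - w.2) * h' (0, 1) = h' (z - w) - h' (z.1 - w.1, 0) := by rw [h2]; ring
    rw [this]
    refine (norm_sub_le _ _).trans ?_
    gcongr
    refine (h'.le_opNorm _).trans ?_
    simp [Prod.norm_def]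
  have h4 : ‖z - w‖ ≤ ‖z.1 - w.1‖ + ‖z.2 - w.2‖ := by
    rw [Prod.norm_def]
    exact max_le_add_of_nonneg (norm_nonneg _) (norm_nonneg _)
  change _ ≤ (1 + 2 * ‖h'‖ / b) * _
  have h5 : ‖z.2 - w.2‖ * b ≤ (b + 2 * ‖h'‖) * ‖z.1 - w.1‖ := by nlinarith
  have h6 : (1 + 2 * ‖h'‖ / b) = (b + 2 * ‖h'‖) / b := by field_simp
  rw [h6, div_mul_eq_mul_div, le_div_iff₀ hb0]
  exact h5

theorem contDiff_eval_map {r : ℕ} (P : Polynomial (MvPolynomial (Fin r) ℂ)) :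
    ContDiff ℂ 1 fun z : (Fin r → ℂ) × ℂ => (P.map (eval z.1)).eval z.2 := by
  have h : (fun z : (Fin r → ℂ) × ℂ => (P.map (eval z.1)).eval z.2) = fun z =>
      eval (Fin.cons z.2 z.1 : Fin (r + 1) → ℂ) ((finSuccEquiv ℂ r).symm P) := by
    funext z
    rw [eval_eq_eval_mv_eval', AlgEquiv.apply_symm_apply]
  rw [h]
  have h2 : ContDiff ℂ 1 fun z : (Fin r → ℂ) × ℂ => (Fin.cons z.2 z.1 : Fin (r + 1) → ℂ) := by
    rw [contDiff_pi]
    intro i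
    refine Fin.cases ?_ (fun j => ?_) i
    · simp only [Fin.cons_zero]
      exact contDiff_snd
    · simp only [Fin.cons_succ]
      exact (contDiff_apply ℂ ℂ j).comp contDiff_fst
  have h3 : ContDiff ℂ 1 fun x : Fin (r + 1) → ℂ => eval x ((finSuccEquiv ℂ r).symm P) :=
    (AnalyticOnNhd.eval_mvPolynomial _).contDiff
  exact h3.comp h2

theorem fderiv_eval_map_apply {r : ℕ} (P : Polynomial (MvPolynomial (Fin r) ℂ))
    (z : (Fin r → ℂ) × ℂ) :
    fderiv ℂ (fun z : (Fin r → ℂ) × ℂ => (P.map (eval z.1)).eval z.2) z (0, 1) =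
      ((Polynomial.derivative P).map (eval z.1)).eval z.2 := by
  have h1 := ((contDiff_eval_map P).differentiable one_ne_zero z).hasFDerivAt
  have h2 : HasDerivAt (fun t : ℂ => (z.1, t)) (0, 1) z.2 :=
    (hasDerivAt_const z.2 z.1).prodMk (hasDerivAt_id z.2)
  have h3 := h1.comp_hasDerivAt z.2 h2
  have h4 := (P.map (eval z.1)).hasDerivAt z.2
  rw [Polynomial.derivative_map] at h4
  exact h3.unique h4

/-- The points at which the coordinate `i` is a root of multiplicity `j i + 1` of a polynomial
`P i` in the coordinates selected by `e` form a null set. -/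
theorem euclideanHausdorffMeasure_multipleRoots {ι : Type*} [Fintype ι] {r s : ℕ}
    (hs : 2 * r < s) (e : Fin r → ι) (P : ι → Polynomial (MvPolynomial (Fin r) ℂ)) (j : ι → ℕ) :
    μHE[s] {z : ι → ℂ | ∀ i,
      (Polynomial.derivative^[j i] ((P i).map (eval (z ∘ e)))).eval (z i) = 0 ∧
      (Polynomial.derivative^[j i + 1] ((P i).map (eval (z ∘ e)))).eval (z i) ≠ 0} = 0 := by
  refine measure_null_of_locally_null _ fun z₀ hz₀ => ?_
  set S := {z : ι → ℂ | ∀ i,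
      (Polynomial.derivative^[j i] ((P i).map (eval (z ∘ e)))).eval (z i) = 0 ∧
      (Polynomial.derivative^[j i + 1] ((P i).map (eval (z ∘ e)))).eval (z i) ≠ 0} with hS
  have hloc : ∀ i, ∃ C : ℝ≥0, ∃ U ∈ 𝓝 z₀, ∀ z ∈ U ∩ S, ∀ w ∈ U ∩ S,
      ‖z i - w i‖ ≤ C * ‖z ∘ e - w ∘ e‖ := by
    intro i
    have hd := (contDiff_eval_map (Polynomial.derivative^[j i] (P i))).contDiffAt
      (x := (z₀ ∘ e, z₀ i)) |>.hasStrictFDerivAt one_ne_zero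
    obtain ⟨C, U, hU, h⟩ := exists_nhds_norm_sub_le hd (by
      rw [fderiv_eval_map_apply, ← Function.iterate_succ_apply' Polynomial.derivative,
        ← Polynomial.iterate_derivative_map]
      exact (hz₀ i).2)
    have hc : Continuous fun z : ι → ℂ => (z ∘ e, z i) := by fun_prop
    refine ⟨C, _, hc.continuousAt.preimage_mem_nhds hU, fun z hz w hw => ?_⟩
    have hzz := (hz.2 i).1
    have hww := (hw.2 i).1
    rw [Polynomial.iterate_derivative_map] at hzz hww
    exact h _ hz.1 _ hw.1 hzz hww
  choose C U hU h using hloc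
  refine ⟨(⋂ i, U i) ∩ S, Filter.inter_mem (mem_nhdsWithin_of_mem_nhds
    (Filter.iInter_mem.2 hU)) self_mem_nhdsWithin, ?_⟩
  -- Near `z₀` every coordinate is a Lipschitz function of those selected by `e`, so the set is no
  -- larger than its projection to `ℂ^r`, where the measure of dimension `s > 2r` vanishes.
  have hle := euclideanHausdorffMeasure_image_le_of_dist_le (f := fun z : ι → ℂ => z ∘ e) (g := id)
    (t := (⋂ i, U i) ∩ S) (K := ∑ i, C i) s (fun z hz w hw => by
      rw [id, id, dist_eq_norm, dist_eq_norm, pi_norm_le_iff_of_nonneg (by positivity)]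
      intro i
      refine (h i z ⟨Set.mem_iInter.1 hz.1 i, hz.2⟩ w ⟨Set.mem_iInter.1 hw.1 i, hw.2⟩).trans ?_
      gcongr
      exact Finset.single_le_sum (f := C) (fun _ _ => zero_le) (Finset.mem_univ i))
  have h0 : (μHE[s] : Measure (Fin r → ℂ)) = 0 := by
    have h1 : (μH[(s : ℝ)] : Measure (Fin r → ℂ)) = 0 := by
      refine Real.hausdorffMeasure_of_finrank_lt ?_
      rw [show Module.finrank ℝ (Fin r → ℂ) = r * 2 by simp [Module.finrank_pi_fintype]]
      exact_mod_cast (by omega : r * 2 < s)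
    rw [Measure.euclideanHausdorffMeasure_def]
    exact (congrArg _ h1).trans (smul_zero _)
  rw [h0] at hle
  simpa using hle

/-- An algebraic set is null for the Hausdorff measures of (real) dimension larger than twice the
number of algebraically independent coordinates on it. -/
theorem euclideanHausdorffMeasure_zeroLocus {ι : Type*} [Fintype ι] {k s : ℕ} (hs : 2 * k < s)
    (p : Ideal (MvPolynomial ι ℂ)) (hp : p.IsPrime)
    (hk : ∀ (r : ℕ) (e : Fin r → ι), CoordIndep p e → r ≤ k) :
    μHE[s] (zeroLocus ℂ p) = 0 := by
  induction p using IsNoetherian.induction with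
  | hgt p ih =>
  obtain ⟨r, e, he, hmax⟩ := exists_maximal_coordIndep hp.ne_top hk
  have hF : ∀ i, ∃ F : MvPolynomial (Fin (r + 1)) ℂ, rename (Fin.cons i e : _ → ι) F ∈ p ∧
      F ≠ 0 := fun i => by
    have := hmax i
    unfold CoordIndep at this
    push Not at this
    exact this
  choose F hFp hF0 using hF
  set P := fun i => finSuccEquiv ℂ r (F i) with hP
  have hP0 : ∀ i, P i ≠ 0 := fun i => by simpa [hP] using hF0 i
  -- Where `q ≠ 0`, no `P i` specialises to the zero polynomial, so each coordinate is a root of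
  -- some finite multiplicity; there are countably many patterns of multiplicities. The locus `q =
  -- 0` belongs to the strictly larger ideal `J`, whose minimal primes fall under the induction
  -- hypothesis.
  set q := ∏ i, (P i).leadingCoeff with hq
  have hq0 : q ≠ 0 := Finset.prod_ne_zero_iff.2 fun i _ => Polynomial.leadingCoeff_ne_zero.2 (hP0 i)
  have hqp : rename e q ∉ p := fun h => hq0 (he q h)
  set J : Ideal (MvPolynomial ι ℂ) := p ⊔ Ideal.span {rename e q} with hJ
  have hpJ : p < J := by
    refine lt_of_le_of_ne le_sup_left fun h => hqp ?_
    rw [h]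
    exact Ideal.mem_sup_right (Ideal.mem_span_singleton_self _)
  have hcover : zeroLocus ℂ p ⊆ (⋃ j : ι → ℕ, {z : ι → ℂ | ∀ i,
      (Polynomial.derivative^[j i] ((P i).map (eval (z ∘ e)))).eval (z i) = 0 ∧
      (Polynomial.derivative^[j i + 1] ((P i).map (eval (z ∘ e)))).eval (z i) ≠ 0}) ∪
      ⋃ p' ∈ J.minimalPrimes, zeroLocus ℂ p' := by
    intro z hz
    by_cases hzq : eval (z ∘ e) q = 0
    · right
      have hJz : J ≤ vanishingIdeal ℂ {z} := by
        refine sup_le (fun f hf => ?_) (Ideal.span_le.2 ?_)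
        · rw [mem_vanishingIdeal_singleton_iff]
          exact hz f hf
        · rw [Set.singleton_subset_iff, SetLike.mem_coe, mem_vanishingIdeal_singleton_iff,
            aeval_rename]
          simpa [aeval_eq_eval] using hzq
      obtain ⟨p', hp', hle⟩ := Ideal.exists_minimalPrimes_le hJz
      refine Set.mem_biUnion hp' fun f hf => ?_
      exact (mem_vanishingIdeal_singleton_iff z f).1 (hle hf)
    · left
      have hPz : ∀ i, (P i).map (eval (z ∘ e)) ≠ 0 := by
        intro i h
        refine hzq ?_
        rw [hq, map_prod]
        refine Finset.prod_eq_zero (Finset.mem_univ i) ?_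
        have := congrArg (fun g => Polynomial.coeff g (P i).natDegree) h
        simpa using this
      have hroot : ∀ i, ((P i).map (eval (z ∘ e))).eval (z i) = 0 := by
        intro i
        rw [hP, ← eval_eq_eval_mv_eval']
        have h1 := hz _ (hFp i)
        rw [aeval_rename] at h1
        rw [← h1, ← coe_aeval_eq_eval]
        simp only [RingHom.coe_coe]
        congr 2
        funext l
        refine Fin.cases ?_ (fun l => ?_) l <;> simp
      choose j hj using fun i => exists_iterate_derivative_root (hPz i) (hroot i)
      exact Set.mem_iUnion.2 ⟨j, hj⟩
  refine measure_mono_null hcover (measure_union_null ?_ ?_)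
  · exact measure_iUnion_null fun j => euclideanHausdorffMeasure_multipleRoots
      (by have := hk r e he; omega) e P j
  · refine (measure_biUnion_null_iff
      (Ideal.finite_minimalPrimes_of_isNoetherianRing _ J).countable).2 fun p' hp' => ?_
    have hpp' : p ≤ p' := hpJ.le.trans hp'.1.2
    refine ih p' (lt_of_lt_of_le hpJ hp'.1.2) hp'.1.1 fun r e h => hk r e (h.mono hpp')

theorem vanishingIdeal_isPrime_of_zariskiIrreducible {ι : Type*} {V : Set (ι → ℂ)}
    (hV : ZariskiIrreducible V) : (vanishingIdeal ℂ V : Ideal (MvPolynomial ι ℂ)).IsPrime := by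
  obtain ⟨⟨x, hx⟩, h⟩ := hV
  refine ⟨fun htop => ?_, fun {f g} hfg => ?_⟩
  · have : (1 : MvPolynomial ι ℂ) ∈ vanishingIdeal ℂ V := htop ▸ Submodule.mem_top
    simpa using this x hx
  · have key : ∀ f : MvPolynomial ι ℂ, V ⊆ zeroLocus ℂ (Ideal.span {f}) →
        f ∈ vanishingIdeal ℂ V := fun f hf x hx => hf hx f (Ideal.mem_span_singleton_self f)
    refine (h (Ideal.span {f}) (Ideal.span {g}) fun x hx => ?_).imp (key f) (key g)
    have := hfg x hx
    rw [map_mul, mul_eq_zero] at this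
    rw [zeroLocus_span, zeroLocus_span]
    simpa using this

/-- A relation between `D` and some coordinates, read as a one-variable polynomial evaluated at `D`;
powers of `D` can then be divided out. -/
theorem aeval_cons_eq_eval₂ {ι : Type*} {r : ℕ} (e : Fin r → ι) (D : MvPolynomial ι ℂ)
    (F : MvPolynomial (Fin (r + 1)) ℂ) :
    aeval (Fin.cons D (fun j => X (e j)) : Fin (r + 1) → MvPolynomial ι ℂ) F =
      (finSuccEquiv ℂ r F).eval₂ (rename e : _ →ₐ[ℂ] MvPolynomial ι ℂ).toRingHom D := by
  induction F using MvPolynomial.induction_on with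
  | C a => simp [finSuccEquiv_apply, MvPolynomial.algebraMap_eq]
  | add f g hf hg => rw [map_add, map_add, Polynomial.eval₂_add, hf, hg]
  | mul_X f i hf =>
    rw [map_mul, map_mul, Polynomial.eval₂_mul, hf, aeval_X]
    congr 1
    refine Fin.cases ?_ (fun j => ?_) i
    · simp [finSuccEquiv_X_zero]
    · simp [finSuccEquiv_X_succ]

/-- If an irreducible set is dominated by a polynomial map from `ℂ^m`, then its proper algebraic
subsets are null for the Hausdorff measure of real dimension `2m`. -/
theorem euclideanHausdorffMeasure_inter_zero {ι τ : Type} [Fintype ι] [Fintype τ]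
    {V : Set (ι → ℂ)} (hV : ZariskiIrreducible V) (ψ : ι → MvPolynomial τ ℂ)
    (D : MvPolynomial ι ℂ)
    (hD : ∀ x ∈ V, eval x D ≠ 0 → ∃ y, (fun i => eval y (ψ i)) = x)
    (hne : ∃ x ∈ V, eval x D ≠ 0) :
    μHE[2 * Fintype.card τ] (V ∩ {x | eval x D = 0}) = 0 := by
  set I : Ideal (MvPolynomial ι ℂ) := vanishingIdeal ℂ V with hI
  have hIp : I.IsPrime := vanishingIdeal_isPrime_of_zariskiIrreducible hV
  have hDI : D ∉ I := fun h => by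
    obtain ⟨x, hx, hx0⟩ := hne
    exact hx0 (by simpa [aeval_eq_eval] using h x hx)
  have hcomp : ∀ f y, eval y (aeval ψ f) = eval (fun i => eval y (ψ i)) f := fun f y => by
    rw [← coe_aeval_eq_eval, ← coe_aeval_eq_eval]
    simp only [RingHom.coe_coe]
    rw [← AlgHom.comp_apply, comp_aeval]
  -- Domination: a polynomial that vanishes along `ψ` vanishes on `V` wherever `D ≠ 0`, so its
  -- product with `D` is in the prime ideal `I`, while `D` is not.
  have hker : ∀ f, aeval ψ f = 0 → f ∈ I := by
    intro f hf
    have hfD : f * D ∈ I := fun x hx => by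
      simp only [map_mul, aeval_eq_eval, mul_eq_zero]
      by_cases hx0 : eval x D = 0
      · exact Or.inr hx0
      · obtain ⟨y, rfl⟩ := hD x hx hx0
        left
        change eval _ f = 0
        rw [← hcomp, hf, map_zero]
    exact (hIp.mem_or_mem hfD).resolve_right hDI
  -- The dimension drops by one: coordinates independent modulo `p ∋ D` stay independent after `D`
  -- is adjoined and `p` is replaced by `I`. Pulled back along `ψ`, they are `r + 1` algebraically
  -- independent polynomials in `Fintype.card τ` variables.
  have key : ∀ p : Ideal (MvPolynomial ι ℂ), I ≤ p → D ∈ p → ∀ (r : ℕ) (e : Fin r → ι),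
      CoordIndep p e → r < Fintype.card τ := by
    intro p hIp' hDp r e he
    have hind : AlgebraicIndependent ℂ
        (aeval ψ ∘ (Fin.cons D (fun j => X (e j)) : Fin (r + 1) → MvPolynomial ι ℂ)) := by
      rw [algebraicIndependent_iff]
      intro F hF
      have hF' := hker _ ((comp_aeval_apply _ (aeval ψ) F).trans hF)
      rw [aeval_cons_eq_eval₂] at hF'
      by_contra hF0
      have hP0 : finSuccEquiv ℂ r F ≠ 0 := by simpa using hF0
      -- Since `D ∉ I` and `I` is prime, the largest power of `D` may be cancelled from the
      -- relation. Modulo `p` only the constant coefficient of `P` survives, and independence of the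
      -- coordinates forces it to vanish, although `X` does not divide `P`.
      obtain ⟨P, hPeq, hPX⟩ := Polynomial.exists_eq_pow_rootMultiplicity_mul_and_not_dvd _ hP0 0
      rw [hPeq, Polynomial.eval₂_mul, Polynomial.eval₂_pow] at hF'
      have hPI : P.eval₂ (rename e : _ →ₐ[ℂ] MvPolynomial ι ℂ).toRingHom D ∈ I := by
        refine (hIp.mem_or_mem hF').resolve_left fun h => hDI ?_
        simpa using hIp.mem_of_pow_mem _ h
      have hmod : rename e (P.coeff 0) ∈ p := by
        have h1 := hIp' hPI
        rw [← Polynomial.divX_mul_X_add P, Polynomial.eval₂_add, Polynomial.eval₂_mul,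
          Polynomial.eval₂_X, Polynomial.eval₂_C] at h1
        exact (Ideal.add_mem_iff_right _ (Ideal.mul_mem_left _ _ hDp)).1 h1
      refine hPX ?_
      rw [map_zero, sub_zero, Polynomial.X_dvd_iff]
      exact he _ hmod
    have := hind.cardinalMk_le_trdeg
    rw [MvPolynomial.trdeg_of_isDomain] at this
    simpa using this
  set J : Ideal (MvPolynomial ι ℂ) := I ⊔ Ideal.span {D} with hJ
  have hcover : V ∩ {x | eval x D = 0} ⊆ ⋃ p ∈ J.minimalPrimes, zeroLocus ℂ p := by
    rintro x ⟨hx, hxD⟩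
    have hJx : J ≤ vanishingIdeal ℂ {x} := by
      refine sup_le (fun f hf => ?_) (Ideal.span_le.2 ?_)
      · rw [mem_vanishingIdeal_singleton_iff]
        exact hf x hx
      · rw [Set.singleton_subset_iff, SetLike.mem_coe, mem_vanishingIdeal_singleton_iff]
        simpa [aeval_eq_eval] using hxD
    obtain ⟨p, hp, hle⟩ := Ideal.exists_minimalPrimes_le hJx
    refine Set.mem_biUnion hp fun f hf => ?_
    exact (mem_vanishingIdeal_singleton_iff x f).1 (hle hf)
  refine measure_mono_null hcover ((measure_biUnion_null_iff
    (Ideal.finite_minimalPrimes_of_isNoetherianRing _ J).countable).2 fun p hp => ?_)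
  have hkey := key p (le_sup_left.trans hp.1.2)
    (hp.1.2 (Ideal.mem_sup_right (Ideal.mem_span_singleton_self D)))
  -- The empty family already gives `0 < card τ`; this validates the truncated subtraction in `k =
  -- card τ - 1`, for which `2 * k < 2 * card τ`.
  have hm : 0 < Fintype.card τ := by
    refine hkey 0 Fin.elim0 fun F hF => ?_
    rw [MvPolynomial.eq_C_of_isEmpty F] at hF ⊢
    rw [rename_C] at hF
    by_contra hne
    refine hp.1.1.ne_top (Ideal.eq_top_of_isUnit_mem _ hF ?_)
    refine IsUnit.map C (isUnit_iff_ne_zero.2 fun h => hne ?_)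
    rw [h, map_zero]
  exact euclideanHausdorffMeasure_zeroLocus (k := Fintype.card τ - 1) (by omega) p hp.1.1
    fun r e he => by have := hkey r e he; omega

end AlgebraicNull

/-! ### Triangular matrices, their commutants and discriminants -/

section Matrices

variable {n : ℕ}

/-- A matrix intertwining two upper triangular matrices, on the strictly lower triangular part, is
upper triangular provided that the relevant diagonal entries are different. -/
theorem isUpperTriangular_of_intertwine {q q' W : Matrix (Fin n) (Fin n) ℂ}
    (hq : q.IsUpperTriangular) (hq' : q'.IsUpperTriangular)
    (hne : ∀ i j, j < i → q' i i ≠ q j j)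
    (h : ∀ i j, j < i → (q' * W) i j = (W * q) i j) : W.IsUpperTriangular := by
  -- Induction outward from the lower left corner: in the `(i, j)` entry of the relation, the other
  -- entries of `W` that occur lie below or to the left and are already zero.
  have key : ∀ m : ℕ, ∀ i j : Fin n, j < i → (n - i : ℕ) + j = m → W i j = 0 := by
    intro m
    induction m using Nat.strong_induction_on with
    | _ m ih =>
      intro i j hij hm
      have h1 := h i j hij
      rw [Matrix.mul_apply, Matrix.mul_apply, Finset.sum_eq_single i, Finset.sum_eq_single j] at h1
      · have h2 : (q' i i - q j j) * W i j = 0 := by linear_combination h1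
        exact (mul_eq_zero.1 h2).resolve_left (sub_ne_zero.2 (hne i j hij))
      · intro k _ hk
        rcases lt_or_gt_of_ne hk with hk | hk
        · rw [ih (n - i + k) (by omega) i k (hk.trans hij) rfl, zero_mul]
        · rw [hq hk, mul_zero]
      · simp
      · intro k _ hk
        rcases lt_or_gt_of_ne hk with hk | hk
        · rw [hq' hk, zero_mul]
        · rw [ih (n - k + j) (by omega) k j (hij.trans hk) rfl, mul_zero]
      · simp
  exact fun i j hij => key _ i j hij rfl

/-- The same elimination by superdiagonals: once the entries nearer to the diagonal vanish, the
commutation relation reads `(q i i - q j j) * Y i j = 0`. -/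
theorem eq_zero_of_commute_of_diag_eq_zero {q Y : Matrix (Fin n) (Fin n) ℂ}
    (hq : q.IsUpperTriangular) (hd : Function.Injective fun i => q i i)
    (hY : Y.IsUpperTriangular) (hY0 : ∀ i, Y i i = 0) (h : q * Y = Y * q) : Y = 0 := by
  have key : ∀ m : ℕ, ∀ i j : Fin n, i < j → (j - i : ℕ) = m → Y i j = 0 := by
    intro m
    induction m using Nat.strong_induction_on with
    | _ m ih =>
      intro i j hij hm
      have h1 := congrFun (congrFun h i) j
      rw [Matrix.mul_apply, Matrix.mul_apply, Finset.sum_eq_single i, Finset.sum_eq_single j] at h1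
      · have h2 : (q i i - q j j) * Y i j = 0 := by linear_combination h1
        exact (mul_eq_zero.1 h2).resolve_left (sub_ne_zero.2 fun h => hij.ne (hd h))
      · intro k _ hk
        rcases lt_or_gt_of_ne hk with hk | hk
        · rcases lt_trichotomy i k with hik | rfl | hik
          · rw [ih (k - i) (by omega) i k hik rfl, zero_mul]
          · rw [hY0, zero_mul]
          · rw [hY hik, zero_mul]
        · rw [hq hk, mul_zero]
      · simp
      · intro k _ hk
        rcases lt_or_gt_of_ne hk with hk | hk
        · rw [hq hk, zero_mul]
        · rcases lt_trichotomy k j with hkj | rfl | hkj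
          · rw [ih (j - k) (by omega) k j hkj rfl, mul_zero]
          · rw [hY0, mul_zero]
          · rw [hY hkj, mul_zero]
      · simp
  ext i j
  rcases lt_trichotomy i j with hij | rfl | hij
  · exact key _ i j hij rfl
  · exact hY0 i
  · exact hY hij

theorem isUpperTriangular_pow {q : Matrix (Fin n) (Fin n) ℂ} (hq : q.IsUpperTriangular) (k : ℕ) :
    (q ^ k).IsUpperTriangular ∧ ∀ i, (q ^ k) i i = q i i ^ k := by
  induction k with
  | zero => exact ⟨by simpa using Matrix.blockTriangular_one, by simp⟩
  | succ k ih =>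
    rw [pow_succ]
    refine ⟨ih.1.mul hq, fun i => ?_⟩
    rw [Matrix.mul_apply, Finset.sum_eq_single i, ih.2, pow_succ]
    · intro j _ hj
      rcases lt_or_gt_of_ne hj with hj | hj
      · rw [ih.1 hj, zero_mul]
      · rw [hq hj, mul_zero]
    · simp

/-- The polynomial `∑ j, c j • q ^ j` in a matrix. -/
def matPoly {R : Type*} [CommRing R] (c : Fin n → R) (q : Matrix (Fin n) (Fin n) R) :
    Matrix (Fin n) (Fin n) R :=
  ∑ j, c j • q ^ (j : ℕ)

theorem isUpperTriangular_matPoly (c : Fin n → ℂ) {q : Matrix (Fin n) (Fin n) ℂ}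
    (hq : q.IsUpperTriangular) : (matPoly c q).IsUpperTriangular := by
  intro i j hij
  simp only [matPoly, Matrix.sum_apply, Matrix.smul_apply]
  exact Finset.sum_eq_zero fun k _ => by rw [(isUpperTriangular_pow hq k).1 hij, smul_zero]

theorem matPoly_diag (c : Fin n → ℂ) {q : Matrix (Fin n) (Fin n) ℂ}
    (hq : q.IsUpperTriangular) (i : Fin n) :
    matPoly c q i i = (Matrix.vandermonde fun i => q i i).mulVec c i := by
  simp only [matPoly, Matrix.sum_apply, Matrix.smul_apply, (isUpperTriangular_pow hq _).2,
    Matrix.mulVec, dotProduct, Matrix.vandermonde_apply, smul_eq_mul, mul_comm]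

theorem commute_matPoly {R : Type*} [CommRing R] (c : Fin n → R) (q : Matrix (Fin n) (Fin n) R) :
    Commute q (matPoly c q) :=
  Commute.sum_right _ _ _ fun _ _ => ((Commute.refl q).pow_right _).smul_right _

theorem commute_matPoly_matPoly {R : Type*} [CommRing R] (c c' : Fin n → R)
    (q : Matrix (Fin n) (Fin n) R) : Commute (matPoly c q) (matPoly c' q) :=
  Commute.sum_left _ _ _ fun _ _ => ((commute_matPoly c' q).pow_left _).smul_left _

theorem isUpperTriangular_of_commute {q Y : Matrix (Fin n) (Fin n) ℂ}
    (hq : q.IsUpperTriangular) (hd : Function.Injective fun i => q i i)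
    (h : q * Y = Y * q) : Y.IsUpperTriangular :=
  isUpperTriangular_of_intertwine hq hq (fun _ _ hij h => hij.ne' (hd h)) fun i j _ => by rw [h]

/-- Interpolate the diagonal of `Y` at the distinct diagonal entries of `q`, by the Vandermonde
matrix. The difference commutes with `q` and has zero diagonal, hence is zero. -/
theorem exists_eq_matPoly {q Y : Matrix (Fin n) (Fin n) ℂ}
    (hq : q.IsUpperTriangular) (hd : Function.Injective fun i => q i i)
    (h : q * Y = Y * q) : ∃ c, Y = matPoly c q := by
  have hdet : IsUnit (Matrix.vandermonde fun i => q i i) :=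
    (Matrix.isUnit_iff_isUnit_det _).2 (isUnit_iff_ne_zero.2 (Matrix.det_vandermonde_ne_zero_iff.2 hd))
  obtain ⟨c, hc⟩ := (Matrix.mulVec_surjective_iff_isUnit.2 hdet) fun i => Y i i
  have hU := isUpperTriangular_matPoly c hq
  refine ⟨c, sub_eq_zero.1 (eq_zero_of_commute_of_diag_eq_zero hq hd
    ((isUpperTriangular_of_commute hq hd h).sub hU) (fun i => ?_) ?_)⟩
  · rw [Matrix.sub_apply, matPoly_diag c hq, hc, sub_self]
  · rw [mul_sub, sub_mul, h, (commute_matPoly c q).eq]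

theorem eq_of_matPoly_eq {q : Matrix (Fin n) (Fin n) ℂ} (hq : q.IsUpperTriangular)
    (hd : Function.Injective fun i => q i i) {c c' : Fin n → ℂ} (h : matPoly c q = matPoly c' q) :
    c = c' := by
  have hdet : IsUnit (Matrix.vandermonde fun i => q i i) :=
    (Matrix.isUnit_iff_isUnit_det _).2 (isUnit_iff_ne_zero.2 (Matrix.det_vandermonde_ne_zero_iff.2 hd))
  refine Matrix.mulVec_injective_iff_isUnit.2 hdet (funext fun i => ?_)
  rw [← matPoly_diag c hq, ← matPoly_diag c' hq, h]

theorem charpoly_eq_prod {q : Matrix (Fin n) (Fin n) ℂ} (hq : q.IsUpperTriangular) :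
    q.charpoly = ∏ i, (Polynomial.X - Polynomial.C (q i i)) :=
  Matrix.charpoly_of_isUpperTriangular q hq

theorem spectrum_eq_range_diag {q : Matrix (Fin n) (Fin n) ℂ} (hq : q.IsUpperTriangular) :
    spectrum ℂ q = Set.range fun i => q i i := by
  ext z
  rw [Matrix.mem_spectrum_iff_isRoot_charpoly, charpoly_eq_prod hq, Polynomial.IsRoot,
    Polynomial.eval_prod, Finset.prod_eq_zero_iff]
  simp [sub_eq_zero, eq_comm]

theorem ncard_spectrum_eq_iff {q : Matrix (Fin n) (Fin n) ℂ} (hq : q.IsUpperTriangular) :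
    (spectrum ℂ q).ncard = n ↔ Function.Injective fun i => q i i := by
  classical
  rw [spectrum_eq_range_diag hq, ← Set.image_univ, ← Finset.coe_univ, ← Finset.coe_image,
    Set.ncard_coe_finset]
  conv_lhs => rhs; rw [← Fintype.card_fin n, ← Finset.card_univ]
  rw [Finset.card_image_iff, Finset.coe_univ, Set.injOn_univ]

/-- A unitary matrix that intertwines upper triangular matrices with the same diagonal, without
repetitions, is diagonal. -/
theorem isDiag_of_conj_eq {q q' : Matrix (Fin n) (Fin n) ℂ} (hq : q.IsUpperTriangular)
    (hq' : q'.IsUpperTriangular) (hd : Function.Injective fun i => q i i)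
    (hqq' : ∀ i, q i i = q' i i) (W : UGroup n) (h : q' * W = W * q) :
    (W : Matrix (Fin n) (Fin n) ℂ).IsDiag := by
  have hW : (W : Matrix (Fin n) (Fin n) ℂ).IsUpperTriangular :=
    isUpperTriangular_of_intertwine hq hq' (fun i j hij h => hij.ne' (hd (by
      simpa [hqq'] using h))) fun i j _ => by rw [h]
  have hW' : (star W : Matrix (Fin n) (Fin n) ℂ).IsUpperTriangular := by
    have : Invertible (W : Matrix (Fin n) (Fin n) ℂ) :=
      ⟨star W, Matrix.UnitaryGroup.star_mul_self W, Matrix.mem_unitaryGroup_iff.1 W.2⟩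
    have h1 := Matrix.blockTriangular_inv_of_blockTriangular hW
    rwa [Matrix.inv_eq_left_inv (Matrix.UnitaryGroup.star_mul_self W)] at h1
  intro i j hij
  rcases lt_or_gt_of_ne hij with hij | hij
  · have := hW' hij
    simpa [Matrix.star_eq_conjTranspose] using this
  · exact hW hij

/-- The polynomial whose nonvanishing says that the eigenvalues are distinct. -/
def eigDisc {R : Type*} [CommRing R] (M : Matrix (Fin n) (Fin n) R) : R :=
  Polynomial.resultant M.charpoly (Polynomial.derivative M.charpoly) n (n - 1)

/-- The resultant is taken with fixed sizes `n` and `n - 1` instead of actual degrees, so it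
commutes with every ring homomorphism. Applied to evaluation, this shows that the discriminant is
polynomial in the entries. -/
theorem eigDisc_map {R S : Type*} [CommRing R] [CommRing S] (φ : R →+* S)
    (M : Matrix (Fin n) (Fin n) R) : eigDisc (M.map φ) = φ (eigDisc M) := by
  rw [eigDisc, Matrix.charpoly_map, Polynomial.derivative_map, Polynomial.resultant_map_map]
  rfl

/-- The resultant with the derivative is nonzero exactly when the characteristic polynomial is
separable; over `ℂ` this says that its `n` roots are distinct. -/
theorem eigDisc_ne_zero_iff (M : Matrix (Fin n) (Fin n) ℂ) :
    eigDisc M ≠ 0 ↔ (spectrum ℂ M).ncard = n := by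
  classical
  have hdeg : M.charpoly.natDegree = n := by
    simp [M.charpoly_natDegree_eq_dim]
  have hmon := M.charpoly_monic
  have hdeg' : (Polynomial.derivative M.charpoly).natDegree = n - 1 := by
    rw [Polynomial.natDegree_derivative, hdeg]
  have h1 : eigDisc M ≠ 0 ↔ M.charpoly.Separable := by
    have h2 : eigDisc M = Polynomial.resultant M.charpoly (Polynomial.derivative M.charpoly) := by
      rw [eigDisc, hdeg, hdeg']
    rw [h2, ← isUnit_iff_ne_zero, Polynomial.isUnit_resultant_iff_isCoprime hmon]
    rfl
  have h3 : spectrum ℂ M = (M.charpoly.roots.toFinset : Set ℂ) := by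
    ext z
    rw [Matrix.mem_spectrum_iff_isRoot_charpoly, Finset.mem_coe, Multiset.mem_toFinset,
      Polynomial.mem_roots hmon.ne_zero]
  have hs : M.charpoly.Splits := IsAlgClosed.splits _
  rw [h1, ← Polynomial.nodup_roots_iff_of_splits hmon.ne_zero hs, h3, Set.ncard_coe_finset]
  have hc : Multiset.card M.charpoly.roots = n := by
    rw [← hs.natDegree_eq_card_roots, hdeg]
  rw [← Multiset.toFinset_card_eq_card_iff_nodup, hc]

theorem eigDisc_conj (U : UGroup n) (M : Matrix (Fin n) (Fin n) ℂ) :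
    eigDisc ((U : Matrix (Fin n) (Fin n) ℂ) * M * star (U : Matrix (Fin n) (Fin n) ℂ)) =
      eigDisc M := by
  have h : ((U : Matrix (Fin n) (Fin n) ℂ) * M * star (U : Matrix (Fin n) (Fin n) ℂ)).charpoly =
      M.charpoly := by
    rw [Matrix.charpoly_mul_comm, ← mul_assoc, Matrix.UnitaryGroup.star_mul_self, one_mul]
  rw [eigDisc, h, eigDisc]

/-- Unitary triangularization with the eigenvalues in a prescribed order. -/
theorem exists_unitary_triangularization {M : Matrix (Fin n) (Fin n) ℂ} {z : Fin n → ℂ}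
    (hz : Function.Injective z) (hM : ∀ i, z i ∈ spectrum ℂ M) :
    ∃ (U : UGroup n) (q : Matrix (Fin n) (Fin n) ℂ), q.IsUpperTriangular ∧ (∀ i, q i i = z i) ∧
      M = U * q * star (U : Matrix (Fin n) (Fin n) ℂ) := by
  have hv : ∀ i, ∃ v, Module.End.HasEigenvector (Matrix.toLin' M) (z i) v := fun i =>
    (Module.End.hasEigenvalue_iff_mem_spectrum.2
      (by rw [Matrix.spectrum_toLin']; exact hM i)).exists_hasEigenvector
  choose v hv using hv
  have hli : LinearIndependent ℂ v :=
    Module.End.eigenvectors_linearIndependent' (Matrix.toLin' M) z hz v hv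
  let f : Fin n → EuclideanSpace ℂ (Fin n) := fun i => WithLp.toLp 2 (v i)
  have hfr : Module.finrank ℂ (EuclideanSpace ℂ (Fin n)) = Fintype.card (Fin n) := by simp
  -- Gram–Schmidt on eigenvectors listed in the order of `z`: if `V` has them as columns, `V = U R`
  -- with `R` upper triangular, so `U* M U = R diag(z) R⁻¹` is upper triangular with diagonal `z`.
  let u := InnerProductSpace.gramSchmidtOrthonormalBasis (𝕜 := ℂ) hfr f
  let U : Matrix (Fin n) (Fin n) ℂ := Matrix.of fun i j => u j i
  let V : Matrix (Fin n) (Fin n) ℂ := Matrix.of fun i j => v j i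
  have hU : star U * U = 1 := by
    ext i j
    have := orthonormal_iff_ite.1 u.orthonormal i j
    rw [EuclideanSpace.inner_eq_star_dotProduct] at this
    rw [Matrix.mul_apply, Matrix.one_apply, ← this]
    simp [dotProduct, U, mul_comm]
  have hU' : U * star U = 1 := mul_eq_one_comm.1 hU
  set R := star U * V with hR
  have hRu : R.IsUpperTriangular := by
    intro i j hij
    have := InnerProductSpace.gramSchmidtOrthonormalBasis_inv_triangular (𝕜 := ℂ) hfr f hij
    rw [EuclideanSpace.inner_eq_star_dotProduct] at this
    rw [hR, Matrix.mul_apply, ← this]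
    simp [dotProduct, U, V, u, f, mul_comm]
  have hMV : M * V = V * Matrix.diagonal z := by
    ext i j
    have := congrFun (hv j).apply_eq_smul i
    rw [Matrix.toLin'_apply] at this
    rw [Matrix.mul_diagonal, Matrix.mul_apply]
    simpa [Matrix.mulVec, dotProduct, V, mul_comm] using this
  have hVu : IsUnit V := by
    rw [← Matrix.linearIndependent_cols_iff_isUnit]
    exact hli
  have hRunit : IsUnit R := by
    rw [hR]
    exact (IsUnit.of_mul_eq_one _ hU).mul hVu
  set q := star U * M * U with hq
  have hqR : q * R = R * Matrix.diagonal z := by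
    rw [hq, hR, mul_assoc, ← mul_assoc U, hU', one_mul, mul_assoc, hMV, mul_assoc]
  have : Invertible R := hRunit.invertible
  have hq' : q = R * Matrix.diagonal z * R⁻¹ := by
    rw [← hqR, mul_assoc, Matrix.mul_inv_of_invertible, mul_one]
  have hqu : q.IsUpperTriangular := by
    rw [hq']
    exact (hRu.mul (Matrix.blockTriangular_diagonal z)).mul
      (Matrix.blockTriangular_inv_of_blockTriangular hRu)
  have hRd : ∀ i, R i i ≠ 0 := by
    have h1 := ((Matrix.isUnit_iff_isUnit_det R).1 hRunit).ne_zero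
    rw [Matrix.det_of_isUpperTriangular hRu] at h1
    exact fun i => Finset.prod_ne_zero_iff.1 h1 i (Finset.mem_univ i)
  refine ⟨⟨U, Matrix.mem_unitaryGroup_iff.2 hU'⟩, q, hqu, fun i => ?_, ?_⟩
  · have h1 := congrFun (congrFun hqR i) i
    rw [Matrix.mul_diagonal, Matrix.mul_apply, Finset.sum_eq_single i] at h1
    · exact mul_right_cancel₀ (hRd i) (by rw [h1, mul_comm])
    · intro j _ hj
      rcases lt_or_gt_of_ne hj with hj | hj
      · rw [hqu hj, zero_mul]
      · rw [hRu hj, mul_zero]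
    · simp
  · change M = U * (star U * M * U) * star U
    rw [mul_assoc, mul_assoc, mul_assoc, hU', mul_one, ← mul_assoc, hU', one_mul]

end Matrices

/-! ### Conjugation of tuples and genericity -/

section TupleBasics

variable {d n : ℕ}

@[simp]
theorem comp_ofComp (M : Fin d → Matrix (Fin n) (Fin n) ℂ) (r : Fin d) :
    comp (ofComp M) r = M r := rfl

@[simp]
theorem ofComp_comp (X : Tuple d n) : ofComp (comp X) = X := rfl

theorem tuple_ext {X Y : Tuple d n} (h : ∀ r, comp X r = comp Y r) : X = Y := by
  rw [← ofComp_comp X, ← ofComp_comp Y, funext h]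

@[simp]
theorem comp_conj (U : UGroup n) (X : Tuple d n) (r : Fin d) :
    comp (conj U X) r =
      (U : Matrix (Fin n) (Fin n) ℂ) * comp X r * star (U : Matrix (Fin n) (Fin n) ℂ) := rfl

@[simp]
theorem conj_one (X : Tuple d n) : conj (1 : UGroup n) X = X :=
  tuple_ext fun r => by simp

theorem conj_mul (U V : UGroup n) (X : Tuple d n) : conj (U * V) X = conj U (conj V X) :=
  tuple_ext fun r => by simp [mul_assoc]

theorem conj_inv_conj (U : UGroup n) (X : Tuple d n) : conj U⁻¹ (conj U X) = X := by
  rw [← conj_mul, inv_mul_cancel, conj_one]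

theorem conj_conj_inv (U : UGroup n) (X : Tuple d n) : conj U (conj U⁻¹ X) = X := by
  rw [← conj_mul, mul_inv_cancel, conj_one]

theorem unitary_conj_mul (U : UGroup n) (A B : Matrix (Fin n) (Fin n) ℂ) :
    (U : Matrix (Fin n) (Fin n) ℂ) * A * star (U : Matrix (Fin n) (Fin n) ℂ) *
      ((U : Matrix (Fin n) (Fin n) ℂ) * B * star (U : Matrix (Fin n) (Fin n) ℂ)) =
      (U : Matrix (Fin n) (Fin n) ℂ) * (A * B) * star (U : Matrix (Fin n) (Fin n) ℂ) := by
  calc _ = (U : Matrix (Fin n) (Fin n) ℂ) * A * (star (U : Matrix (Fin n) (Fin n) ℂ) * U) * B *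
        star (U : Matrix (Fin n) (Fin n) ℂ) := by simp only [mul_assoc]
    _ = _ := by rw [Matrix.UnitaryGroup.star_mul_self, mul_one]; simp only [mul_assoc]

theorem continuous_comp (r : Fin d) : Continuous fun X : Tuple d n => comp X r := by
  refine continuous_matrix fun i j => ?_
  exact PiLp.continuous_apply 2 (fun _ : Fin d × Fin n × Fin n => ℂ) (r, i, j)

theorem continuous_ofComp {T : Type*} [TopologicalSpace T]
    {f : T → Fin d → Matrix (Fin n) (Fin n) ℂ} (hf : ∀ r, Continuous fun t => f t r) :
    Continuous fun t => ofComp (f t) := by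
  refine (PiLp.continuous_toLp 2 _).comp (continuous_pi fun k => ?_)
  exact (hf k.1).matrix_elem k.2.1 k.2.2

theorem continuous_conj : Continuous fun p : UGroup n × Tuple d n => conj p.1 p.2 := by
  refine continuous_ofComp fun r => ?_
  have h1 : Continuous fun p : UGroup n × Tuple d n => (p.1 : Matrix (Fin n) (Fin n) ℂ) :=
    continuous_subtype_val.comp continuous_fst
  exact (h1.mul ((continuous_comp r).comp continuous_snd)).mul h1.star

theorem norm_sq_eq_sum_trace (X : Tuple d n) :
    ((‖X‖ ^ 2 : ℝ) : ℂ) = ∑ r, (comp X r * star (comp X r)).trace := by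
  rw [EuclideanSpace.norm_sq_eq, Fintype.sum_prod_type, Complex.ofReal_sum]
  refine Finset.sum_congr rfl fun r _ => ?_
  rw [Fintype.sum_prod_type, Complex.ofReal_sum, Matrix.trace]
  refine Finset.sum_congr rfl fun i _ => ?_
  rw [Matrix.diag_apply, Matrix.mul_apply, Complex.ofReal_sum]
  refine Finset.sum_congr rfl fun j _ => ?_
  rw [Matrix.star_apply]
  simp only [comp, Matrix.of_apply]
  rw [Complex.star_def, Complex.mul_conj, Complex.normSq_eq_norm_sq]

@[simp]
theorem norm_conj (U : UGroup n) (X : Tuple d n) : ‖conj U X‖ = ‖X‖ := by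
  have h : ((‖conj U X‖ ^ 2 : ℝ) : ℂ) = ((‖X‖ ^ 2 : ℝ) : ℂ) := by
    rw [norm_sq_eq_sum_trace, norm_sq_eq_sum_trace]
    refine Finset.sum_congr rfl fun r _ => ?_
    have hs : star (comp (conj U X) r) = (U : Matrix (Fin n) (Fin n) ℂ) * star (comp X r) *
        star (U : Matrix (Fin n) (Fin n) ℂ) := by
      simp [mul_assoc]
    rw [hs, comp_conj, unitary_conj_mul, Matrix.trace_mul_comm, ← mul_assoc,
      Matrix.UnitaryGroup.star_mul_self, one_mul]
  have h' : ‖conj U X‖ ^ 2 = ‖X‖ ^ 2 := by exact_mod_cast h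
  exact (sq_eq_sq₀ (norm_nonneg _) (norm_nonneg _)).1 h'

theorem conj_sub (U : UGroup n) (X Y : Tuple d n) : conj U X - conj U Y = conj U (X - Y) := by
  refine tuple_ext fun r => ?_
  have h : ∀ A B : Tuple d n, comp (A - B) r = comp A r - comp B r := fun A B => rfl
  rw [h, comp_conj, comp_conj, comp_conj, h, mul_sub, sub_mul]

theorem isometry_conj (U : UGroup n) : Isometry (conj U : Tuple d n → Tuple d n) :=
  Isometry.of_dist_eq fun X Y => by rw [dist_eq_norm, dist_eq_norm, conj_sub, norm_conj]

theorem conj_mem_commuting {U : UGroup n} {X : Tuple d n} (hX : X ∈ commuting d n) :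
    conj U X ∈ commuting d n := by
  intro r s
  rw [comp_conj, comp_conj, unitary_conj_mul, unitary_conj_mul, hX r s]

/-- The product of the discriminants of the components. -/
def tupleDisc (X : Tuple d n) : ℂ := ∏ r, eigDisc (comp X r)

/-- The polynomial that defines `tupleDisc`. -/
def discPoly (d n : ℕ) : MvPolynomial (Fin d × Fin n × Fin n) ℂ :=
  ∏ r, eigDisc (Matrix.of fun i j => MvPolynomial.X (r, i, j))

theorem eval_discPoly (X : Tuple d n) : MvPolynomial.eval X.ofLp (discPoly d n) = tupleDisc X := by
  rw [discPoly, map_prod]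
  refine Finset.prod_congr rfl fun r _ => ?_
  rw [← eigDisc_map]
  congr 1
  ext i j
  simp [comp]

theorem continuous_tupleDisc : Continuous (tupleDisc : Tuple d n → ℂ) := by
  have : (tupleDisc : Tuple d n → ℂ) = fun X => MvPolynomial.eval X.ofLp (discPoly d n) :=
    funext fun X => (eval_discPoly X).symm
  rw [this]
  exact (MvPolynomial.continuous_eval _).comp (PiLp.continuous_ofLp 2 _)

@[simp]
theorem tupleDisc_conj (U : UGroup n) (X : Tuple d n) : tupleDisc (conj U X) = tupleDisc X := by
  unfold tupleDisc
  refine Finset.prod_congr rfl fun r _ => ?_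
  rw [comp_conj, eigDisc_conj]

theorem mem_generic_iff {X : Tuple d n} :
    X ∈ generic d n ↔ X ∈ commuting d n ∧ tupleDisc X ≠ 0 := by
  simp only [generic, Set.mem_ofPred_eq, tupleDisc, Finset.prod_ne_zero_iff, Finset.mem_univ,
    true_implies, eigDisc_ne_zero_iff]

theorem conj_mem_generic {U : UGroup n} {X : Tuple d n} (hX : X ∈ generic d n) :
    conj U X ∈ generic d n := by
  rw [mem_generic_iff] at hX ⊢
  exact ⟨conj_mem_commuting hX.1, by simpa using hX.2⟩

theorem isClosed_commuting : IsClosed (commuting d n) := by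
  simp only [commuting, Set.ofPred_forall]
  refine isClosed_iInter fun r => isClosed_iInter fun s => isClosed_eq ?_ ?_
  · exact (continuous_comp r).mul (continuous_comp s)
  · exact (continuous_comp s).mul (continuous_comp r)

theorem isClosed_triangular : IsClosed (triangular d n) := by
  have : triangular d n = commuting d n ∩
      ⋂ r, ⋂ i, ⋂ j, ⋂ (_ : j < i), {X : Tuple d n | comp X r i j = 0} := by
    ext X
    simp [triangular]
  rw [this]
  refine isClosed_commuting.inter (isClosed_iInter fun r => isClosed_iInter fun i =>
    isClosed_iInter fun j => isClosed_iInter fun _ => isClosed_eq ?_ continuous_const)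
  exact (continuous_comp r).matrix_elem i j

theorem measurableSet_generic : MeasurableSet (generic d n) := by
  have : generic d n = commuting d n ∩ {X | tupleDisc X ≠ 0} := by
    ext X
    exact mem_generic_iff
  rw [this]
  exact isClosed_commuting.measurableSet.inter
    (isOpen_ne_fun continuous_tupleDisc continuous_const).measurableSet

theorem mem_triangular_iff {X : Tuple d n} :
    X ∈ triangular d n ↔ X ∈ commuting d n ∧ ∀ r, (comp X r).IsUpperTriangular :=
  and_congr_right fun _ => forall_congr' fun _ => ⟨fun h _ _ hij => h _ _ hij, fun h _ _ hij => h hij⟩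

theorem matPoly_conj (U : UGroup n) (c : Fin n → ℂ) (q : Matrix (Fin n) (Fin n) ℂ) :
    matPoly c ((U : Matrix (Fin n) (Fin n) ℂ) * q * star (U : Matrix (Fin n) (Fin n) ℂ)) =
      (U : Matrix (Fin n) (Fin n) ℂ) * matPoly c q * star (U : Matrix (Fin n) (Fin n) ℂ) := by
  have hU' := Matrix.mem_unitaryGroup_iff.1 U.2
  have hp : ∀ k : ℕ, ((U : Matrix (Fin n) (Fin n) ℂ) * q *
      star (U : Matrix (Fin n) (Fin n) ℂ)) ^ k =
      (U : Matrix (Fin n) (Fin n) ℂ) * q ^ k * star (U : Matrix (Fin n) (Fin n) ℂ) := by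
    intro k
    induction k with
    | zero => simp [hU']
    | succ k ih =>
      rw [pow_succ, ih, pow_succ, unitary_conj_mul]
  simp only [matPoly, hp, Finset.mul_sum, Finset.sum_mul, mul_smul_comm, smul_mul_assoc]

/-- In a generic tuple, all matrices are polynomials in the first one. -/
theorem exists_matPoly_of_generic {X : Tuple (d + 1) n} (hX : X ∈ generic (d + 1) n)
    (r : Fin (d + 1)) : ∃ c, comp X r = matPoly c (comp X 0) := by
  obtain ⟨z, hz, hzs⟩ : ∃ z : Fin n → ℂ, Function.Injective z ∧
      ∀ i, z i ∈ spectrum ℂ (comp X 0) := by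
    have h := hX.2 0
    rw [← Nat.card_coe_set_eq] at h
    rcases Nat.eq_zero_or_pos n with rfl | hn
    · exact ⟨Fin.elim0, fun i => i.elim0, fun i => i.elim0⟩
    have : Finite (spectrum ℂ (comp X 0)) := Nat.finite_of_card_ne_zero (by omega)
    obtain e := Finite.equivFinOfCardEq h
    exact ⟨fun i => e.symm i, Subtype.val_injective.comp e.symm.injective, fun i => (e.symm i).2⟩
  obtain ⟨U, q, hq, hqz, hXq⟩ := exists_unitary_triangularization hz hzs
  have hd : Function.Injective fun i => q i i := by simpa [hqz] using hz
  have hU := Matrix.UnitaryGroup.star_mul_self U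
  have hU' := Matrix.mem_unitaryGroup_iff.1 U.2
  have hcomm : q * (star (U : Matrix (Fin n) (Fin n) ℂ) * comp X r * U) =
      star (U : Matrix (Fin n) (Fin n) ℂ) * comp X r * U * q := by
    have h1 := hX.1 0 r
    rw [hXq] at h1
    calc q * (star (U : Matrix (Fin n) (Fin n) ℂ) * comp X r * U)
        = star (U : Matrix (Fin n) (Fin n) ℂ) *
          (U * q * star (U : Matrix (Fin n) (Fin n) ℂ) * comp X r) * U := by
          simp only [← mul_assoc, hU, one_mul]
      _ = _ := by rw [h1]; simp only [mul_assoc, hU, mul_one]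
  obtain ⟨c, hc⟩ := exists_eq_matPoly hq hd hcomm
  refine ⟨c, ?_⟩
  rw [hXq, matPoly_conj, ← hc]
  simp only [← mul_assoc, hU', one_mul]
  rw [mul_assoc, hU', mul_one]

/-- The components of the polynomial parametrization of the generic tuples by a matrix and the
coefficients of `d` polynomials. -/
def paramPoly (d n : ℕ) (k : Fin (d + 1) × Fin n × Fin n) :
    MvPolynomial ((Fin n × Fin n) ⊕ (Fin d × Fin n)) ℂ :=
  Fin.cases (MvPolynomial.X (Sum.inl k.2))
    (fun r => matPoly (fun l => MvPolynomial.X (Sum.inr (r, l)))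
      (Matrix.of fun i j => MvPolynomial.X (Sum.inl (i, j))) k.2.1 k.2.2) k.1

theorem matPoly_map {R S : Type*} [CommRing R] [CommRing S] (φ : R →+* S) (c : Fin n → R)
    (q : Matrix (Fin n) (Fin n) R) : (matPoly c q).map φ = matPoly (φ ∘ c) (q.map φ) := by
  have h : ∀ k : ℕ, (q ^ k).map φ = (q.map φ) ^ k := fun k => by
    simpa using map_pow (RingHom.mapMatrix φ) q k
  ext i j
  simp [matPoly, Matrix.sum_apply, ← h]

theorem exists_mem_generic : ∃ X : Tuple d n, X ∈ generic d n := by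
  let q : Matrix (Fin n) (Fin n) ℂ := Matrix.diagonal fun i => ((i : ℕ) : ℂ)
  have hq : q.IsUpperTriangular := Matrix.blockTriangular_diagonal _
  refine ⟨ofComp fun _ => q, fun r s => rfl, fun r => (ncard_spectrum_eq_iff hq).2 ?_⟩
  intro i j hij
  simpa [q, Fin.ext_iff] using hij

/-- If the variety of commuting tuples is irreducible, then almost all its points are generic. -/
theorem euclideanHausdorffMeasure_commuting_diff_generic
    (h : CommutingIrreducible (d + 1) n) :
    μHE[2 * n ^ 2 + 2 * d * n] (commuting (d + 1) n \ generic (d + 1) n) = 0 := by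
  have h1 := euclideanHausdorffMeasure_inter_zero h (paramPoly d n) (discPoly (d + 1) n)
    (by
      rintro _ ⟨X, hX, rfl⟩ hD
      change MvPolynomial.eval X.ofLp _ ≠ 0 at hD
      rw [eval_discPoly] at hD
      choose c hc using exists_matPoly_of_generic (mem_generic_iff.2 ⟨hX, hD⟩)
      refine ⟨Sum.elim (fun k => comp X 0 k.1 k.2) fun k => c k.1.succ k.2, ?_⟩
      funext ⟨r, i, j⟩
      refine Fin.cases ?_ (fun r => ?_) r
      · simp [paramPoly, comp]
      · simp only [paramPoly, Fin.cases_succ]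
        have h2 := congrFun (congrFun (matPoly_map (MvPolynomial.eval
          (Sum.elim (fun k : Fin n × Fin n => comp X 0 k.1 k.2)
            fun k : Fin d × Fin n => c k.1.succ k.2))
          (fun l => MvPolynomial.X (Sum.inr (r, l)))
          (Matrix.of fun i j => MvPolynomial.X (Sum.inl (i, j)))) i) j
        rw [Matrix.map_apply] at h2
        rw [h2]
        have h3 := congrFun (congrFun (hc r.succ) i) j
        have h4 : X.ofLp (r.succ, i, j) = comp X r.succ i j := rfl
        rw [h4, h3]
        have h5 : (⇑(MvPolynomial.eval (Sum.elim (fun k : Fin n × Fin n => comp X 0 k.1 k.2)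
            fun k : Fin d × Fin n => c k.1.succ k.2)) ∘
              fun l => MvPolynomial.X (Sum.inr (r, l))) = c r.succ := by
          funext l
          simp
        have h6 : (Matrix.of fun i j => MvPolynomial.X (Sum.inl (i, j))).map
            ⇑(MvPolynomial.eval (Sum.elim (fun k : Fin n × Fin n => comp X 0 k.1 k.2)
            fun k : Fin d × Fin n => c k.1.succ k.2)) = comp X 0 := by
          ext i j
          simp
        rw [h5, h6])
    (by
      obtain ⟨X, hX⟩ := exists_mem_generic (d := d + 1) (n := n)
      refine ⟨_, ⟨X, hX.1, rfl⟩, ?_⟩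
      change MvPolynomial.eval X.ofLp _ ≠ 0
      rw [eval_discPoly]
      exact (mem_generic_iff.1 hX).2)
  -- Twice the number of parameters is exactly the dimension of `dX` for tuples of length `d + 1`.
  have hcard : 2 * Fintype.card ((Fin n × Fin n) ⊕ (Fin d × Fin n)) = 2 * n ^ 2 + 2 * d * n := by
    simp
    ring
  rw [hcard] at h1
  have hsub : commuting (d + 1) n \ generic (d + 1) n ⊆ WithLp.toLp 2 ''
      ((fun X : Tuple (d + 1) n => (X : Fin (d + 1) × Fin n × Fin n → ℂ)) '' commuting (d + 1) n ∩
        {x | MvPolynomial.eval x (discPoly (d + 1) n) = 0}) := by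
    rintro X ⟨hX, hXg⟩
    refine ⟨X.ofLp, ⟨⟨X, hX, rfl⟩, ?_⟩, rfl⟩
    rw [Set.mem_ofPred_eq, eval_discPoly]
    by_contra hD
    exact hXg (mem_generic_iff.2 ⟨hX, hD⟩)
  refine measure_mono_null hsub ?_
  -- The algebraic argument takes place in the sup norm. Passing to the Frobenius norm is a
  -- Lipschitz map, so it preserves null sets.
  have hL := PiLp.lipschitzWith_toLp 2 fun _ : Fin (d + 1) × Fin n × Fin n => ℂ
  have h2 := euclideanHausdorffMeasure_image_le_of_dist_le (f := id)
    (g := (WithLp.toLp 2 : (Fin (d + 1) × Fin n × Fin n → ℂ) → Tuple (d + 1) n))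
    (t := (fun X : Tuple (d + 1) n => (X : Fin (d + 1) × Fin n × Fin n → ℂ)) ''
      commuting (d + 1) n ∩ {x | MvPolynomial.eval x (discPoly (d + 1) n) = 0})
    (2 * n ^ 2 + 2 * d * n) fun x _ y _ => hL.dist_le_mul x y
  rw [Set.image_id, h1, mul_zero] at h2
  exact le_antisymm h2 zero_le

end TupleBasics

/-! ### Parametrization of the generic triangular tuples -/

section Param

open scoped Matrix.Norms.Operator

variable {d n : ℕ}

/-- Parameters for the generic upper triangular commuting `(d + 1)`-tuples: the entries of the first
matrix and the coefficients of `d` polynomials. -/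
abbrev ParamSpace (d n : ℕ) : Type :=
  ({p : Fin n × Fin n // p.1 ≤ p.2} → ℂ) × (Fin d → Fin n → ℂ)

/-- The upper triangular matrix with given entries. -/
def triMat : ({p : Fin n × Fin n // p.1 ≤ p.2} → ℂ) →L[ℝ] Matrix (Fin n) (Fin n) ℂ :=
  LinearMap.toContinuousLinearMap
    { toFun := fun a => Matrix.of fun i j => if h : i ≤ j then a ⟨(i, j), h⟩ else 0
      map_add' := fun a b => by
        ext i j
        by_cases h : i ≤ j <;> simp [h]
      map_smul' := fun c a => by
        ext i j
        by_cases h : i ≤ j <;> simp [h] }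

theorem triMat_apply (a : {p : Fin n × Fin n // p.1 ≤ p.2} → ℂ) (i j : Fin n) :
    triMat a i j = if h : i ≤ j then a ⟨(i, j), h⟩ else 0 := rfl

theorem isUpperTriangular_triMat (a : {p : Fin n × Fin n // p.1 ≤ p.2} → ℂ) :
    (triMat a).IsUpperTriangular := fun i j (hij : j < i) => by
  rw [triMat_apply, dif_neg hij.not_ge]

theorem triMat_injective : Function.Injective (triMat (n := n)) := by
  intro a b h
  funext ⟨⟨i, j⟩, hij⟩
  have hij' : i ≤ j := hij
  have := congrFun (congrFun h i) j
  simpa [triMat_apply, hij'] using this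

theorem exists_triMat_eq {q : Matrix (Fin n) (Fin n) ℂ} (hq : q.IsUpperTriangular) :
    ∃ a, triMat a = q := by
  refine ⟨fun p => q p.1.1 p.1.2, ?_⟩
  ext i j
  rw [triMat_apply]
  split_ifs with h
  · rfl
  · exact (hq (not_le.1 h)).symm

/-- `comp` as a continuous linear map. -/
def compL (r : Fin d) : Tuple d n →L[ℝ] Matrix (Fin n) (Fin n) ℂ :=
  LinearMap.toContinuousLinearMap
    { toFun := fun X => comp X r
      map_add' := fun _ _ => rfl
      map_smul' := fun _ _ => rfl }

@[simp]
theorem compL_apply (r : Fin d) (X : Tuple d n) : compL r X = comp X r := rfl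

/-- `ofComp` as a continuous linear map. -/
def ofCompL : (Fin d → Matrix (Fin n) (Fin n) ℂ) →L[ℝ] Tuple d n :=
  LinearMap.toContinuousLinearMap
    { toFun := ofComp
      map_add' := fun _ _ => rfl
      map_smul' := fun _ _ => rfl }

theorem contDiff_ofComp {E : Type*} [NormedAddCommGroup E] [NormedSpace ℝ E]
    {f : E → Fin d → Matrix (Fin n) (Fin n) ℂ} (hf : ∀ r, ContDiff ℝ 1 fun x => f x r) :
    ContDiff ℝ 1 fun x => ofComp (f x) :=
  (ofCompL (d := d) (n := n)).contDiff.comp (contDiff_pi.2 hf)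

/-- The parametrization of the generic upper triangular commuting tuples. -/
def param (e : ParamSpace d n) : Tuple (d + 1) n :=
  ofComp (Fin.cases (triMat e.1) fun r => matPoly (e.2 r) (triMat e.1))

@[simp]
theorem comp_param_zero (e : ParamSpace d n) : comp (param e) 0 = triMat e.1 := rfl

@[simp]
theorem comp_param_succ (e : ParamSpace d n) (r : Fin d) :
    comp (param e) r.succ = matPoly (e.2 r) (triMat e.1) := rfl

theorem contDiff_param : ContDiff ℝ 1 (param : ParamSpace d n → Tuple (d + 1) n) := by
  refine contDiff_ofComp fun r => ?_
  have h1 : ContDiff ℝ 1 fun e : ParamSpace d n => triMat e.1 :=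
    triMat.contDiff.comp contDiff_fst
  refine Fin.cases h1 (fun r => ?_) r
  change ContDiff ℝ 1 fun e : ParamSpace d n => matPoly (e.2 r) (triMat e.1)
  unfold matPoly
  refine ContDiff.sum fun j _ => ?_
  have h2 : ContDiff ℝ 1 fun e : ParamSpace d n => e.2 := contDiff_snd
  have h3 := (contDiff_pi.1 (contDiff_pi.1 h2 r) j).smul (h1.pow (j : ℕ))
  exact h3

theorem param_mem_triangular (e : ParamSpace d n) : param e ∈ triangular (d + 1) n := by
  rw [mem_triangular_iff]
  refine ⟨fun r s => ?_, fun r => ?_⟩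
  · refine Fin.cases ?_ (fun r => ?_) r <;> refine Fin.cases ?_ (fun s => ?_) s
    · rfl
    · exact commute_matPoly _ _
    · exact (commute_matPoly _ _).symm
    · exact commute_matPoly_matPoly _ _ _
  · refine Fin.cases ?_ (fun r => ?_) r
    · exact isUpperTriangular_triMat _
    · exact isUpperTriangular_matPoly _ (isUpperTriangular_triMat _)

/-- The parameters of the generic tuples. -/
def paramDom (d n : ℕ) : Set (ParamSpace d n) := {e | param e ∈ generic (d + 1) n}

theorem mem_paramDom_iff {e : ParamSpace d n} : e ∈ paramDom d n ↔ tupleDisc (param e) ≠ 0 := by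
  change param e ∈ generic (d + 1) n ↔ _
  rw [mem_generic_iff]
  exact and_iff_right (param_mem_triangular e).1

theorem isOpen_paramDom : IsOpen (paramDom d n) := by
  have : paramDom d n = {e | tupleDisc (param e) ≠ 0} := by
    ext e
    exact mem_paramDom_iff
  rw [this]
  exact isOpen_ne_fun (continuous_tupleDisc.comp contDiff_param.continuous) continuous_const

theorem diag_injective_of_mem_generic {Q : Tuple d n} (hQ : Q ∈ triangular d n)
    (hQ' : Q ∈ generic d n) (r : Fin d) : Function.Injective fun i => comp Q r i i :=
  (ncard_spectrum_eq_iff ((mem_triangular_iff.1 hQ).2 r)).1 (hQ'.2 r)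

theorem diag_injective_of_mem_paramDom {e : ParamSpace d n} (he : e ∈ paramDom d n) :
    Function.Injective fun i => triMat e.1 i i :=
  diag_injective_of_mem_generic (param_mem_triangular e) he 0

theorem injOn_param : Set.InjOn param (paramDom d n) := by
  intro e he e' _ h
  have h0 : e.1 = e'.1 := triMat_injective (by rw [← comp_param_zero, h, comp_param_zero])
  refine Prod.ext h0 (funext fun r => ?_)
  refine eq_of_matPoly_eq (isUpperTriangular_triMat e.1) (diag_injective_of_mem_paramDom he) ?_
  rw [← comp_param_succ, h, comp_param_succ, h0]

theorem image_param_paramDom :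
    param '' paramDom d n = triangular (d + 1) n ∩ generic (d + 1) n := by
  refine Set.Subset.antisymm ?_ ?_
  · rintro _ ⟨e, he, rfl⟩
    exact ⟨param_mem_triangular e, he⟩
  · rintro Q ⟨hQ, hQg⟩
    have hd := diag_injective_of_mem_generic hQ hQg 0
    rw [mem_triangular_iff] at hQ
    obtain ⟨a, ha⟩ := exists_triMat_eq (hQ.2 0)
    choose c hc using fun r : Fin d => exists_eq_matPoly (hQ.2 0) hd (hQ.1 0 r.succ)
    have h : param (a, c) = Q := by
      refine tuple_ext fun r => Fin.cases ?_ (fun r => ?_) r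
      · rw [comp_param_zero, ha]
      · rw [comp_param_succ, ha, hc]
    exact ⟨(a, c), by rw [← h] at hQg; exact hQg, h⟩

/-! ### Tangent vectors -/

theorem hasDerivAt_line {E : Type*} [NormedAddCommGroup E] [NormedSpace ℝ E] (a b : E) :
    HasDerivAt (fun t : ℝ => a + t • b) b 0 := by
  have h := ((hasDerivAt_id (0 : ℝ)).smul_const b).const_add a
  rw [one_smul] at h
  exact h

/-- Differentiate the defining equations along the curve: triangularity is linear, and commutation
gives its linearisation. -/
theorem tangent_equations {γ : ℝ → Tuple d n} {Z : Tuple d n}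
    (hγ : HasDerivAt γ Z 0) (hmem : ∀ᶠ t in 𝓝 0, γ t ∈ triangular d n) :
    (∀ r, (comp Z r).IsUpperTriangular) ∧ ∀ r s, comp Z r * comp (γ 0) s +
      comp (γ 0) r * comp Z s = comp Z s * comp (γ 0) r + comp (γ 0) s * comp Z r := by
  have hc : ∀ r, HasDerivAt (fun t => comp (γ t) r) (comp Z r) 0 := fun r =>
    (compL r).hasFDerivAt.comp_hasDerivAt 0 hγ
  refine ⟨fun r i j hij => ?_, fun r s => ?_⟩
  · have h1 : HasDerivAt (fun t => comp (γ t) r i j) (comp Z r i j) 0 := by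
      let L : Matrix (Fin n) (Fin n) ℂ →L[ℝ] ℂ :=
        LinearMap.toContinuousLinearMap (Matrix.entryLinearMap ℝ ℂ i j)
      exact L.hasFDerivAt.comp_hasDerivAt 0 (hc r)
    have h2 : (fun t => comp (γ t) r i j) =ᶠ[𝓝 0] fun _ => 0 :=
      hmem.mono fun t ht => (mem_triangular_iff.1 ht).2 r hij
    exact h1.unique ((hasDerivAt_const (0 : ℝ) (0 : ℂ)).congr_of_eventuallyEq h2)
  · have h1 := (hc r).mul (hc s)
    have h2 := (hc s).mul (hc r)
    have h3 : ((fun t => comp (γ t) r) * fun t => comp (γ t) s) =ᶠ[𝓝 0]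
        (fun t => comp (γ t) s) * fun t => comp (γ t) r :=
      hmem.mono fun t ht => ht.1 r s
    exact h1.unique (h2.congr_of_eventuallyEq h3)

theorem hasDerivAt_param_line (e e' : ParamSpace d n) :
    HasDerivAt (fun t : ℝ => param (e + t • e')) (fderiv ℝ param e e') 0 := by
  have h1 := hasDerivAt_line e e'
  have h2 : HasFDerivAt param (fderiv ℝ param e) (e + (0 : ℝ) • e') := by
    simpa using (contDiff_param.differentiable one_ne_zero e).hasFDerivAt
  exact h2.comp_hasDerivAt 0 h1

theorem comp_fderiv_param_zero (e e' : ParamSpace d n) :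
    comp (fderiv ℝ param e e') 0 = triMat e'.1 := by
  have h1 := (compL (0 : Fin (d + 1))).hasFDerivAt.comp_hasDerivAt 0 (hasDerivAt_param_line e e')
  have h2 := hasDerivAt_line (triMat e.1) (triMat e'.1)
  refine h1.unique (h2.congr_of_eventuallyEq (Eventually.of_forall fun t => ?_))
  simp

theorem comp_fderiv_param_succ (e : ParamSpace d n) (c : Fin d → Fin n → ℂ) (r : Fin d) :
    comp (fderiv ℝ param e (0, c)) r.succ = matPoly (c r) (triMat e.1) := by
  have h1 := (compL r.succ).hasFDerivAt.comp_hasDerivAt 0 (hasDerivAt_param_line e (0, c))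
  have h2 := hasDerivAt_line (matPoly (e.2 r) (triMat e.1)) (matPoly (c r) (triMat e.1))
  refine h1.unique (h2.congr_of_eventuallyEq (Eventually.of_forall fun t => ?_))
  simp [matPoly, add_smul, Finset.sum_add_distrib, Finset.smul_sum, mul_smul]

theorem fderiv_param_injective {e : ParamSpace d n} (he : e ∈ paramDom d n) :
    Function.Injective (fderiv ℝ param e) := by
  rw [injective_iff_map_eq_zero]
  rintro ⟨a, c⟩ h
  have ha : a = 0 := triMat_injective (by
    rw [map_zero, ← comp_fderiv_param_zero e (a, c), h]
    rfl)
  subst ha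
  refine Prod.ext rfl (funext fun r => ?_)
  refine eq_of_matPoly_eq (isUpperTriangular_triMat e.1) (diag_injective_of_mem_paramDom he) ?_
  rw [← comp_fderiv_param_succ, h]
  simp [matPoly]
  rfl

/-- Subtract a derivative of `param` with the same first component as `Z`. What is left commutes
with the first matrix, hence consists of polynomials in it, and these are derivatives in the
coefficient directions. -/
theorem mem_range_fderiv_param {e : ParamSpace d n} (he : e ∈ paramDom d n) {Z : Tuple (d + 1) n}
    (hZ : (comp Z 0).IsUpperTriangular)
    (hZ' : ∀ s, comp Z 0 * comp (param e) s + comp (param e) 0 * comp Z s =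
      comp Z s * comp (param e) 0 + comp (param e) s * comp Z 0) :
    ∃ e', fderiv ℝ param e e' = Z := by
  obtain ⟨a, ha⟩ := exists_triMat_eq hZ
  set Y := fderiv ℝ param e (a, 0) with hY
  have hY0 : comp Y 0 = comp Z 0 := by rw [hY, comp_fderiv_param_zero, ha]
  have hYt := tangent_equations (hasDerivAt_param_line e (a, 0))
    (Eventually.of_forall fun t => param_mem_triangular _)
  simp only [zero_smul, add_zero] at hYt
  have hcomm : ∀ s, triMat e.1 * (comp Z s - comp Y s) = (comp Z s - comp Y s) * triMat e.1 := by
    intro s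
    have h1 := hZ' s
    have h2 := hYt.2 0 s
    rw [← hY, hY0] at h2
    rw [comp_param_zero] at h1 h2
    rw [mul_sub, sub_mul]
    have h3 := congrArg₂ (· - ·) h1 h2
    simp only [add_sub_add_left_eq_sub, add_sub_add_right_eq_sub] at h3
    exact h3
  choose c hc using fun r : Fin d => exists_eq_matPoly (isUpperTriangular_triMat e.1)
    (diag_injective_of_mem_paramDom he) (hcomm r.succ)
  refine ⟨(a, c), ?_⟩
  have hac : ((a, c) : ParamSpace d n) = (a, 0) + (0, c) := by simp
  rw [hac, map_add, ← hY]
  refine tuple_ext fun r => ?_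
  change comp Y r + comp (fderiv ℝ param e (0, c)) r = comp Z r
  refine Fin.cases ?_ (fun r => ?_) r
  · rw [hY0, comp_fderiv_param_zero]
    simp
  · rw [comp_fderiv_param_succ, ← hc]
    abel

/-- Velocities of curves solve the linearised equations, whose solutions at a generic point lie in
the range; conversely, lines in parameter space give curves of triangular tuples. -/
theorem tangentSpaceOf_param {e : ParamSpace d n} (he : e ∈ paramDom d n) :
    tangentSpaceOf (triangular (d + 1) n) (param e) =
      LinearMap.range (fderiv ℝ param e : ParamSpace d n →ₗ[ℝ] Tuple (d + 1) n) := by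
  refine le_antisymm (Submodule.span_le.2 ?_) ?_
  · rintro Z ⟨γ, -, hmem, hγ0, hγ⟩
    have h := tangent_equations hγ hmem
    rw [hγ0] at h
    exact mem_range_fderiv_param he (h.1 0) fun s => h.2 0 s
  · rintro _ ⟨e', rfl⟩
    refine Submodule.subset_span ⟨fun t : ℝ => param (e + t • e'), ?_, ?_, by simp,
      hasDerivAt_param_line e e'⟩
    · exact (contDiff_param.comp (by fun_prop)).contDiffAt
    · exact Eventually.of_forall fun t => param_mem_triangular _

end Param

/-! ### Conjugation by exponentials and its Jacobian -/

section Exponential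

open scoped Matrix.Norms.Operator

variable {d n : ℕ}

/-- `skewMat` as a continuous linear map. -/
def skewMatL : skewZeroDiag n →L[ℝ] Matrix (Fin n) (Fin n) ℂ :=
  LinearMap.toContinuousLinearMap
    { toFun := skewMat
      map_add' := fun _ _ => rfl
      map_smul' := fun _ _ => rfl }

theorem star_skewMat (S : skewZeroDiag n) : star (skewMat S) = -skewMat S := by
  ext i j
  exact S.2.1 i j

theorem skewMat_diag (S : skewZeroDiag n) (i : Fin n) : skewMat S i i = 0 := S.2.2 i

theorem skewMat_injective : Function.Injective (skewMat (n := n)) := by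
  intro S T h
  refine Subtype.ext (PiLp.ext fun k => ?_)
  exact congrFun (congrFun h k.1) k.2

theorem skewMat_eq_zero_of_isUpperTriangular {S : skewZeroDiag n}
    (hS : (skewMat S).IsUpperTriangular) : S = 0 := by
  refine skewMat_injective ?_
  change skewMat S = 0
  ext i j
  rcases lt_trichotomy i j with h | rfl | h
  · have h1 : star (skewMat S j i) = -skewMat S i j := congrFun (congrFun (star_skewMat S) i) j
    have h2 : skewMat S j i = 0 := hS h
    rw [h2, star_zero] at h1
    exact neg_eq_zero.1 h1.symm
  · exact skewMat_diag S i
  · exact hS h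

theorem star_exp_skewMat (S : skewZeroDiag n) :
    star (NormedSpace.exp (skewMat S)) = NormedSpace.exp (-skewMat S) := by
  rw [Matrix.star_eq_conjTranspose, ← Matrix.exp_conjTranspose, ← Matrix.star_eq_conjTranspose,
    star_skewMat]

theorem exp_skewMat_mem (S : skewZeroDiag n) :
    NormedSpace.exp (skewMat S) ∈ Matrix.unitaryGroup (Fin n) ℂ := by
  have h : Commute (skewMat S) (-skewMat S) := (Commute.refl (skewMat S)).neg_right
  rw [Matrix.mem_unitaryGroup_iff, star_exp_skewMat, ← Matrix.exp_add_of_commute _ _ h,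
    add_neg_cancel, NormedSpace.exp_zero]

/-- The unitary matrix `e^S`. -/
def expU (S : skewZeroDiag n) : UGroup n :=
  ⟨NormedSpace.exp (skewMat S), exp_skewMat_mem S⟩

theorem star_coe_expU (S : skewZeroDiag n) :
    star (expU S : Matrix (Fin n) (Fin n) ℂ) = NormedSpace.exp (-skewMat S) :=
  star_exp_skewMat S

theorem contDiff_matrix_exp : ContDiff ℝ 1 (NormedSpace.exp : Matrix (Fin n) (Fin n) ℂ → _) :=
  contDiff_iff_contDiffAt.2 fun A => (NormedSpace.exp_analytic (𝕂 := ℝ) A).contDiffAt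

theorem continuous_expU : Continuous (expU : skewZeroDiag n → UGroup n) :=
  Continuous.subtype_mk (contDiff_matrix_exp.continuous.comp skewMatL.continuous) _

/-- Conjugation of the parametrized upper triangular tuples by exponentials. -/
def flow (p : ParamSpace d n × skewZeroDiag n) : Tuple (d + 1) n := conj (expU p.2) (param p.1)

theorem contDiff_flow :
    ContDiff ℝ 1 (flow : ParamSpace d n × skewZeroDiag n → Tuple (d + 1) n) := by
  refine contDiff_ofComp (f := fun (p : ParamSpace d n × skewZeroDiag n) r =>
    (expU p.2 : Matrix (Fin n) (Fin n) ℂ) * comp (param p.1) r *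
      star (expU p.2 : Matrix (Fin n) (Fin n) ℂ)) fun r => ?_
  have h1 : ContDiff ℝ 1 fun p : ParamSpace d n × skewZeroDiag n => comp (param p.1) r :=
    (compL r).contDiff.comp (contDiff_param.comp contDiff_fst)
  have h2 : ContDiff ℝ 1 fun p : ParamSpace d n × skewZeroDiag n => NormedSpace.exp (skewMat p.2) :=
    contDiff_matrix_exp.comp (skewMatL.contDiff.comp contDiff_snd)
  have h3 : ContDiff ℝ 1 fun p : ParamSpace d n × skewZeroDiag n =>
      NormedSpace.exp (-skewMat p.2) :=
    contDiff_matrix_exp.comp (skewMatL.contDiff.comp contDiff_snd).neg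
  have h4 := (h2.mul h1).mul h3
  simp_rw [star_coe_expU]
  exact h4

/-- The derivative of `e^{tS} Q e^{-tS}` at `t = 0` is `S Q - Q S`, which is the negative of `ad_Q
S`. -/
theorem fderiv_flow (e e' : ParamSpace d n) (S : skewZeroDiag n) :
    fderiv ℝ flow (e, (0 : skewZeroDiag n)) (e', S) =
      fderiv ℝ param e e' - ad (param e) S := by
  have h1 := hasDerivAt_line (e, (0 : skewZeroDiag n)) (e', S)
  have h2 : HasFDerivAt flow (fderiv ℝ flow (e, (0 : skewZeroDiag n)))
      ((e, (0 : skewZeroDiag n)) + (0 : ℝ) • (e', S)) := by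
    rw [zero_smul, add_zero]
    exact (contDiff_flow.differentiable one_ne_zero _).hasFDerivAt
  have h3 := h2.comp_hasDerivAt 0 h1
  refine tuple_ext fun r => ?_
  have h4 := (compL r).hasFDerivAt.comp_hasDerivAt 0 h3
  have h5 := (compL r).hasFDerivAt.comp_hasDerivAt 0 (hasDerivAt_param_line e e')
  have h6 := hasDerivAt_exp_smul_const (𝕂 := ℝ) (skewMat S) 0
  have h7 := hasDerivAt_exp_smul_const (𝕂 := ℝ) (-skewMat S) 0
  have h8 := (h6.mul h5).mul h7
  have h9 := h4.unique (h8.congr_of_eventuallyEq (Eventually.of_forall fun t => ?_))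
  · change comp _ r = _ at h9
    rw [h9]
    simp only [zero_smul, NormedSpace.exp_zero, one_mul, mul_one, Pi.mul_apply, Function.comp_apply,
      add_zero, compL_apply]
    change skewMat S * comp (param e) r + comp (fderiv ℝ param e e') r +
      comp (param e) r * -skewMat S = comp (fderiv ℝ param e e') r -
        (comp (param e) r * skewMat S - skewMat S * comp (param e) r)
    rw [mul_neg]
    abel
  · simp only [Function.comp_apply, compL_apply, Pi.mul_apply, flow, comp_conj, star_coe_expU,
      Prod.mk_add_mk, Prod.smul_mk, zero_add]
    rw [smul_neg]
    rfl

/-- In the kernel, the commutator of `S` with the first matrix is upper triangular, which forces `S`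
to be upper triangular. A skew-Hermitian `S` with zero diagonal is then zero, and `param` is an
immersion. -/
theorem fderiv_flow_injective {e : ParamSpace d n} (he : e ∈ paramDom d n) :
    Function.Injective (fderiv ℝ flow (e, (0 : skewZeroDiag n))) := by
  rw [injective_iff_map_eq_zero]
  rintro ⟨e', S⟩ h
  rw [fderiv_flow, sub_eq_zero] at h
  have hd := diag_injective_of_mem_paramDom he
  have h0 : triMat e'.1 = triMat e.1 * skewMat S - skewMat S * triMat e.1 := by
    rw [← comp_fderiv_param_zero e e', h]
    rfl
  have hS : S = 0 := by
    refine skewMat_eq_zero_of_isUpperTriangular (isUpperTriangular_of_intertwine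
      (isUpperTriangular_triMat e.1) (isUpperTriangular_triMat e.1)
      (fun i j hij h' => hij.ne' (hd h')) fun i j hij => ?_)
    have h1 := congrFun (congrFun h0 i) j
    rw [isUpperTriangular_triMat e'.1 hij] at h1
    exact (sub_eq_zero.1 h1.symm)
  subst hS
  rw [map_zero] at h
  exact Prod.ext ((injective_iff_map_eq_zero _).1 (fderiv_param_injective he) _ h) rfl

/-! ### The Jacobian of the flow -/

/-- Since `P^⊥` is symmetric and idempotent, the Gram matrix is the matrix of `Λ_Q` in an
orthonormal basis, up to transposition. In particular `det Λ_Q ≥ 0`. -/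
theorem det_gram_Pperp_ad (Q : Tuple d n) :
    (Matrix.gram ℝ fun j => Pperp Q (ad Q (stdOrthonormalBasis ℝ (skewZeroDiag n) j))).det =
      LinearMap.det (Lam Q) := by
  set c := stdOrthonormalBasis ℝ (skewZeroDiag n)
  rw [← LinearMap.det_toMatrix c.toBasis, ← Matrix.det_transpose]
  congr 1
  ext i j
  rw [Matrix.transpose_apply, LinearMap.toMatrix_apply, Matrix.gram_apply]
  simp only [OrthonormalBasis.coe_toBasis, OrthonormalBasis.coe_toBasis_repr_apply]
  rw [OrthonormalBasis.repr_apply_apply, real_inner_comm (Lam Q (c j)), inner_Lam, real_inner_comm]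
  unfold Pperp
  simp only [ContinuousLinearMap.coe_coe]
  rw [← Submodule.inner_starProjection_left_eq_right]
  rw [Submodule.starProjection_eq_self_iff.2 (Submodule.starProjection_apply_mem
    (tangentSpaceOf (triangular d n) Q)ᗮ (ad Q (c i))),
    Submodule.inner_starProjection_left_eq_right, real_inner_comm]

/-- This is where `κ` comes from: `jac_prod` with the tangent space as range of the first factor
leaves the vectors `-P^⊥ ad_Q S`, and the sign disappears in the Gram matrix. -/
theorem jac_flow {ι : Type*} [Fintype ι] [DecidableEq ι] (b : Module.Basis ι ℝ (ParamSpace d n))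
    {e : ParamSpace d n} (he : e ∈ paramDom d n) :
    jac (b.prod (stdOrthonormalBasis ℝ (skewZeroDiag n)).toBasis)
        (fderiv ℝ flow (e, (0 : skewZeroDiag n))) =
      jac b (fderiv ℝ param e) * kappa 1 (param e) := by
  have h1 := jac_prod b (stdOrthonormalBasis ℝ (skewZeroDiag n)).toBasis
    (fderiv ℝ flow (e, (0 : skewZeroDiag n))) (fderiv ℝ param e)
    (-LinearMap.toContinuousLinearMap (ad (param e)))
    (fun x y => by rw [fderiv_flow]; exact sub_eq_add_neg _ _)
    (tangentSpaceOf (triangular (d + 1) n) (param e)) (tangentSpaceOf_param he)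
  rw [h1]
  congr 1
  have h2 : (Matrix.gram ℝ fun j => (tangentSpaceOf (triangular (d + 1) n) (param e))ᗮ.starProjection
      ((-LinearMap.toContinuousLinearMap (ad (param e)))
        ((stdOrthonormalBasis ℝ (skewZeroDiag n)).toBasis j))) =
      Matrix.gram ℝ fun j => Pperp (param e)
        (ad (param e) (stdOrthonormalBasis ℝ (skewZeroDiag n) j)) := by
    ext i j
    simp only [Matrix.gram_apply, Pperp, neg_apply, map_neg, inner_neg_neg,
      OrthonormalBasis.coe_toBasis]
    rfl
  rw [h2, kappa, one_mul, ← det_gram_Pperp_ad, abs_of_nonneg]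
  exact (Matrix.posSemidef_gram ℝ _).det_nonneg

end Exponential

/-! ### The chart `S ↦ [e^S]` near the identity coset -/

section LocalSplitting

open scoped Matrix.Norms.Operator

variable {d n : ℕ}

/-- The diagonal part of a matrix. -/
def diagPart : Matrix (Fin n) (Fin n) ℂ →L[ℝ] Matrix (Fin n) (Fin n) ℂ :=
  LinearMap.toContinuousLinearMap
    { toFun := fun M => Matrix.diagonal M.diag
      map_add' := fun M N => (Matrix.diagonal_add _ _).symm
      map_smul' := fun c M => by
        ext i j
        by_cases h : i = j <;> simp [h, Matrix.diagonal] }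

theorem diagPart_apply (M : Matrix (Fin n) (Fin n) ℂ) :
    diagPart M = Matrix.diagonal M.diag := rfl

theorem diagPart_star (M : Matrix (Fin n) (Fin n) ℂ) : diagPart (star M) = star (diagPart M) := by
  rw [diagPart_apply, diagPart_apply, Matrix.star_eq_conjTranspose, Matrix.star_eq_conjTranspose,
    Matrix.diagonal_conjTranspose]
  rfl

theorem diagPart_skewMat (S : skewZeroDiag n) : diagPart (skewMat S) = 0 := by
  rw [diagPart_apply]
  have : (skewMat S).diag = 0 := funext fun i => skewMat_diag S i
  rw [this, Matrix.diagonal_zero']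

theorem diagPart_diagonal (v : Fin n → ℂ) : diagPart (Matrix.diagonal v) = Matrix.diagonal v := by
  rw [diagPart_apply, Matrix.diag_diagonal]

/-- The product of the exponentials of the off-diagonal part and of the diagonal part. -/
def expSplit (M : Matrix (Fin n) (Fin n) ℂ) : Matrix (Fin n) (Fin n) ℂ :=
  NormedSpace.exp (M - diagPart M) * NormedSpace.exp (diagPart M)

theorem expSplit_zero : expSplit (0 : Matrix (Fin n) (Fin n) ℂ) = 1 := by
  rw [expSplit, map_zero, sub_zero, NormedSpace.exp_zero, mul_one]

theorem expSplit_skewMat (S : skewZeroDiag n) : expSplit (skewMat S) = NormedSpace.exp (skewMat S) := by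
  rw [expSplit, diagPart_skewMat, sub_zero, NormedSpace.exp_zero, mul_one]

theorem expSplit_skewMat_add (S : skewZeroDiag n) (v : Fin n → ℂ) :
    expSplit (skewMat S + Matrix.diagonal v) =
      NormedSpace.exp (skewMat S) * Matrix.diagonal fun i => Complex.exp (v i) := by
  rw [expSplit, map_add, diagPart_skewMat, diagPart_diagonal, zero_add, add_sub_cancel_right,
    Matrix.exp_diagonal]
  congr 2
  funext i
  rw [Pi.coe_exp, Complex.exp_eq_exp_ℂ]

theorem exp_mul_exp_neg (A : Matrix (Fin n) (Fin n) ℂ) :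
    NormedSpace.exp A * NormedSpace.exp (-A) = 1 := by
  have h : Commute A (-A) := (Commute.refl A).neg_right
  rw [← Matrix.exp_add_of_commute _ _ h, add_neg_cancel, NormedSpace.exp_zero]

theorem exp_neg_mul_exp (A : Matrix (Fin n) (Fin n) ℂ) :
    NormedSpace.exp (-A) * NormedSpace.exp A = 1 := by
  have h := exp_mul_exp_neg (-A)
  rwa [neg_neg] at h

/-- `expSplit` carries `M ↦ -M*` to `A ↦ (A*)⁻¹`, which fixes unitary matrices. Hence an inverse
function theorem on the space of all matrices suffices: near the identity, the logarithm of a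
unitary matrix is skew-Hermitian. -/
theorem expSplit_neg_star_mul (M : Matrix (Fin n) (Fin n) ℂ) :
    expSplit (-star M) * star (expSplit M) = 1 := by
  have h1 : star (expSplit M) = NormedSpace.exp (star (diagPart M)) *
      NormedSpace.exp (star (M - diagPart M)) := by
    rw [expSplit, star_mul]
    simp only [Matrix.star_eq_conjTranspose, Matrix.exp_conjTranspose]
  have h2 : expSplit (-star M) = NormedSpace.exp (-star (M - diagPart M)) *
      NormedSpace.exp (-star (diagPart M)) := by
    rw [expSplit, map_neg, diagPart_star, star_sub]
    congr 2
    abel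
  rw [h1, h2, mul_assoc, ← mul_assoc (NormedSpace.exp (-star (diagPart M))), exp_neg_mul_exp,
    one_mul, exp_neg_mul_exp]

theorem hasStrictFDerivAt_expSplit :
    HasStrictFDerivAt (expSplit (n := n))
      ((ContinuousLinearEquiv.refl ℝ (Matrix (Fin n) (Fin n) ℂ) :
        Matrix (Fin n) (Fin n) ℂ →L[ℝ] Matrix (Fin n) (Fin n) ℂ)) 0 := by
  have h0 := hasStrictFDerivAt_exp_zero (𝕂 := ℝ) (𝔸 := Matrix (Fin n) (Fin n) ℂ)
  have h1 : HasStrictFDerivAt (fun M : Matrix (Fin n) (Fin n) ℂ => NormedSpace.exp (M - diagPart M))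
      (ContinuousLinearMap.id ℝ _ - diagPart) 0 := by
    have h2 := (ContinuousLinearMap.id ℝ (Matrix (Fin n) (Fin n) ℂ) - diagPart).hasStrictFDerivAt
      (x := 0)
    have h3 : HasStrictFDerivAt NormedSpace.exp (1 : Matrix (Fin n) (Fin n) ℂ →L[ℝ] _)
        ((ContinuousLinearMap.id ℝ (Matrix (Fin n) (Fin n) ℂ) - diagPart (n := n) :
          Matrix (Fin n) (Fin n) ℂ →L[ℝ] Matrix (Fin n) (Fin n) ℂ) 0) := by
      rw [map_zero]
      exact h0
    exact h3.comp 0 h2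
  have h2 : HasStrictFDerivAt (fun M : Matrix (Fin n) (Fin n) ℂ => NormedSpace.exp (diagPart M))
      (diagPart (n := n)) 0 := by
    have h2 := (diagPart (n := n)).hasStrictFDerivAt (x := 0)
    have h3 : HasStrictFDerivAt NormedSpace.exp (1 : Matrix (Fin n) (Fin n) ℂ →L[ℝ] _)
        (diagPart (n := n) 0) := by
      rw [map_zero]
      exact h0
    exact h3.comp 0 h2
  have h3 := h1.mul' h2
  refine h3.congr_fderiv ?_
  ext M : 1
  simp only [map_zero, sub_zero, NormedSpace.exp_zero, MulOpposite.op_one]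
  change (1 : Matrix (Fin n) (Fin n) ℂ) * diagPart M + (M - diagPart M) * 1 = M
  simp

/-- The local inverse of `expSplit` at the identity. -/
def logSplit : Matrix (Fin n) (Fin n) ℂ → Matrix (Fin n) (Fin n) ℂ :=
  hasStrictFDerivAt_expSplit.localInverse _ _ _

theorem eventually_logSplit_expSplit :
    ∀ᶠ M in 𝓝 (0 : Matrix (Fin n) (Fin n) ℂ), logSplit (expSplit M) = M :=
  hasStrictFDerivAt_expSplit.eventually_left_inverse

theorem eventually_expSplit_logSplit :
    ∀ᶠ A in 𝓝 (1 : Matrix (Fin n) (Fin n) ℂ), expSplit (logSplit A) = A := by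
  have h := (hasStrictFDerivAt_expSplit (n := n)).eventually_right_inverse
  rwa [expSplit_zero] at h

theorem tendsto_logSplit : Tendsto (logSplit (n := n)) (𝓝 1) (𝓝 0) := by
  have h := (hasStrictFDerivAt_expSplit (n := n)).localInverse_tendsto
  rwa [expSplit_zero] at h

/-- The off-diagonal part of a skew-Hermitian matrix. -/
def offDiagVec (M : Matrix (Fin n) (Fin n) ℂ) : EuclideanSpace ℂ (Fin n × Fin n) :=
  WithLp.toLp 2 fun k => (M - diagPart M) k.1 k.2

theorem continuous_offDiagVec : Continuous (offDiagVec (n := n)) := by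
  refine (PiLp.continuous_toLp 2 _).comp (continuous_pi fun k => ?_)
  exact (continuous_id.sub diagPart.continuous).matrix_elem k.1 k.2

theorem offDiagVec_mem {M : Matrix (Fin n) (Fin n) ℂ} (hM : star M = -M) :
    offDiagVec M ∈ skewZeroDiag n := by
  have h : star (M - diagPart M) = -(M - diagPart M) := by
    rw [star_sub, ← diagPart_star, hM, map_neg]
    abel
  refine ⟨fun i j => congrFun (congrFun h i) j, fun i => ?_⟩
  change M i i - Matrix.diagonal M.diag i i = 0
  simp

/-- Matrices near the identity are products of exponentials and diagonal matrices. -/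
theorem exists_expU_mul_torus {ε : ℝ} (hε : 0 < ε) :
    {U : UGroup n | ∃ S : skewZeroDiag n, ‖S‖ < ε ∧ ∃ t ∈ torus n, U = expU S * t} ∈
      𝓝 (1 : UGroup n) := by
  have hstar : Tendsto (fun A : Matrix (Fin n) (Fin n) ℂ => -star (logSplit A)) (𝓝 1) (𝓝 0) := by
    have h1 : Continuous fun A : Matrix (Fin n) (Fin n) ℂ => -star A :=
      (continuous_id.matrix_conjTranspose).neg
    have h2 := (h1.tendsto 0).comp (tendsto_logSplit (n := n))
    have h3 : -star (0 : Matrix (Fin n) (Fin n) ℂ) = 0 := by rw [star_zero, neg_zero]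
    rw [h3] at h2
    exact h2
  have hnorm : ∀ᶠ A in 𝓝 (1 : Matrix (Fin n) (Fin n) ℂ), ‖offDiagVec (logSplit A)‖ < ε := by
    have h2 := ((continuous_offDiagVec.norm).tendsto 0).comp (tendsto_logSplit (n := n))
    have h3 : ‖offDiagVec (0 : Matrix (Fin n) (Fin n) ℂ)‖ < ε := by
      have : offDiagVec (0 : Matrix (Fin n) (Fin n) ℂ) = 0 := by
        ext k
        simp [offDiagVec]
      rwa [this, norm_zero]
    exact h2.eventually (gt_mem_nhds h3)
  have hU : Tendsto (fun U : UGroup n => (U : Matrix (Fin n) (Fin n) ℂ)) (𝓝 1) (𝓝 1) :=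
    continuous_subtype_val.tendsto _
  filter_upwards [hU.eventually hnorm, hU.eventually (eventually_expSplit_logSplit (n := n)),
    hU.eventually (hstar.eventually (eventually_logSplit_expSplit (n := n)))] with U h1 h2 h3
  set M := logSplit (U : Matrix (Fin n) (Fin n) ℂ) with hM
  -- Both `M` and `-M*` are small and `expSplit` sends both to `U`; local injectivity gives `M* =
  -- -M`.
  have h4 : expSplit (-star M) = U := by
    have h5 := expSplit_neg_star_mul M
    rw [h2] at h5
    calc expSplit (-star M) = expSplit (-star M) * (star (U : Matrix (Fin n) (Fin n) ℂ) * U) := by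
          rw [Matrix.mem_unitaryGroup_iff'.1 U.2, mul_one]
      _ = U := by rw [← mul_assoc, h5, one_mul]
  rw [h4, ← hM] at h3
  have hskew : star M = -M := by
    rw [eq_neg_iff_add_eq_zero, ← neg_eq_iff_add_eq_zero]
    exact h3.symm
  let S : skewZeroDiag n := ⟨offDiagVec M, offDiagVec_mem hskew⟩
  have hS : skewMat S = M - diagPart M := rfl
  refine ⟨S, h1, (expU S)⁻¹ * U, ?_, by group⟩
  have h5 : (((expU S)⁻¹ * U : UGroup n) : Matrix (Fin n) (Fin n) ℂ) =
      NormedSpace.exp (diagPart M) := by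
    rw [Matrix.UnitaryGroup.mul_val, ← h2]
    change star (expU S : Matrix (Fin n) (Fin n) ℂ) * _ = _
    rw [star_coe_expU, expSplit, ← mul_assoc, ← hS, exp_neg_mul_exp, one_mul]
  change Matrix.IsDiag _
  rw [h5, diagPart_apply, Matrix.exp_diagonal]
  exact Matrix.isDiag_diagonal _

/-- The chart `S ↦ [e^S]` is injective near the origin. -/
theorem exists_injective_expU : ∃ ε : ℝ, 0 < ε ∧ ∀ S S' : skewZeroDiag n, ‖S‖ < ε → ‖S'‖ < ε →
    (expU S')⁻¹ * expU S ∈ torus n → S = S' := by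
  let T : skewZeroDiag n × skewZeroDiag n → Matrix (Fin n) (Fin n) ℂ := fun p =>
    ((expU p.2)⁻¹ * expU p.1 : UGroup n)
  have hTc : Continuous T := by
    refine continuous_subtype_val.comp (Continuous.mul ?_ (continuous_expU.comp continuous_fst))
    exact (continuous_expU.comp continuous_snd).inv
  have hT0 : T 0 = 1 := by
    change (((expU 0)⁻¹ * expU 0 : UGroup n) : Matrix (Fin n) (Fin n) ℂ) = 1
    rw [inv_mul_cancel]
    rfl
  have hTd : ∀ i, T 0 i i = 1 := fun i => by rw [hT0, Matrix.one_apply_eq]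
  have hTi : ∀ i, Continuous fun p => T p i i := fun i => hTc.matrix_elem i i
  -- If the torus element `T = e^{-S'} e^S` is close to `1`, its entrywise principal logarithm `D`
  -- is small and `e^S = expSplit (S' + D)`. Local injectivity gives `S = S' + D`; now compare
  -- off-diagonal parts.
  let D : skewZeroDiag n × skewZeroDiag n → Matrix (Fin n) (Fin n) ℂ := fun p =>
    Matrix.diagonal fun i => Complex.log (T p i i)
  have hD : Tendsto D (𝓝 0) (𝓝 0) := by
    have h1 : Tendsto (fun p => fun i => Complex.log (T p i i)) (𝓝 0) (𝓝 0) := by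
      refine tendsto_pi_nhds.2 fun i => ?_
      have h2 : ContinuousAt Complex.log (T 0 i i) := by
        rw [hTd]
        exact continuousAt_clog Complex.one_mem_slitPlane
      have h3 := h2.tendsto.comp ((hTi i).tendsto 0)
      rw [hTd, Complex.log_one] at h3
      exact h3
    have h4 : Continuous fun v : Fin n → ℂ => Matrix.diagonal v := continuous_id.matrix_diagonal
    have h5 := (h4.tendsto 0).comp h1
    rw [Matrix.diagonal_zero'] at h5
    exact h5
  have hS' : Tendsto (fun p : skewZeroDiag n × skewZeroDiag n => skewMat p.2 + D p) (𝓝 0) (𝓝 0) := by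
    have h1 : Tendsto (fun p : skewZeroDiag n × skewZeroDiag n => skewMat p.2) (𝓝 0) (𝓝 0) :=
      (skewMatL.continuous.comp continuous_snd).tendsto' _ _ (map_zero skewMatL)
    simpa using h1.add hD
  have hS : Tendsto (fun p : skewZeroDiag n × skewZeroDiag n => skewMat p.1) (𝓝 0) (𝓝 0) :=
    (skewMatL.continuous.comp continuous_fst).tendsto' _ _ (map_zero skewMatL)
  have hne : ∀ᶠ p in 𝓝 0, ∀ i, T p i i ≠ 0 := eventually_all.2 fun i =>
    ((hTi i).tendsto 0).eventually_ne (by rw [hTd]; exact one_ne_zero)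
  have hev : ∀ᶠ p : skewZeroDiag n × skewZeroDiag n in 𝓝 0,
      (expU p.2)⁻¹ * expU p.1 ∈ torus n → p.1 = p.2 := by
    filter_upwards [hne, hS.eventually eventually_logSplit_expSplit,
      hS'.eventually eventually_logSplit_expSplit] with p h1 h2 h3 hp
    have h4 : Matrix.diagonal (fun i => Complex.exp (Complex.log (T p i i))) = T p := by
      have h5 : (T p).IsDiag := hp
      simp_rw [fun i => Complex.exp_log (h1 i)]
      exact h5.diagonal_diag
    have h6 : expSplit (skewMat p.2 + D p) = expSplit (skewMat p.1) := by
      rw [expSplit_skewMat_add, h4, expSplit_skewMat]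
      change ((expU p.2 * ((expU p.2)⁻¹ * expU p.1) : UGroup n) : Matrix (Fin n) (Fin n) ℂ) = _
      rw [mul_inv_cancel_left]
      rfl
    rw [h6, h2] at h3
    have h7 := congrArg (fun M => M - diagPart M) h3
    simp only [map_add, diagPart_skewMat, sub_zero, zero_add, D, diagPart_diagonal,
      add_sub_cancel_right] at h7
    exact skewMat_injective h7
  obtain ⟨ε, hε, h⟩ := Metric.eventually_nhds_iff.1 hev
  refine ⟨ε, hε, fun S S' h1 h2 h3 => h (y := (S, S')) ?_ h3⟩
  rw [dist_zero_right]
  exact max_lt h1 h2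

theorem mk_mem_expBall_iff {ε : ℝ} {U : UGroup n} :
    (QuotientGroup.mk U : UGroup n ⧸ torus n) ∈ expBall n ε ↔
      ∃ S : skewZeroDiag n, ‖S‖ < ε ∧ (expU S)⁻¹ * U ∈ torus n := by
  constructor
  · rintro ⟨S, hS, V, hV, h⟩
    refine ⟨S, hS, ?_⟩
    have : V = expU S := Subtype.ext hV
    rw [← this]
    exact QuotientGroup.eq.1 h
  · rintro ⟨S, hS, h⟩
    exact ⟨S, hS, expU S, rfl, QuotientGroup.eq.2 h⟩

theorem preimage_expBall_mem_nhds {ε : ℝ} (hε : 0 < ε) :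
    (QuotientGroup.mk ⁻¹' expBall n ε : Set (UGroup n)) ∈ 𝓝 (1 : UGroup n) := by
  filter_upwards [exists_expU_mul_torus hε] with U hU
  obtain ⟨S, hS, t, ht, rfl⟩ := hU
  refine mk_mem_expBall_iff.2 ⟨S, hS, ?_⟩
  rwa [inv_mul_cancel_left]

end LocalSplitting

/-! ### Ordering the eigenvalues of the first matrix -/

section Sorting

variable {d n : ℕ}

/-- The lexicographic key used for ordering eigenvalues. -/
def lexKey (z : ℂ) : ℝ ×ₗ ℝ := toLex (z.re, z.im)

theorem lexKey_injective : Function.Injective lexKey := by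
  intro z w h
  have h' := toLex.injective h
  exact Complex.ext (congrArg Prod.fst h') (congrArg Prod.snd h')

theorem lexKey_lt_iff {z w : ℂ} : lexKey z < lexKey w ↔ z.re < w.re ∨ z.re = w.re ∧ z.im < w.im :=
  Prod.Lex.toLex_lt_toLex

/-- The generic upper triangular tuples for which the diagonal of the first matrix is ordered
lexicographically by the permutation `π`. -/
def sorted (d n : ℕ) (π : Equiv.Perm (Fin n)) : Set (Tuple (d + 1) n) :=
  {Q | Q ∈ triangular (d + 1) n ∩ generic (d + 1) n ∧
    StrictMono fun i => lexKey (comp Q 0 (π i) (π i))}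

theorem measurableSet_sorted (π : Equiv.Perm (Fin n)) : MeasurableSet (sorted d n π) := by
  refine (isClosed_triangular.measurableSet.inter measurableSet_generic).inter ?_
  have : {Q : Tuple (d + 1) n | StrictMono fun i => lexKey (comp Q 0 (π i) (π i))} =
      ⋂ i, ⋂ j, ⋂ _ : i < j, {Q : Tuple (d + 1) n |
        lexKey (comp Q 0 (π i) (π i)) < lexKey (comp Q 0 (π j) (π j))} := by
    ext Q
    simp only [Set.mem_iInter]
    exact Iff.rfl
  change MeasurableSet {Q : Tuple (d + 1) n | StrictMono fun i => lexKey (comp Q 0 (π i) (π i))}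
  rw [this]
  have hm : ∀ i : Fin n, Measurable fun Q : Tuple (d + 1) n => comp Q 0 i i := fun i =>
    ((continuous_comp 0).matrix_elem i i).measurable
  have hr := fun i => Complex.measurable_re.comp (hm i)
  have hi := fun i => Complex.measurable_im.comp (hm i)
  refine MeasurableSet.iInter fun i => MeasurableSet.iInter fun j => MeasurableSet.iInter fun _ => ?_
  simp_rw [lexKey_lt_iff]
  exact (measurableSet_lt (hr _) (hr _)).union
    ((measurableSet_eq_fun (hr _) (hr _)).inter (measurableSet_lt (hi _) (hi _)))

theorem sorted_subset (π : Equiv.Perm (Fin n)) :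
    sorted d n π ⊆ triangular (d + 1) n ∩ generic (d + 1) n := fun _ h => h.1

theorem strictMono_sort {v : Fin n → ℂ} (hv : Function.Injective v) :
    StrictMono fun i => lexKey (v (Tuple.sort (lexKey ∘ v) i)) :=
  (Tuple.monotone_sort (lexKey ∘ v)).strictMono_of_injective
    ((lexKey_injective.comp hv).comp (Equiv.injective _))

theorem iUnion_sorted : ⋃ π, sorted d n π = triangular (d + 1) n ∩ generic (d + 1) n := by
  refine Set.Subset.antisymm (Set.iUnion_subset sorted_subset) fun Q hQ => ?_
  exact Set.mem_iUnion.2 ⟨_, hQ, strictMono_sort (diag_injective_of_mem_generic hQ.1 hQ.2 0)⟩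

theorem pairwise_disjoint_sorted : Pairwise (Function.onFun Disjoint (sorted d n)) := by
  intro π π' hne
  rw [Function.onFun, Set.disjoint_left]
  intro Q hQ hQ'
  refine hne (Equiv.ext fun i => ?_)
  let f : Fin n → ℝ ×ₗ ℝ := fun j => lexKey (comp Q 0 j j)
  have hf : Function.Injective f := lexKey_injective.comp (diag_injective_of_mem_generic hQ.1.1 hQ.1.2 0)
  have h := (StrictMono.range_inj hQ.2 hQ'.2).1 (by
    change Set.range (f ∘ π) = Set.range (f ∘ π')
    rw [EquivLike.range_comp, EquivLike.range_comp])
  exact hf (congrFun h i)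

theorem conj_torus_apply {t : UGroup n} (ht : t ∈ torus n) (X : Tuple d n) (r : Fin d)
    (i j : Fin n) : comp (conj t X) r i j =
      (t : Matrix (Fin n) (Fin n) ℂ) i i * comp X r i j *
        star ((t : Matrix (Fin n) (Fin n) ℂ) j j) := by
  have h : (t : Matrix (Fin n) (Fin n) ℂ).IsDiag := ht
  have h1 := h.diagonal_diag
  rw [comp_conj]
  conv_lhs => rw [← h1]
  rw [Matrix.star_eq_conjTranspose, Matrix.diagonal_conjTranspose, Matrix.mul_diagonal,
    Matrix.diagonal_mul]
  rfl

theorem torus_mul_star {t : UGroup n} (ht : t ∈ torus n) (i : Fin n) :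
    (t : Matrix (Fin n) (Fin n) ℂ) i i * star ((t : Matrix (Fin n) (Fin n) ℂ) i i) = 1 := by
  have h : (t : Matrix (Fin n) (Fin n) ℂ).IsDiag := ht
  have h1 := congrFun (congrFun (Matrix.mem_unitaryGroup_iff.1 t.2) i) i
  rw [← h.diagonal_diag, Matrix.star_eq_conjTranspose, Matrix.diagonal_conjTranspose,
    Matrix.diagonal_mul_diagonal, Matrix.diagonal_apply_eq, Matrix.one_apply_eq] at h1
  exact h1

theorem conj_torus_mem_triangular {t : UGroup n} (ht : t ∈ torus n) {Q : Tuple d n}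
    (hQ : Q ∈ triangular d n) : conj t Q ∈ triangular d n := by
  refine ⟨conj_mem_commuting hQ.1, fun r i j hij => ?_⟩
  rw [conj_torus_apply ht, hQ.2 r i j hij, mul_zero, zero_mul]

theorem conj_torus_mem_sorted {t : UGroup n} (ht : t ∈ torus n) {Q : Tuple (d + 1) n}
    {π : Equiv.Perm (Fin n)} (hQ : Q ∈ sorted d n π) : conj t Q ∈ sorted d n π := by
  refine ⟨⟨conj_torus_mem_triangular ht hQ.1.1, conj_mem_generic hQ.1.2⟩, ?_⟩
  have : ∀ i, comp (conj t Q) 0 i i = comp Q 0 i i := fun i => by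
    rw [conj_torus_apply ht, mul_right_comm, torus_mul_star ht, one_mul]
  simp_rw [this]
  exact hQ.2

/-- Unitarily equivalent first matrices have the same eigenvalues; listed in the same order, these
are equal diagonals. The intertwining unitary is then diagonal by `isDiag_of_conj_eq`. -/
theorem mem_torus_of_conj_eq {π : Equiv.Perm (Fin n)} {Q Q' : Tuple (d + 1) n}
    (hQ : Q ∈ sorted d n π) (hQ' : Q' ∈ sorted d n π) {U U' : UGroup n}
    (h : conj U Q = conj U' Q') : U'⁻¹ * U ∈ torus n := by
  have h1 : conj (U'⁻¹ * U) Q = Q' := by rw [conj_mul, h, conj_inv_conj]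
  set W := U'⁻¹ * U
  have h2 : comp Q' 0 = W * comp Q 0 * star (W : Matrix (Fin n) (Fin n) ℂ) := by
    rw [← h1, comp_conj]
  have hT := (mem_triangular_iff.1 hQ.1.1).2 0
  have hT' := (mem_triangular_iff.1 hQ'.1.1).2 0
  have h3 : spectrum ℂ (comp Q' 0) = spectrum ℂ (comp Q 0) := by
    rw [h2]
    exact Unitary.spectrum_star_right_conjugate
  rw [spectrum_eq_range_diag hT, spectrum_eq_range_diag hT'] at h3
  have h4 := (StrictMono.range_inj hQ.2 hQ'.2).1 (by
    change Set.range ((fun i => lexKey (comp Q 0 i i)) ∘ π) =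
      Set.range ((fun i => lexKey (comp Q' 0 i i)) ∘ π)
    rw [EquivLike.range_comp, EquivLike.range_comp]
    change Set.range (lexKey ∘ fun i => comp Q 0 i i) = Set.range (lexKey ∘ fun i => comp Q' 0 i i)
    rw [Set.range_comp, Set.range_comp, h3])
  refine isDiag_of_conj_eq hT hT' (diag_injective_of_mem_generic hQ.1.1 hQ.1.2 0) (fun i => ?_) W ?_
  · have h5 := congrFun h4 (π.symm i)
    simp only [Equiv.apply_symm_apply] at h5
    exact lexKey_injective h5
  · rw [h2, mul_assoc, Matrix.UnitaryGroup.star_mul_self, mul_one]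

/-- Triangularise the first matrix with its eigenvalues in the prescribed order; the others commute
with it, so they become triangular too. As this works for every `π`, each of the `n!` pieces meets
every generic orbit. -/
theorem exists_conj_sorted (π : Equiv.Perm (Fin n)) {X : Tuple (d + 1) n}
    (hX : X ∈ generic (d + 1) n) : ∃ U : UGroup n, ∃ Q ∈ sorted d n π, X = conj U Q := by
  have hfin := Matrix.finite_spectrum (comp X 0)
  have : Finite (spectrum ℂ (comp X 0)) := hfin
  let φ := (Finite.equivFinOfCardEq (hX.2 0)).symm
  let v : Fin n → ℂ := fun i => φ i
  have hv : Function.Injective v := Subtype.val_injective.comp φ.injective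
  -- Chosen so that `z ∘ π` lists the eigenvalues in increasing order.
  let z : Fin n → ℂ := fun i => v (Tuple.sort (lexKey ∘ v) (π.symm i))
  have hz : Function.Injective z := hv.comp ((Equiv.injective _).comp π.symm.injective)
  obtain ⟨U, q, hq, hqz, hM⟩ := exists_unitary_triangularization (M := comp X 0) hz
    fun i => (φ _).2
  let Q := conj U⁻¹ X
  have hXQ : X = conj U Q := (conj_conj_inv U X).symm
  have hQg : Q ∈ generic (d + 1) n := conj_mem_generic hX
  have hQ0 : comp Q 0 = q := by
    have h1 : (U : Matrix (Fin n) (Fin n) ℂ) * comp Q 0 * star (U : Matrix (Fin n) (Fin n) ℂ) =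
        U * q * star (U : Matrix (Fin n) (Fin n) ℂ) := by
      rw [← hM, ← comp_conj, ← hXQ]
    have hU := Matrix.UnitaryGroup.star_mul_self U
    have h2 := congrArg (fun A => star (U : Matrix (Fin n) (Fin n) ℂ) * A * U) h1
    simpa only [← mul_assoc, hU, one_mul, mul_assoc _ (star (U : Matrix (Fin n) (Fin n) ℂ))
      (U : Matrix (Fin n) (Fin n) ℂ), mul_one] using h2
  have hd : Function.Injective fun i => q i i := by
    simp_rw [hqz]
    exact hz
  refine ⟨U, Q, ⟨⟨mem_triangular_iff.2 ⟨hQg.1, fun r => ?_⟩, hQg⟩, ?_⟩, hXQ⟩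
  · refine isUpperTriangular_of_commute hq hd ?_
    rw [← hQ0]
    exact hQg.1 0 r
  · simp only [hQ0, hqz, z, Equiv.symm_apply_apply]
    exact strictMono_sort hv

end Sorting

/-! ### Dimension counts -/

section Dimension

variable {d n : ℕ}

theorem card_le_add_card_lt : Fintype.card {p : Fin n × Fin n // p.1 ≤ p.2} +
    Fintype.card {p : Fin n × Fin n // p.1 < p.2} = n ^ 2 := by
  have h1 : Fintype.card {p : Fin n × Fin n // p.1 < p.2} =
      Fintype.card {p : Fin n × Fin n // ¬ p.1 ≤ p.2} :=
    Fintype.card_congr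
      { toFun := fun p => ⟨(p.1.2, p.1.1), not_le.2 p.2⟩
        invFun := fun p => ⟨(p.1.2, p.1.1), not_le.1 p.2⟩
        left_inv := fun _ => rfl
        right_inv := fun _ => rfl }
  rw [h1, Fintype.card_subtype_compl, Fintype.card_prod, Fintype.card_fin, ← sq]
  have h2 := Fintype.card_subtype_le fun p : Fin n × Fin n => p.1 ≤ p.2
  rw [Fintype.card_prod, Fintype.card_fin, ← sq] at h2
  omega

theorem card_le_eq : Fintype.card {p : Fin n × Fin n // p.1 ≤ p.2} =
    Fintype.card {p : Fin n × Fin n // p.1 < p.2} + n := by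
  have h : Fintype.card {p : Fin n × Fin n // p.1 ≤ p.2} =
      Fintype.card ({p : Fin n × Fin n // p.1 < p.2} ⊕ Fin n) := by
    refine Fintype.card_congr
      { toFun := fun p => if h : p.1.1 < p.1.2 then Sum.inl ⟨p.1, h⟩ else Sum.inr p.1.1
        invFun := fun s => Sum.elim (fun p => ⟨p.1, p.2.le⟩) (fun i => ⟨(i, i), le_rfl⟩) s
        left_inv := ?_
        right_inv := ?_ }
    · rintro ⟨⟨i, j⟩, h⟩
      by_cases h' : i < j
      · simp [h']
      · have : i = j := le_antisymm h (not_lt.1 h')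
        subst this
        simp
    · rintro (⟨⟨i, j⟩, h⟩ | i)
      · have h' : i < j := h
        simp [h']
      · simp
  rw [h, Fintype.card_sum, Fintype.card_fin]

/-- A skew-Hermitian matrix with zero diagonal is determined by its entries above the diagonal. -/
def skewEquiv (n : ℕ) : skewZeroDiag n ≃ₗ[ℝ] ({p : Fin n × Fin n // p.1 < p.2} → ℂ) where
  toFun S p := skewMat S p.1.1 p.1.2
  map_add' _ _ := rfl
  map_smul' _ _ := rfl
  invFun f := ⟨WithLp.toLp 2 fun k => if h : k.1 < k.2 then f ⟨k, h⟩ else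
      if h : k.2 < k.1 then -star (f ⟨(k.2, k.1), h⟩) else 0, by
    refine ⟨fun i j => ?_, fun i => by simp⟩
    rcases lt_trichotomy i j with h | rfl | h
    · simp [h, h.not_gt]
    · simp
    · simp [h, h.not_gt]⟩
  left_inv S := by
    refine Subtype.ext (PiLp.ext fun ⟨i, j⟩ => ?_)
    rcases lt_trichotomy i j with h | rfl | h
    · simp [h, skewMat]
    · simp [S.2.2 i]
    · have := S.2.1 i j
      simp [h, h.not_gt, skewMat, S.2.1 i j]
  right_inv f := by
    funext ⟨⟨i, j⟩, h⟩
    have h' : i < j := h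
    simp [skewMat, h']

theorem finrank_pi_complex (ι : Type*) [Fintype ι] :
    Module.finrank ℝ (ι → ℂ) = 2 * Fintype.card ι := by
  rw [Module.finrank_pi_fintype]
  simp [Complex.finrank_real_complex, mul_comm]

theorem finrank_skewZeroDiag : Module.finrank ℝ (skewZeroDiag n) =
    2 * Fintype.card {p : Fin n × Fin n // p.1 < p.2} := by
  rw [(skewEquiv n).finrank_eq, finrank_pi_complex]

theorem finrank_paramSpace : Module.finrank ℝ (ParamSpace d n) =
    2 * Fintype.card {p : Fin n × Fin n // p.1 ≤ p.2} + 2 * d * n := by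
  rw [Module.finrank_prod, finrank_pi_complex, Module.finrank_pi_fintype]
  simp only [finrank_pi_complex, Fintype.card_fin, Finset.sum_const, Finset.card_univ, smul_eq_mul]
  ring

/-- A basis of the parameter space. -/
def paramBasis (d n : ℕ) : Module.Basis (Fin (Module.finrank ℝ (ParamSpace d n))) ℝ (ParamSpace d n) :=
  Module.finBasis ℝ _

/-- An orthonormal basis of the space of skew-Hermitian matrices with zero diagonal. -/
def skewBasis (n : ℕ) :
    Module.Basis (Fin (Module.finrank ℝ (skewZeroDiag n))) ℝ (skewZeroDiag n) :=
  (stdOrthonormalBasis ℝ (skewZeroDiag n)).toBasis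

theorem card_paramBasis : Fintype.card (Fin (Module.finrank ℝ (ParamSpace d n))) =
    n ^ 2 + (2 * (d + 1) - 1) * n := by
  have h1 := card_le_add_card_lt (n := n)
  have h2 := card_le_eq (n := n)
  have h3 : (2 * (d + 1) - 1) * n = 2 * d * n + n := by
    rw [show 2 * (d + 1) - 1 = 2 * d + 1 by omega]
    ring
  rw [Fintype.card_fin, finrank_paramSpace, h3]
  omega

/-- The `n² + n + 2dn` real parameters and the `n² - n` real dimensions of the skew-Hermitian
directions add up to the dimension of `dX`. -/
theorem card_prodBasis : Fintype.card (Fin (Module.finrank ℝ (ParamSpace d n)) ⊕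
    Fin (Module.finrank ℝ (skewZeroDiag n))) = 2 * n ^ 2 + 2 * d * n := by
  have h1 := card_le_add_card_lt (n := n)
  have h2 := card_le_eq (n := n)
  rw [Fintype.card_sum, Fintype.card_fin, Fintype.card_fin, finrank_paramSpace,
    finrank_skewZeroDiag]
  omega

end Dimension

/-! ### Compact exhaustion and uniform radii -/

section Compactness

variable {d n : ℕ}

instance : SecondCountableTopology (UGroup n) :=
  haveI : SecondCountableTopology (Matrix (Fin n) (Fin n) ℂ) :=
    inferInstanceAs (SecondCountableTopology (Fin n → Fin n → ℂ))
  (Topology.IsInducing.subtypeVal (t := {A : Matrix (Fin n) (Fin n) ℂ |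
    A ∈ Matrix.unitaryGroup (Fin n) ℂ})).secondCountableTopology

/-- Needed for the theorem that injective continuous images of Borel sets are Borel, on `U(n)` times
the space of tuples. -/
instance : PolishSpace (UGroup n) := by
  have : TopologicalSpace.MetrizableSpace (UGroup n) := inferInstance
  let := TopologicalSpace.metrizableSpaceMetric (UGroup n)
  infer_instance

/-- The parameters of an upper triangular tuple, by Cramer's rule. -/
def paramInv (Q : Tuple (d + 1) n) : ParamSpace d n :=
  (fun p => comp Q 0 p.1.1 p.1.2, fun r =>
    ((Matrix.vandermonde fun i => comp Q 0 i i).det)⁻¹ •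
      (Matrix.vandermonde fun i => comp Q 0 i i).adjugate.mulVec fun i => comp Q r.succ i i)

theorem paramInv_param {e : ParamSpace d n} (he : e ∈ paramDom d n) : paramInv (param e) = e := by
  have hT := isUpperTriangular_triMat e.1
  have hV := Matrix.det_vandermonde_ne_zero_iff.2 (diag_injective_of_mem_paramDom he)
  refine Prod.ext ?_ (funext fun r => ?_)
  · funext ⟨⟨i, j⟩, hij⟩
    have hij' : i ≤ j := hij
    simp [paramInv, triMat_apply, hij']
  · have h1 : (fun i => comp (param e) r.succ i i) =
        (Matrix.vandermonde fun i => triMat e.1 i i).mulVec (e.2 r) :=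
      funext fun i => matPoly_diag (e.2 r) hT i
    simp only [paramInv, h1, comp_param_zero]
    rw [Matrix.mulVec_mulVec, Matrix.adjugate_mul, Matrix.smul_mulVec, Matrix.one_mulVec,
      smul_smul, inv_mul_cancel₀ hV, one_smul]

theorem continuousOn_paramInv :
    ContinuousOn paramInv (triangular (d + 1) n ∩ generic (d + 1) n) := by
  have hm : ∀ r i j, Continuous fun Q : Tuple (d + 1) n => comp Q r i j := fun r i j =>
    (continuous_comp r).matrix_elem i j
  have hV : Continuous fun Q : Tuple (d + 1) n => Matrix.vandermonde fun i => comp Q 0 i i :=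
    continuous_matrix fun i j => (hm 0 i i).pow j
  refine ContinuousOn.prodMk (continuous_pi fun p => hm 0 _ _).continuousOn
    (continuousOn_pi.2 fun r => ?_)
  refine ContinuousOn.smul (hV.matrix_det.continuousOn.inv₀ fun Q hQ => ?_)
    (hV.matrix_adjugate.matrix_mulVec (continuous_pi fun i => hm _ i i)).continuousOn
  exact Matrix.det_vandermonde_ne_zero_iff.2 (diag_injective_of_mem_generic hQ.1 hQ.2 0)

/-- A compact piece of the space of generic tuples. -/
def piece (d n k : ℕ) : Set (Tuple (d + 1) n) :=
  {X | X ∈ commuting (d + 1) n ∧ 1 ≤ k * ‖tupleDisc X‖ ∧ ‖X‖ ≤ k}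

theorem isClosed_piece (k : ℕ) : IsClosed (piece d n k) :=
  isClosed_commuting.inter ((isClosed_le continuous_const
    (continuous_const.mul continuous_tupleDisc.norm)).inter
    (isClosed_le continuous_norm continuous_const))

theorem isCompact_piece (k : ℕ) : IsCompact (piece d n k) :=
  Metric.isCompact_of_isClosed_isBounded (isClosed_piece k)
    ((Metric.isBounded_closedBall (x := 0) (r := (k : ℝ))).subset fun X hX => by
      simpa using hX.2.2)

theorem piece_subset_generic (k : ℕ) : piece d n k ⊆ generic (d + 1) n := by
  intro X hX
  refine mem_generic_iff.2 ⟨hX.1, fun h => ?_⟩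
  have := hX.2.1
  rw [h, norm_zero, mul_zero] at this
  exact absurd this (by norm_num)

theorem conj_mem_piece {k : ℕ} {X : Tuple (d + 1) n} (U : UGroup n) (hX : X ∈ piece d n k) :
    conj U X ∈ piece d n k :=
  ⟨conj_mem_commuting hX.1, by rw [tupleDisc_conj]; exact hX.2.1, by rw [norm_conj]; exact hX.2.2⟩

theorem monotone_piece : Monotone (piece d n) := by
  intro k l hkl X hX
  have h : (k : ℝ) ≤ l := Nat.cast_le.2 hkl
  exact ⟨hX.1, hX.2.1.trans (mul_le_mul_of_nonneg_right h (norm_nonneg _)), hX.2.2.trans h⟩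

theorem iUnion_piece : ⋃ k, piece d n k = generic (d + 1) n := by
  refine Set.Subset.antisymm (Set.iUnion_subset piece_subset_generic) fun X hX => ?_
  obtain ⟨hX, hD⟩ := mem_generic_iff.1 hX
  obtain ⟨k, hk⟩ := exists_nat_ge (max ‖tupleDisc X‖⁻¹ ‖X‖)
  refine Set.mem_iUnion.2 ⟨k, hX, ?_, (le_max_right _ _).trans hk⟩
  rw [← inv_mul_cancel₀ (norm_ne_zero_iff.2 hD)]
  exact mul_le_mul_of_nonneg_right ((le_max_left _ _).trans hk) (norm_nonneg _)

/-- On the generic tuples Cramer's rule gives a continuous inverse of `param`, so compactness of the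
pieces passes to parameters. -/
theorem isCompact_preimage_piece (k : ℕ) : IsCompact (param ⁻¹' piece d n k) := by
  have h1 : IsCompact (triangular (d + 1) n ∩ piece d n k) :=
    (isCompact_piece k).inter_left isClosed_triangular
  have h2 := h1.image_of_continuousOn (continuousOn_paramInv.mono
    (Set.inter_subset_inter_right _ (piece_subset_generic k)))
  refine h2.of_isClosed_subset ((isClosed_piece k).preimage contDiff_param.continuous) ?_
  intro e he
  exact ⟨param e, ⟨param_mem_triangular e, he⟩, paramInv_param (piece_subset_generic k he)⟩

/-- The Jacobian of the flow. -/
def flowJac (p : ParamSpace d n × skewZeroDiag n) : ℝ :=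
  jac ((paramBasis d n).prod (skewBasis n)) (fderiv ℝ flow p)

theorem continuous_flowJac : Continuous (flowJac : ParamSpace d n × skewZeroDiag n → ℝ) :=
  (continuous_jac _).comp (contDiff_flow.continuous_fderiv one_ne_zero)

theorem flowJac_nonneg (p : ParamSpace d n × skewZeroDiag n) : 0 ≤ flowJac p := Real.sqrt_nonneg _

theorem flowJac_pos {e : ParamSpace d n} (he : e ∈ paramDom d n) : 0 < flowJac (e, 0) :=
  jac_pos _ (fderiv_flow_injective he)

/-- The tube lemma around `K × {0}`; it turns conditions at `S = 0` into a radius uniform in the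
parameter. -/
theorem exists_pos_forall_of_isCompact {K : Set (ParamSpace d n)} (hK : IsCompact K)
    {O : Set (ParamSpace d n × skewZeroDiag n)} (hO : IsOpen O) (h : ∀ e ∈ K, (e, 0) ∈ O) :
    ∃ ε : ℝ, 0 < ε ∧ ∀ e ∈ K, ∀ S : skewZeroDiag n, ‖S‖ < ε → (e, S) ∈ O := by
  obtain ⟨u, v, -, hv, hKu, h0, huv⟩ := generalized_tube_lemma hK
    (isCompact_singleton (x := (0 : skewZeroDiag n))) hO (by
      rintro ⟨e, S⟩ ⟨he, hS⟩
      obtain rfl : S = 0 := hS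
      exact h e he)
  obtain ⟨ε, hε, hεv⟩ := Metric.isOpen_iff.1 hv 0 (h0 rfl)
  exact ⟨ε, hε, fun e he S hS => huv ⟨hKu he, hεv (by simpa using hS)⟩⟩

theorem exists_pos_fderiv_flow_injective {K : Set (ParamSpace d n)} (hK : IsCompact K)
    (hKd : K ⊆ paramDom d n) : ∃ ε : ℝ, 0 < ε ∧ ∀ e ∈ K, ∀ S : skewZeroDiag n, ‖S‖ < ε →
      Function.Injective (fderiv ℝ flow (e, S)) := by
  obtain ⟨ε, hε, h⟩ := exists_pos_forall_of_isCompact hK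
    (O := {p | flowJac p ≠ 0}) (isOpen_ne_fun continuous_flowJac continuous_const)
    fun e he => (flowJac_pos (hKd he)).ne'
  exact ⟨ε, hε, fun e he S hS => injective_of_jac_ne_zero _ (h e he S hS)⟩

theorem exists_pos_abs_flowJac_sub_lt {K : Set (ParamSpace d n)} (hK : IsCompact K) {η : ℝ}
    (hη : 0 < η) : ∃ ε : ℝ, 0 < ε ∧ ∀ e ∈ K, ∀ S : skewZeroDiag n, ‖S‖ < ε →
      |flowJac (e, S) - flowJac (e, 0)| < η := by
  refine exists_pos_forall_of_isCompact hK
    (O := {p | |flowJac p - flowJac (p.1, 0)| < η}) (isOpen_lt ?_ continuous_const) ?_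
  · exact (continuous_flowJac.sub (continuous_flowJac.comp (by fun_prop))).abs
  · intro e _
    simpa using hη

/-- For sorted tuples the image determines the coset of `e^S`, hence `S`; undoing the conjugation
recovers the parameter. -/
theorem injOn_flow (π : Equiv.Perm (Fin n)) {ε : ℝ}
    (hε : ∀ S S' : skewZeroDiag n, ‖S‖ < ε → ‖S'‖ < ε → (expU S')⁻¹ * expU S ∈ torus n → S = S') :
    Set.InjOn flow ((param ⁻¹' sorted d n π) ×ˢ Metric.ball (0 : skewZeroDiag n) ε) := by
  rintro ⟨e, S⟩ ⟨he, hS⟩ ⟨e', S'⟩ ⟨he', hS'⟩ h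
  have h1 := hε S S' (by simpa using hS) (by simpa using hS') (mem_torus_of_conj_eq he he' h)
  subst h1
  refine Prod.ext (injOn_param (sorted_subset π he).2 (sorted_subset π he').2 ?_) rfl
  have h2 := congrArg (conj (expU S)⁻¹) h
  simp only [flow] at h2
  rwa [conj_inv_conj, conj_inv_conj] at h2

end Compactness

/-! ### Haar measure and invariance of Hausdorff measure -/

section HaarMeasure

variable {d n : ℕ}

instance : (haarU n).IsHaarMeasure := by
  unfold haarU
  infer_instance

instance : IsProbabilityMeasure (haarU n) := ⟨by
  have h := Measure.haarMeasure_self (K₀ := (⊤ : TopologicalSpace.PositiveCompacts (UGroup n)))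
  rwa [TopologicalSpace.PositiveCompacts.coe_top] at h⟩

/-- A right translate is again a Haar probability measure, so uniqueness identifies the two. -/
instance : (haarU n).IsMulRightInvariant := ⟨fun g => by
  have : IsProbabilityMeasure ((haarU n).map (· * g)) :=
    Measure.isProbabilityMeasure_map (measurable_mul_const g).aemeasurable
  exact Measure.isHaarMeasure_eq_of_isProbabilityMeasure _ _⟩

theorem measurable_mk : Measurable (QuotientGroup.mk : UGroup n → UGroup n ⧸ torus n) :=
  measurable_quotient_mk''

theorem nu_apply {s : Set (UGroup n ⧸ torus n)} (hs : MeasurableSet s) :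
    nu n s = haarU n (QuotientGroup.mk ⁻¹' s) :=
  Measure.map_apply measurable_mk hs

theorem haarU_preimage_mul (s : Set (UGroup n)) (V : UGroup n) :
    haarU n {U | U * V ∈ s} = haarU n s :=
  measure_preimage_mul_right (haarU n) V s

theorem measurableSet_quotient_iff {s : Set (UGroup n ⧸ torus n)} :
    MeasurableSet s ↔ MeasurableSet (QuotientGroup.mk ⁻¹' s : Set (UGroup n)) := Iff.rfl

theorem measurable_conj (U : UGroup n) : Measurable (conj U : Tuple d n → Tuple d n) :=
  (isometry_conj U).continuous.measurable

theorem continuous_conj_left (X : Tuple d n) : Continuous fun U : UGroup n => conj U X := by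
  have h : Continuous fun U : UGroup n => (U, X) := continuous_id.prodMk continuous_const
  have h' := (continuous_conj (d := d) (n := n)).comp h
  exact h'

theorem preimage_conj_generic (U : UGroup n) : conj U ⁻¹' generic d n = generic d n := by
  ext X
  refine ⟨fun h => ?_, fun h => conj_mem_generic h⟩
  rw [← conj_inv_conj U X]
  exact conj_mem_generic h

/-- The Hausdorff measure on the generic commuting tuples. -/
def genMeasure (d n : ℕ) : Measure (Tuple (d + 1) n) :=
  (μHE[2 * n ^ 2 + 2 * d * n]).restrict (generic (d + 1) n)

theorem measurePreserving_conj (U : UGroup n) :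
    MeasurePreserving (conj U) (genMeasure d n) (genMeasure d n) := by
  let e : Tuple (d + 1) n ≃ᵢ Tuple (d + 1) n :=
    { toFun := conj U
      invFun := conj U⁻¹
      left_inv := conj_inv_conj U
      right_inv := conj_conj_inv U
      isometry_toFun := isometry_conj U }
  have h := (e.measurePreserving_euclideanHausdorffMeasure
    (2 * n ^ 2 + 2 * d * n)).restrict_preimage (measurableSet_generic (d := d + 1) (n := n))
  change MeasurePreserving (conj U) (Measure.restrict _ (conj U ⁻¹' generic (d + 1) n)) _ at h
  rwa [preimage_conj_generic] at h

end HaarMeasure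

/-! ### Thin slabs around sorted tuples -/

section Slab

variable {d n : ℕ}

/-- The tuples `e^S Q e^{-S}` for `Q` in a set of sorted tuples and small `S`. -/
def slab (π : Equiv.Perm (Fin n)) (ε : ℝ) (D : Set (Tuple (d + 1) n)) : Set (Tuple (d + 1) n) :=
  flow '' ((param ⁻¹' (D ∩ sorted d n π)) ×ˢ Metric.ball (0 : skewZeroDiag n) ε)

theorem exists_param_eq {π : Equiv.Perm (Fin n)} {Q : Tuple (d + 1) n} (hQ : Q ∈ sorted d n π) :
    ∃ e, param e = Q := by
  have h := sorted_subset π hQ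
  rw [← image_param_paramDom] at h
  obtain ⟨e, -, h⟩ := h
  exact ⟨e, h⟩

/-- Membership depends only on the coset of `V`: if `V = e^S t`, the torus element `t` is absorbed
in `Q`, since `D` and the sorted tuples are stable under the torus. -/
theorem conj_mem_slab_iff {π : Equiv.Perm (Fin n)} {ε : ℝ} {D : Set (Tuple (d + 1) n)}
    (hD : ∀ U : UGroup n, ∀ X ∈ D, conj U X ∈ D) {Q : Tuple (d + 1) n} (hQ : Q ∈ D ∩ sorted d n π)
    (V : UGroup n) :
    conj V Q ∈ slab π ε D ↔ (QuotientGroup.mk V : UGroup n ⧸ torus n) ∈ expBall n ε := by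
  rw [mk_mem_expBall_iff]
  constructor
  · rintro ⟨⟨e, S⟩, ⟨he, hS⟩, h⟩
    exact ⟨S, by simpa using hS, mem_torus_of_conj_eq hQ.2 he.2 h.symm⟩
  · rintro ⟨S, hS, ht⟩
    have hQ' : conj ((expU S)⁻¹ * V) Q ∈ D ∩ sorted d n π :=
      ⟨hD _ Q hQ.1, conj_torus_mem_sorted ht hQ.2⟩
    obtain ⟨e, he⟩ := exists_param_eq hQ'.2
    refine ⟨(e, S), ⟨?_, by simpa using hS⟩, ?_⟩
    · change param e ∈ D ∩ sorted d n π
      rw [he]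
      exact hQ'
    · rw [flow, he, ← conj_mul, mul_inv_cancel_left]

theorem slab_subset {π : Equiv.Perm (Fin n)} {ε : ℝ} {D : Set (Tuple (d + 1) n)}
    (hD : ∀ U : UGroup n, ∀ X ∈ D, conj U X ∈ D) : slab π ε D ⊆ D := by
  rintro _ ⟨⟨e, S⟩, ⟨he, -⟩, rfl⟩
  exact hD _ _ he.1

/-- The chart `S ↦ [e^S]` is injective on the ball of radius `ε`. -/
def InjRadius (n : ℕ) (ε : ℝ) : Prop :=
  ∀ S S' : skewZeroDiag n, ‖S‖ < ε → ‖S'‖ < ε → (expU S')⁻¹ * expU S ∈ torus n → S = S'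

theorem InjRadius.mono {ε ε' : ℝ} (h : InjRadius n ε) (hε : ε' ≤ ε) : InjRadius n ε' :=
  fun S S' hS hS' => h S S' (hS.trans_le hε) (hS'.trans_le hε)

theorem measurableSet_param_preimage {π : Equiv.Perm (Fin n)} {D : Set (Tuple (d + 1) n)}
    (hDm : MeasurableSet D) : MeasurableSet (param ⁻¹' (D ∩ sorted d n π)) :=
  contDiff_param.continuous.measurable (hDm.inter (measurableSet_sorted π))

theorem measurableSet_slab {π : Equiv.Perm (Fin n)} {ε : ℝ} (hε : InjRadius n ε)
    {D : Set (Tuple (d + 1) n)} (hDm : MeasurableSet D) : MeasurableSet (slab π ε D) :=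
  MeasurableSet.image_of_continuousOn_injOn
    ((measurableSet_param_preimage hDm).prod measurableSet_ball) contDiff_flow.continuous.continuousOn
    ((injOn_flow π hε).mono (Set.prod_mono (Set.preimage_mono Set.inter_subset_right) le_rfl))

/-- Along the orbit map of a single sorted `1`-tuple, the preimage of this set in `U(n)` is the
preimage of a slab, and slabs are injective continuous images of measurable sets. -/
theorem measurableSet_expBall {ε : ℝ} (hε : InjRadius n ε) : MeasurableSet (expBall n ε) := by
  rw [measurableSet_quotient_iff]
  obtain ⟨X, hX⟩ := exists_mem_generic (d := 1) (n := n)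
  obtain ⟨U, Q, hQ, -⟩ := exists_conj_sorted (d := 0) 1 hX
  have h : (QuotientGroup.mk ⁻¹' expBall n ε : Set (UGroup n)) =
      (fun V => conj V Q) ⁻¹' slab 1 ε (generic 1 n) := by
    ext V
    exact (conj_mem_slab_iff (fun U X => conj_mem_generic) ⟨hQ.1.2, hQ⟩ V).symm
  rw [h]
  exact (continuous_conj_left Q).measurable (measurableSet_slab hε measurableSet_generic)

theorem haarU_preimage_expBall {ε : ℝ} (hε : InjRadius n ε) (V : UGroup n) :
    haarU n {U | (QuotientGroup.mk (U * V) : UGroup n ⧸ torus n) ∈ expBall n ε} =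
      nu n (expBall n ε) := by
  rw [nu_apply (measurableSet_expBall hε)]
  exact haarU_preimage_mul (QuotientGroup.mk ⁻¹' expBall n ε) V

theorem nu_expBall_pos {ε : ℝ} (hε : InjRadius n ε) (h0 : 0 < ε) : 0 < nu n (expBall n ε) := by
  rw [nu_apply (measurableSet_expBall hε)]
  exact Measure.measure_pos_of_mem_nhds _ (preimage_expBall_mem_nhds h0)

/-- Average the indicator of the slab over conjugations. If `X = V Q V*` lies in `D`, then `U X U*`
is in the slab exactly when `[U V]` is in `expBall`; by right invariance such `U` have Haar measure
`ν(expBall)`. The s-finiteness needed for Fubini is a hypothesis because its proof below uses slabs.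
-/
theorem genMeasure_slab [SFinite (genMeasure d n)] (π : Equiv.Perm (Fin n)) {ε : ℝ}
    (hε : InjRadius n ε) {D : Set (Tuple (d + 1) n)} (hDm : MeasurableSet D)
    (hD : ∀ U : UGroup n, ∀ X ∈ D, conj U X ∈ D) :
    genMeasure d n (slab π ε D) = genMeasure d n D * nu n (expBall n ε) := by
  have hs := measurableSet_slab (π := π) hε hDm
  have hmeas : Measurable (Function.uncurry fun (U : UGroup n) (X : Tuple (d + 1) n) =>
      (slab π ε D).indicator (1 : Tuple (d + 1) n → ℝ≥0∞) (conj U X)) :=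
    (measurable_one.indicator hs).comp continuous_conj.measurable
  have h1 : ∀ U : UGroup n, ∫⁻ X, (slab π ε D).indicator (1 : Tuple (d + 1) n → ℝ≥0∞) (conj U X)
      ∂(genMeasure d n) = genMeasure d n (slab π ε D) := fun U => by
    rw [(measurePreserving_conj U).lintegral_comp (measurable_one.indicator hs),
      lintegral_indicator_one hs]
  have h2 : ∀ X ∈ generic (d + 1) n, ∫⁻ U, (slab π ε D).indicator
      (1 : Tuple (d + 1) n → ℝ≥0∞) (conj U X) ∂(haarU n) =
        D.indicator (fun _ => nu n (expBall n ε)) X := by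
    intro X hX
    have h3 : (fun U => (slab π ε D).indicator (1 : Tuple (d + 1) n → ℝ≥0∞) (conj U X)) =
        ((fun U => conj U X) ⁻¹' slab π ε D).indicator 1 := rfl
    have hc : Measurable fun U : UGroup n => conj U X :=
      (continuous_conj_left X).measurable
    rw [h3, lintegral_indicator_one (hc hs)]
    by_cases hXD : X ∈ D
    · obtain ⟨V, Q, hQ, rfl⟩ := exists_conj_sorted π hX
      have hQD : Q ∈ D := by
        rw [← conj_inv_conj V Q]
        exact hD _ _ hXD
      rw [Set.indicator_of_mem hXD, ← haarU_preimage_expBall hε V]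
      congr 1
      ext U
      change conj U (conj V Q) ∈ slab π ε D ↔ _
      rw [← conj_mul]
      exact conj_mem_slab_iff hD ⟨hQD, hQ⟩ _
    · rw [Set.indicator_of_notMem hXD]
      convert measure_empty (μ := haarU n)
      refine Set.eq_empty_of_forall_notMem fun U hU => hXD ?_
      rw [← conj_inv_conj U X]
      exact hD _ _ (slab_subset hD hU)
  calc genMeasure d n (slab π ε D)
      = ∫⁻ U, ∫⁻ X, (slab π ε D).indicator (1 : Tuple (d + 1) n → ℝ≥0∞) (conj U X)
          ∂(genMeasure d n) ∂(haarU n) := by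
        simp_rw [h1]
        rw [lintegral_const, measure_univ, mul_one]
    _ = ∫⁻ X, ∫⁻ U, (slab π ε D).indicator (1 : Tuple (d + 1) n → ℝ≥0∞) (conj U X)
          ∂(haarU n) ∂(genMeasure d n) := lintegral_lintegral_swap hmeas.aemeasurable
    _ = ∫⁻ X, D.indicator (fun _ => nu n (expBall n ε)) X ∂(genMeasure d n) :=
        setLIntegral_congr_fun measurableSet_generic h2
    _ = genMeasure d n D * nu n (expBall n ε) := by
        rw [lintegral_indicator hDm, setLIntegral_const, mul_comm]

/-! ### The area formula for the slabs -/

/-- Radii for which the flow is an immersion near a compact piece. -/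
def ImmRadius (d n k : ℕ) (ε : ℝ) : Prop :=
  ∀ e ∈ param ⁻¹' piece d n k, ∀ S : skewZeroDiag n, ‖S‖ < ε →
    Function.Injective (fderiv ℝ flow (e, S))

theorem ImmRadius.mono {k : ℕ} {ε ε' : ℝ} (h : ImmRadius d n k ε) (hε : ε' ≤ ε) :
    ImmRadius d n k ε' := fun e he S hS => h e he S (hS.trans_le hε)

theorem exists_injRadius : ∃ ε : ℝ, 0 < ε ∧ InjRadius n ε := exists_injective_expU

theorem exists_immRadius (k : ℕ) : ∃ ε : ℝ, 0 < ε ∧ ImmRadius d n k ε :=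
  exists_pos_fderiv_flow_injective (isCompact_preimage_piece k) fun _ he => piece_subset_generic k he

/-- Lebesgue measure on the parameter space. -/
def paramMeasure (d n : ℕ) : Measure (ParamSpace d n) := (paramBasis d n).addHaar

instance : (paramMeasure d n).IsAddHaarMeasure := by
  unfold paramMeasure
  infer_instance

theorem addHaar_skewBasis : (skewBasis n).addHaar = volume (α := skewZeroDiag n) :=
  OrthonormalBasis.addHaar_eq_volume _

/-- The area formula for `flow`; the two radii supply injectivity and the immersion property. -/
theorem euclideanHausdorffMeasure_slab (π : Equiv.Perm (Fin n)) {k : ℕ} {ε : ℝ}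
    (hε : InjRadius n ε) (hε' : ImmRadius d n k ε) {D : Set (Tuple (d + 1) n)}
    (hDm : MeasurableSet D) (hDk : D ⊆ piece d n k) :
    μHE[2 * n ^ 2 + 2 * d * n] (slab π ε D) =
      ∫⁻ e in param ⁻¹' (D ∩ sorted d n π), ∫⁻ S in Metric.ball (0 : skewZeroDiag n) ε,
        ENNReal.ofReal (flowJac (e, S)) ∂volume ∂(paramMeasure d n) := by
  have h := area_formula ((paramBasis d n).prod (skewBasis n)) contDiff_flow
    ((measurableSet_param_preimage (π := π) hDm).prod
      (measurableSet_ball (x := (0 : skewZeroDiag n)) (ε := ε)))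
    ((injOn_flow π hε).mono (Set.prod_mono (Set.preimage_mono Set.inter_subset_right) le_rfl))
    (by
      rintro ⟨e, S⟩ ⟨he, hS⟩
      exact hε' e (hDk he.1) S (by simpa using hS))
  rw [card_prodBasis, Module.Basis.prod_addHaar, addHaar_skewBasis] at h
  rw [slab, h]
  exact setLIntegral_prod _ (continuous_flowJac.measurable.ennreal_ofReal.aemeasurable)

theorem genMeasure_apply_of_subset {s : Set (Tuple (d + 1) n)} (hs : s ⊆ generic (d + 1) n) :
    genMeasure d n s = μHE[2 * n ^ 2 + 2 * d * n] s :=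
  Measure.restrict_eq_self _ hs

theorem setLIntegral_flowJac_lt_top (k : ℕ) (ε : ℝ) {A : Set (ParamSpace d n)}
    (hA : A ⊆ param ⁻¹' piece d n k) :
    ∫⁻ e in A, ∫⁻ S in Metric.ball (0 : skewZeroDiag n) ε,
        ENNReal.ofReal (flowJac (e, S)) ∂volume ∂(paramMeasure d n) < ∞ := by
  have hK := (isCompact_preimage_piece (d := d) (n := n) k).prod
    (isCompact_closedBall (0 : skewZeroDiag n) ε)
  obtain ⟨C, hC⟩ := (hK.image continuous_flowJac).bddAbove
  have h1 : ∀ e ∈ param ⁻¹' piece d n k, ∫⁻ S in Metric.ball (0 : skewZeroDiag n) ε,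
      ENNReal.ofReal (flowJac (e, S)) ≤
        ENNReal.ofReal C * volume (Metric.ball (0 : skewZeroDiag n) ε) := fun e he => by
    rw [← setLIntegral_const]
    refine setLIntegral_mono measurable_const fun S hS => ENNReal.ofReal_le_ofReal ?_
    exact hC ⟨(e, S), ⟨he, Metric.ball_subset_closedBall hS⟩, rfl⟩
  calc _ ≤ ∫⁻ e in param ⁻¹' piece d n k, ∫⁻ S in Metric.ball (0 : skewZeroDiag n) ε,
        ENNReal.ofReal (flowJac (e, S)) ∂volume ∂(paramMeasure d n) := lintegral_mono_set hA
    _ ≤ ∫⁻ _ in param ⁻¹' piece d n k, ENNReal.ofReal C *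
          volume (Metric.ball (0 : skewZeroDiag n) ε) ∂(paramMeasure d n) :=
        setLIntegral_mono measurable_const h1
    _ < ∞ := by
        rw [setLIntegral_const]
        exact ENNReal.mul_lt_top (ENNReal.mul_lt_top ENNReal.ofReal_lt_top measure_ball_lt_top)
          (isCompact_preimage_piece k).measure_lt_top

/-- Slabs over compact pieces have finite measure, the Jacobian being bounded there. Their
translates by a countable dense set of unitaries cover the generic tuples: for `X = V Q V*`, some
such `U` brings `U V` close to `1`. -/
instance : SigmaFinite (genMeasure d n) := by
  obtain ⟨ε₀, hε₀, hinj⟩ := exists_injRadius (n := n)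
  choose ε' hε' himm using exists_immRadius (d := d) (n := n)
  let ε : ℕ → ℝ := fun k => min ε₀ (ε' k)
  have hpos : ∀ k, 0 < ε k := fun k => lt_min hε₀ (hε' k)
  obtain ⟨s, hs, hsd⟩ := TopologicalSpace.exists_countable_dense (UGroup n)
  let T : Set (Set (Tuple (d + 1) n)) := insert (generic (d + 1) n)ᶜ
    (⋃ k, (fun U => conj U ⁻¹' slab 1 (ε k) (piece d n k)) '' s)
  refine Measure.sigmaFinite_of_countable (S := T)
    ((Set.countable_iUnion fun k => hs.image _).insert _) ?_ ?_
  · intro t ht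
    rcases ht with rfl | ht
    · have h : genMeasure d n (generic (d + 1) n)ᶜ = 0 := by
        rw [genMeasure, Measure.restrict_apply measurableSet_generic.compl]
        simp
      rw [h]
      exact ENNReal.zero_lt_top
    · obtain ⟨k, U, -, rfl⟩ := Set.mem_iUnion.1 ht
      have hm := (isClosed_piece (d := d) (n := n) k).measurableSet
      have hi := hinj.mono (min_le_left ε₀ (ε' k))
      rw [(measurePreserving_conj U).measure_preimage (measurableSet_slab hi hm).nullMeasurableSet,
        genMeasure_apply_of_subset ((slab_subset fun U X => conj_mem_piece U).trans
          (piece_subset_generic k)),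
        euclideanHausdorffMeasure_slab 1 hi ((himm k).mono (min_le_right _ _)) hm le_rfl]
      exact setLIntegral_flowJac_lt_top k _ (Set.preimage_mono Set.inter_subset_left)
  · refine Set.eq_univ_of_forall fun X => ?_
    by_cases hX : X ∈ generic (d + 1) n
    · have hX' := hX
      rw [← iUnion_piece] at hX'
      obtain ⟨k, hk⟩ := Set.mem_iUnion.1 hX'
      obtain ⟨V, Q, hQ, rfl⟩ := exists_conj_sorted 1 hX
      have hQk : Q ∈ piece d n k := by
        rw [← conj_inv_conj V Q]
        exact conj_mem_piece _ hk
      have hnhds : {U : UGroup n | (QuotientGroup.mk (U * V) : UGroup n ⧸ torus n) ∈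
          expBall n (ε k)} ∈ 𝓝 V⁻¹ := by
        have hc : Continuous fun U : UGroup n => U * V := by fun_prop
        have h0 := preimage_expBall_mem_nhds (n := n) (hpos k)
        rw [← inv_mul_cancel V] at h0
        exact hc.continuousAt.preimage_mem_nhds h0
      obtain ⟨O, hO, hOo, hVO⟩ := mem_nhds_iff.1 hnhds
      obtain ⟨U, hUO, hUs⟩ := hsd.inter_open_nonempty O hOo ⟨_, hVO⟩
      refine ⟨_, Or.inr (Set.mem_iUnion.2 ⟨k, U, hUs, rfl⟩), ?_⟩
      change conj U (conj V Q) ∈ slab 1 (ε k) (piece d n k)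
      rw [← conj_mul]
      exact (conj_mem_slab_iff (fun U X => conj_mem_piece U) ⟨hQk, hQ⟩ _).2 (hO hUO)
    · exact ⟨_, Or.inl rfl, hX⟩

end Slab

/-! ### Shrinking slabs and the constant `C` -/

section Limit

variable {d n : ℕ}

theorem setLIntegral_flowJac_zero_lt_top (k : ℕ) {A : Set (ParamSpace d n)}
    (hA : A ⊆ param ⁻¹' piece d n k) :
    ∫⁻ e in A, ENNReal.ofReal (flowJac (e, 0)) ∂(paramMeasure d n) < ∞ := by
  have hK := isCompact_preimage_piece (d := d) (n := n) k
  have hc : Continuous fun e : ParamSpace d n => flowJac (e, 0) :=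
    continuous_flowJac.comp (continuous_id.prodMk continuous_const)
  obtain ⟨C, hC⟩ := (hK.image hc).bddAbove
  calc _ ≤ ∫⁻ e in param ⁻¹' piece d n k, ENNReal.ofReal (flowJac (e, 0)) ∂(paramMeasure d n) :=
        lintegral_mono_set hA
    _ ≤ ∫⁻ _ in param ⁻¹' piece d n k, ENNReal.ofReal C ∂(paramMeasure d n) :=
        setLIntegral_mono measurable_const fun e he => ENNReal.ofReal_le_ofReal (hC ⟨e, he, rfl⟩)
    _ < ∞ := by
        rw [setLIntegral_const]
        exact ENNReal.mul_lt_top ENNReal.ofReal_lt_top hK.measure_lt_top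

theorem measurable_flowJac_zero :
    Measurable fun e : ParamSpace d n => ENNReal.ofReal (flowJac (e, 0)) := by
  have hc : Continuous fun e : ParamSpace d n => flowJac (e, 0) :=
    continuous_flowJac.comp (continuous_id.prodMk continuous_const)
  exact hc.measurable.ennreal_ofReal

/-- The Jacobian is frozen at `S = 0` with a uniform additive error. In the matching lower bound
`mul_setLIntegral_flowJac_le`, the error stands on the larger side to avoid truncated subtraction.
-/
theorem setLIntegral_flowJac_le {A : Set (ParamSpace d n)} {ε : ℝ} {η : ℝ≥0}
    (h : ∀ e ∈ A, ∀ S : skewZeroDiag n, ‖S‖ < ε → |flowJac (e, S) - flowJac (e, 0)| < η) :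
    ∫⁻ e in A, ∫⁻ S in Metric.ball (0 : skewZeroDiag n) ε,
        ENNReal.ofReal (flowJac (e, S)) ∂volume ∂(paramMeasure d n) ≤
      (∫⁻ e in A, ENNReal.ofReal (flowJac (e, 0)) ∂(paramMeasure d n) + η * paramMeasure d n A) *
        volume (Metric.ball (0 : skewZeroDiag n) ε) := by
  have hc := measurable_flowJac_zero (d := d) (n := n)
  have h1 : ∀ e ∈ A, ∫⁻ S in Metric.ball (0 : skewZeroDiag n) ε,
      ENNReal.ofReal (flowJac (e, S)) ∂volume ≤ (ENNReal.ofReal (flowJac (e, 0)) + η) *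
        volume (Metric.ball (0 : skewZeroDiag n) ε) := fun e he => by
    rw [← setLIntegral_const]
    refine setLIntegral_mono measurable_const fun S hS => ?_
    rw [← ENNReal.ofReal_coe_nnreal, ← ENNReal.ofReal_add (flowJac_nonneg _) (NNReal.coe_nonneg η)]
    refine ENNReal.ofReal_le_ofReal ?_
    have := (abs_lt.1 (h e he S (by simpa using hS))).2
    linarith
  refine (setLIntegral_mono ((hc.add_const _).mul_const _) h1).trans (le_of_eq ?_)
  rw [lintegral_mul_const _ (hc.add_const _), lintegral_add_right _ measurable_const,
    setLIntegral_const]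

theorem mul_setLIntegral_flowJac_le {A : Set (ParamSpace d n)} {ε : ℝ} {η : ℝ≥0}
    (h : ∀ e ∈ A, ∀ S : skewZeroDiag n, ‖S‖ < ε → |flowJac (e, S) - flowJac (e, 0)| < η) :
    (∫⁻ e in A, ENNReal.ofReal (flowJac (e, 0)) ∂(paramMeasure d n)) *
        volume (Metric.ball (0 : skewZeroDiag n) ε) ≤
      ∫⁻ e in A, ∫⁻ S in Metric.ball (0 : skewZeroDiag n) ε,
        ENNReal.ofReal (flowJac (e, S)) ∂volume ∂(paramMeasure d n) +
      η * paramMeasure d n A * volume (Metric.ball (0 : skewZeroDiag n) ε) := by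
  have hc := measurable_flowJac_zero (d := d) (n := n)
  have hm : Measurable fun e : ParamSpace d n => ∫⁻ S in Metric.ball (0 : skewZeroDiag n) ε,
      ENNReal.ofReal (flowJac (e, S)) ∂volume :=
    continuous_flowJac.measurable.ennreal_ofReal.lintegral_prod_right'
  have h1 : ∀ e ∈ A, ENNReal.ofReal (flowJac (e, 0)) * volume (Metric.ball (0 : skewZeroDiag n) ε) ≤
      ∫⁻ S in Metric.ball (0 : skewZeroDiag n) ε, ENNReal.ofReal (flowJac (e, S)) ∂volume +
        η * volume (Metric.ball (0 : skewZeroDiag n) ε) := fun e he => by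
    rw [← setLIntegral_const, ← setLIntegral_const, ← lintegral_add_right _ measurable_const]
    refine setLIntegral_mono' measurableSet_ball fun S hS => ?_
    rw [← ENNReal.ofReal_coe_nnreal, ← ENNReal.ofReal_add (flowJac_nonneg _) (NNReal.coe_nonneg η)]
    refine ENNReal.ofReal_le_ofReal ?_
    have := (abs_lt.1 (h e he S (by simpa using hS))).1
    linarith
  rw [← lintegral_mul_const _ hc]
  refine (setLIntegral_mono (hm.add_const _) h1).trans (le_of_eq ?_)
  rw [lintegral_add_right _ measurable_const, setLIntegral_const, mul_right_comm]

/-- Equate the two values of the measure of a slab, by averaging and by the area formula, and divide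
by the volume of the ball. The measure of `D` is not assumed finite, nor is convergence of the
ratio; both are drawn from this statement. -/
theorem tendsto_genMeasure_mul (π : Equiv.Perm (Fin n)) (k : ℕ) {D : Set (Tuple (d + 1) n)}
    (hDm : MeasurableSet D) (hD : ∀ U : UGroup n, ∀ X ∈ D, conj U X ∈ D) (hDk : D ⊆ piece d n k) :
    Tendsto (fun ε : ℝ => genMeasure d n D *
        (nu n (expBall n ε) / volume (Metric.ball (0 : skewZeroDiag n) ε))) (𝓝[>] 0)
      (𝓝 (∫⁻ e in param ⁻¹' (D ∩ sorted d n π),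
        ENNReal.ofReal (flowJac (e, 0)) ∂(paramMeasure d n))) := by
  set A : Set (ParamSpace d n) := param ⁻¹' (D ∩ sorted d n π) with hA
  have hAk : A ⊆ param ⁻¹' piece d n k := fun e he => hDk he.1
  have hfin := setLIntegral_flowJac_zero_lt_top k hAk
  have hM : paramMeasure d n A ≠ ∞ :=
    ((measure_mono hAk).trans_lt (isCompact_preimage_piece k).measure_lt_top).ne
  refine (ENNReal.tendsto_nhds hfin.ne).2 fun δ hδ => ?_
  obtain ⟨η, hη, hηδ⟩ := ENNReal.exists_nnreal_pos_mul_lt hM hδ.ne'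
  obtain ⟨ε₁, hε₁, h₁⟩ := exists_pos_abs_flowJac_sub_lt
    (isCompact_preimage_piece (d := d) (n := n) k) (η := η) (NNReal.coe_pos.2 hη)
  obtain ⟨ε₂, hε₂, h₂⟩ := exists_injRadius (n := n)
  obtain ⟨ε₃, hε₃, h₃⟩ := exists_immRadius (d := d) (n := n) k
  have hmem : Set.Ioo (0 : ℝ) (min ε₁ (min ε₂ ε₃)) ∈ 𝓝[>] (0 : ℝ) :=
    Ioo_mem_nhdsGT (lt_min hε₁ (lt_min hε₂ hε₃))
  filter_upwards [hmem] with ε hε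
  have hε1 : ε ≤ ε₁ := hε.2.le.trans (min_le_left _ _)
  have hε2 := h₂.mono (hε.2.le.trans ((min_le_right _ _).trans (min_le_left _ _)))
  have hε3 := h₃.mono (hε.2.le.trans ((min_le_right _ _).trans (min_le_right _ _)))
  set v := volume (Metric.ball (0 : skewZeroDiag n) ε) with hv
  have hv0 : v ≠ 0 := (Metric.measure_ball_pos volume _ hε.1).ne'
  have hv1 : v ≠ ∞ := measure_ball_lt_top.ne
  have hI := genMeasure_slab π hε2 hDm hD
  rw [genMeasure_apply_of_subset ((slab_subset hD).trans (hDk.trans (piece_subset_generic k))),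
    euclideanHausdorffMeasure_slab π hε2 hε3 hDm hDk] at hI
  have hb : ∀ e ∈ A, ∀ S : skewZeroDiag n, ‖S‖ < ε → |flowJac (e, S) - flowJac (e, 0)| < η :=
    fun e he S hS => h₁ e (hAk he) S (hS.trans_le hε1)
  have hle := setLIntegral_flowJac_le hb
  have hge := mul_setLIntegral_flowJac_le hb
  rw [hI, ← hv] at hle hge
  rw [← mul_div_assoc]
  constructor
  · rw [tsub_le_iff_right]
    refine (((ENNReal.le_div_iff_mul_le (Or.inl hv0) (Or.inl hv1)).2 hge).trans ?_)
    rw [ENNReal.add_div, ENNReal.mul_div_cancel_right hv0 hv1]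
    gcongr
  · refine ENNReal.div_le_of_le_mul (hle.trans ?_)
    gcongr

/-- The ratio of `ν` and of Lebesgue measure in the chart `S ↦ [e^S]` has a limit. -/
theorem exists_tendsto_nu_div (n : ℕ) : ∃ C : ℝ, 0 < C ∧ Tendsto (fun ε : ℝ =>
    nu n (expBall n ε) / volume (Metric.ball (0 : skewZeroDiag n) ε)) (𝓝[>] 0)
      (𝓝 (ENNReal.ofReal C)⁻¹) := by
  -- Single matrices suffice: the ratio involves only `U(n)`, so one constant serves all tuple
  -- lengths. Some sorted part of a compact piece has positive parameter measure.
  have hne : paramMeasure 0 n (paramDom 0 n) ≠ 0 := by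
    refine (isOpen_paramDom.measure_pos _ ?_).ne'
    obtain ⟨X, hX⟩ := exists_mem_generic (d := 1) (n := n)
    obtain ⟨U, Q, hQ, -⟩ := exists_conj_sorted (d := 0) 1 hX
    obtain ⟨e, rfl⟩ := exists_param_eq hQ
    exact ⟨e, hQ.1.2⟩
  have hcov : paramDom 0 n ⊆ ⋃ p : Equiv.Perm (Fin n) × ℕ,
      param ⁻¹' (piece 0 n p.2 ∩ sorted 0 n p.1) := by
    intro e he
    have h1 : param e ∈ ⋃ k, piece 0 n k := by rw [iUnion_piece]; exact he
    have h2 : param e ∈ ⋃ π, sorted 0 n π := by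
      rw [iUnion_sorted]
      exact ⟨param_mem_triangular e, he⟩
    obtain ⟨k, hk⟩ := Set.mem_iUnion.1 h1
    obtain ⟨π, hπ⟩ := Set.mem_iUnion.1 h2
    exact Set.mem_iUnion.2 ⟨(π, k), hk, hπ⟩
  obtain ⟨⟨π, k⟩, hπk⟩ : ∃ p : Equiv.Perm (Fin n) × ℕ,
      paramMeasure 0 n (param ⁻¹' (piece 0 n p.2 ∩ sorted 0 n p.1)) ≠ 0 := by
    by_contra! h
    exact hne (measure_mono_null hcov (measure_iUnion_null h))
  have hDm := (isClosed_piece (d := 0) (n := n) k).measurableSet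
  have hlim := tendsto_genMeasure_mul π k hDm (fun U X => conj_mem_piece U) le_rfl
  set A : Set (ParamSpace 0 n) := param ⁻¹' (piece 0 n k ∩ sorted 0 n π) with hA
  have hAm : MeasurableSet A := measurableSet_param_preimage hDm
  set I := ∫⁻ e in A, ENNReal.ofReal (flowJac (e, 0)) ∂(paramMeasure 0 n) with hI
  have hI1 : I ≠ ∞ := (setLIntegral_flowJac_zero_lt_top k fun e he => he.1).ne
  have hI0 : I ≠ 0 := by
    refine ((setLIntegral_pos_iff measurable_flowJac_zero).2 ?_).ne'
    refine (pos_iff_ne_zero.2 hπk).trans_le (measure_mono fun e he => ⟨?_, he⟩)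
    exact (ENNReal.ofReal_pos.2 (flowJac_pos (sorted_subset π he.2).2)).ne'
  set m := genMeasure 0 n (piece 0 n k) with hm
  -- The limit `I` of `m` times the ratio is positive and finite. So `m = 0` is excluded, and `m =
  -- ∞` would make the product infinite for all small `ε`. Therefore the ratio tends to `I / m`, and
  -- the constant is `m / I`.
  have hm0 : m ≠ 0 := by
    intro h0
    rw [h0] at hlim
    simp only [zero_mul] at hlim
    exact hI0 (tendsto_nhds_unique hlim tendsto_const_nhds)
  have hm1 : m ≠ ∞ := by
    intro h1
    obtain ⟨ε₂, hε₂, h₂⟩ := exists_injRadius (n := n)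
    have hev : (fun ε : ℝ => m * (nu n (expBall n ε) /
        volume (Metric.ball (0 : skewZeroDiag n) ε))) =ᶠ[𝓝[>] 0] fun _ => ∞ := by
      filter_upwards [Ioo_mem_nhdsGT hε₂] with ε hε
      rw [h1]
      exact ENNReal.top_mul (ENNReal.div_pos (nu_expBall_pos (h₂.mono hε.2.le) hε.1).ne'
        measure_ball_lt_top.ne).ne'
    exact hI1 (tendsto_nhds_unique (hlim.congr' hev) tendsto_const_nhds)
  have hmI : m / I ≠ ∞ := ENNReal.div_ne_top hm1 hI0
  refine ⟨(m / I).toReal, ENNReal.toReal_pos (ENNReal.div_pos hm0 hI1).ne' hmI, ?_⟩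
  rw [ENNReal.ofReal_toReal hmI, ENNReal.inv_div (Or.inl hI1) (Or.inl hI0)]
  have h := ENNReal.Tendsto.const_mul (a := m⁻¹) hlim (Or.inr (ENNReal.inv_ne_top.2 hm0))
  rw [mul_comm m⁻¹, ← div_eq_mul_inv] at h
  refine h.congr fun ε => ?_
  rw [← mul_assoc, ENNReal.inv_mul_cancel hm0 hm1, one_mul]

end Limit

/-! ### Integration in polar coordinates over `U(n)` -/

section Polar

variable {d n : ℕ}

theorem measurableSet_triangular_generic :
    MeasurableSet (triangular d n ∩ generic d n) :=
  isClosed_triangular.measurableSet.inter measurableSet_generic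

/-- The Jacobian of the parametrization of the upper triangular tuples. -/
def paramJac (e : ParamSpace d n) : ℝ := jac (paramBasis d n) (fderiv ℝ param e)

theorem continuous_paramJac : Continuous (paramJac : ParamSpace d n → ℝ) :=
  (continuous_jac _).comp (contDiff_param.continuous_fderiv one_ne_zero)

theorem paramJac_pos {e : ParamSpace d n} (he : e ∈ paramDom d n) : 0 < paramJac e :=
  jac_pos _ (fderiv_param_injective he)

theorem flowJac_zero {e : ParamSpace d n} (he : e ∈ paramDom d n) :
    flowJac (e, 0) = paramJac e * kappa 1 (param e) :=
  jac_flow _ he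

/-- The area formula for `param`, which turns integrals against `dQ` into Lebesgue integrals over
parameters. -/
theorem dQ_eq_map : dQ (d + 1) n = Measure.map param
    (((paramMeasure d n).restrict (paramDom d n)).withDensity
      fun e => ENNReal.ofReal (paramJac e)) := by
  ext s hs
  have hms : MeasurableSet (param ⁻¹' s : Set (ParamSpace d n)) :=
    contDiff_param.continuous.measurable hs
  rw [Measure.map_apply contDiff_param.continuous.measurable hs, withDensity_apply _ hms,
    Measure.restrict_restrict hms, dQ, Measure.restrict_apply hs, ← image_param_paramDom,
    ← Set.image_preimage_inter]
  have h := area_formula (paramBasis d n) contDiff_param (hms.inter isOpen_paramDom.measurableSet)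
    (injOn_param.mono Set.inter_subset_right) fun e he => fderiv_param_injective he.2
  rw [card_paramBasis] at h
  exact h

instance : SFinite (dQ (d + 1) n) := by
  rw [dQ_eq_map]
  infer_instance

/-- The density `κ` on the generic upper triangular tuples, extended by zero. -/
def kappaFun (C : ℝ) : Tuple (d + 1) n → ℝ≥0∞ :=
  (triangular (d + 1) n ∩ generic (d + 1) n).indicator fun Q => ENNReal.ofReal (kappa C Q)

theorem kappaFun_of_mem {C : ℝ} {Q : Tuple (d + 1) n}
    (hQ : Q ∈ triangular (d + 1) n ∩ generic (d + 1) n) :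
    kappaFun C Q = ENNReal.ofReal (kappa C Q) := Set.indicator_of_mem hQ _

theorem kappa_eq_mul (C : ℝ) (Q : Tuple d n) : kappa C Q = C * kappa 1 Q := by
  simp [kappa]

/-- In parameters `κ` is `C` times a quotient of two continuous Jacobians, and the parameters depend
continuously on a generic triangular tuple. The varying tangent spaces need not be examined. -/
theorem measurable_kappaFun (C : ℝ) : Measurable (kappaFun C : Tuple (d + 1) n → ℝ≥0∞) := by
  classical
  let g : ParamSpace d n → ℝ := fun e => C * (flowJac (e, 0) / paramJac e)
  have hc : Continuous fun e : ParamSpace d n => flowJac (e, 0) :=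
    continuous_flowJac.comp (continuous_id.prodMk continuous_const)
  have hg : Measurable fun e => ENNReal.ofReal (g e) :=
    ((hc.measurable.div continuous_paramJac.measurable).const_mul C).ennreal_ofReal
  let p : Tuple (d + 1) n → ParamSpace d n :=
    (triangular (d + 1) n ∩ generic (d + 1) n).piecewise paramInv fun _ => 0
  have hp : Measurable p := ContinuousOn.measurable_piecewise continuousOn_paramInv
    continuousOn_const measurableSet_triangular_generic
  have h : (kappaFun C : Tuple (d + 1) n → ℝ≥0∞) =
      (triangular (d + 1) n ∩ generic (d + 1) n).indicator fun Q => ENNReal.ofReal (g (p Q)) := by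
    refine Set.indicator_congr fun Q hQ => ?_
    have hp' : p Q = paramInv Q := Set.piecewise_eq_of_mem _ _ _ hQ
    rw [← image_param_paramDom] at hQ
    obtain ⟨e, he, rfl⟩ := hQ
    rw [hp', paramInv_param he]
    simp only [g]
    rw [flowJac_zero he, mul_div_cancel_left₀ _ (paramJac_pos he).ne', kappa_eq_mul]
  rw [h]
  exact (hg.comp hp).indicator measurableSet_triangular_generic

/-- The measure `κ dQ` on the sorted upper triangular tuples. -/
def sortedMeasure (C : ℝ) (π : Equiv.Perm (Fin n)) : Measure (Tuple (d + 1) n) :=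
  ((dQ (d + 1) n).restrict (sorted d n π)).withDensity (kappaFun C)

instance (C : ℝ) (π : Equiv.Perm (Fin n)) : SFinite (sortedMeasure C π : Measure (Tuple (d + 1) n)) := by
  unfold sortedMeasure
  infer_instance

/-- By `flowJac_zero` the Jacobian of `param` times `κ` is `C` times that of `flow` at `S = 0`; this
recognises `κ dQ` in the limit of the slabs. -/
theorem sortedMeasure_apply (C : ℝ) (π : Equiv.Perm (Fin n)) (hC : 0 ≤ C)
    {D : Set (Tuple (d + 1) n)} (hD : MeasurableSet D) :
    sortedMeasure C π D = ENNReal.ofReal C * ∫⁻ e in param ⁻¹' (D ∩ sorted d n π),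
      ENNReal.ofReal (flowJac (e, 0)) ∂(paramMeasure d n) := by
  have hm := hD.inter (measurableSet_sorted (d := d) π)
  have hmp : MeasurableSet (param ⁻¹' (D ∩ sorted d n π)) := measurableSet_param_preimage hD
  have hsub : param ⁻¹' (D ∩ sorted d n π) ⊆ paramDom d n := fun e he => (sorted_subset π he.2).2
  have hk : Measurable fun e : ParamSpace d n => kappaFun C (param e) :=
    (measurable_kappaFun C).comp contDiff_param.continuous.measurable
  rw [sortedMeasure, withDensity_apply _ hD, Measure.restrict_restrict hD, dQ_eq_map,
    setLIntegral_map hm (measurable_kappaFun C) contDiff_param.continuous.measurable,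
    setLIntegral_withDensity_eq_setLIntegral_mul _ continuous_paramJac.measurable.ennreal_ofReal
      hk hmp,
    Measure.restrict_restrict hmp, Set.inter_eq_left.2 hsub,
    ← lintegral_const_mul _ measurable_flowJac_zero]
  refine setLIntegral_congr_fun hmp fun e he => ?_
  simp only [Pi.mul_apply]
  rw [kappaFun_of_mem (sorted_subset π he.2), flowJac_zero (hsub he), kappa_eq_mul,
    ENNReal.ofReal_mul hC, ENNReal.ofReal_mul (paramJac_pos (hsub he)).le]
  ring

/-- `C` is the limit of the ratio of Lebesgue measure and `ν` in the chart `S ↦ [e^S]`. -/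
def IsChartRatio (n : ℕ) (C : ℝ) : Prop :=
  0 < C ∧ Tendsto (fun ε : ℝ =>
    nu n (expBall n ε) / volume (Metric.ball (0 : skewZeroDiag n) ε)) (𝓝[>] 0)
      (𝓝 (ENNReal.ofReal C)⁻¹)

/-- Uniqueness of limits: the ratio tends to `1 / C`, so the limit in `tendsto_genMeasure_mul` is
also the measure of `D` divided by `C`. -/
theorem genMeasure_eq_sortedMeasure_of_subset {C : ℝ} (hC : IsChartRatio n C)
    (π : Equiv.Perm (Fin n)) {k : ℕ} {D : Set (Tuple (d + 1) n)} (hDm : MeasurableSet D)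
    (hD : ∀ U : UGroup n, ∀ X ∈ D, conj U X ∈ D) (hDk : D ⊆ piece d n k) :
    genMeasure d n D = sortedMeasure C π D := by
  have h0 : ENNReal.ofReal C ≠ 0 := (ENNReal.ofReal_pos.2 hC.1).ne'
  have h1 := ENNReal.Tendsto.const_mul (a := genMeasure d n D) hC.2
    (Or.inl (ENNReal.inv_ne_zero.2 ENNReal.ofReal_ne_top))
  rw [sortedMeasure_apply C π hC.1.le hDm,
    tendsto_nhds_unique (tendsto_genMeasure_mul π k hDm hD hDk) h1, mul_comm, mul_assoc,
    ENNReal.inv_mul_cancel h0 ENNReal.ofReal_ne_top, mul_one]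

theorem genMeasure_eq_sortedMeasure {C : ℝ} (hC : IsChartRatio n C)
    (π : Equiv.Perm (Fin n)) {D : Set (Tuple (d + 1) n)} (hDm : MeasurableSet D)
    (hD : ∀ U : UGroup n, ∀ X ∈ D, conj U X ∈ D) :
    genMeasure d n D = sortedMeasure C π D := by
  have hmono : Monotone fun k => D ∩ piece d n k := fun k l h =>
    Set.inter_subset_inter_right _ (monotone_piece h)
  have hU : ⋃ k, D ∩ piece d n k = D ∩ generic (d + 1) n := by
    rw [← Set.inter_iUnion, iUnion_piece]
  have h1 : genMeasure d n D = genMeasure d n (D ∩ generic (d + 1) n) := by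
    rw [genMeasure, Measure.restrict_apply hDm, Measure.restrict_apply
      (hDm.inter measurableSet_generic), Set.inter_assoc, Set.inter_self]
  have h2 : sortedMeasure C π D = sortedMeasure C π (D ∩ generic (d + 1) n) := by
    rw [sortedMeasure_apply C π hC.1.le hDm,
      sortedMeasure_apply C π hC.1.le (hDm.inter measurableSet_generic), Set.inter_assoc,
      Set.inter_eq_right.2 fun Q hQ => (sorted_subset π hQ).2]
  rw [h1, h2, ← hU, hmono.measure_iUnion, hmono.measure_iUnion]
  refine iSup_congr fun k => ?_
  exact genMeasure_eq_sortedMeasure_of_subset hC π (k := k)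
    (hDm.inter (isClosed_piece k).measurableSet)
    (fun U X hX => ⟨hD U X hX.1, conj_mem_piece U hX.2⟩) Set.inter_subset_right

theorem lintegral_genMeasure_of_invariant {C : ℝ} (hC : IsChartRatio n C)
    (π : Equiv.Perm (Fin n)) {F : Tuple (d + 1) n → ℝ≥0∞} (hF : Measurable F)
    (hinv : ∀ (U : UGroup n) (X), F (conj U X) = F X) :
    ∫⁻ X, F X ∂(genMeasure d n) = ∫⁻ Q, F Q ∂(sortedMeasure C π) := by
  -- Preimages under an invariant function are invariant sets, so the two measures have the same
  -- image under `F`.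
  have h : (genMeasure d n).map F = (sortedMeasure C π).map F := by
    ext s hs
    rw [Measure.map_apply hF hs, Measure.map_apply hF hs]
    refine genMeasure_eq_sortedMeasure hC π (hF hs) fun U X hX => ?_
    change F (conj U X) ∈ s
    rw [hinv]
    exact hX
  have h1 := lintegral_map (μ := genMeasure d n) measurable_id hF
  have h2 := lintegral_map (μ := sortedMeasure C π) measurable_id hF
  simp only [id] at h1 h2
  rw [← h1, ← h2, h]

/-- Integration over the generic tuples in the coordinates given by a unitary matrix and a sorted
upper triangular tuple. -/
theorem lintegral_genMeasure {C : ℝ} (hC : IsChartRatio n C) (π : Equiv.Perm (Fin n))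
    {f : Tuple (d + 1) n → ℝ≥0∞} (hf : Measurable f) :
    ∫⁻ X, f X ∂(genMeasure d n) =
      ∫⁻ U, ∫⁻ Q, f (conj U Q) ∂(sortedMeasure C π) ∂(haarU n) := by
  have hmeas : Measurable (Function.uncurry fun (U : UGroup n) (X : Tuple (d + 1) n) =>
      f (conj U X)) := hf.comp continuous_conj.measurable
  -- Averaging over conjugations does not change the integral and replaces `f` by a
  -- conjugation-invariant function, by right invariance of Haar measure. For that function the two
  -- measures agree, and Fubini restores the order of integration.
  calc ∫⁻ X, f X ∂(genMeasure d n)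
      = ∫⁻ U, ∫⁻ X, f (conj U X) ∂(genMeasure d n) ∂(haarU n) := by
        simp_rw [fun U : UGroup n => (measurePreserving_conj (d := d) U).lintegral_comp hf]
        rw [lintegral_const, measure_univ, mul_one]
    _ = ∫⁻ X, ∫⁻ U, f (conj U X) ∂(haarU n) ∂(genMeasure d n) :=
        lintegral_lintegral_swap hmeas.aemeasurable
    _ = ∫⁻ Q, ∫⁻ U, f (conj U Q) ∂(haarU n) ∂(sortedMeasure C π) := by
        refine lintegral_genMeasure_of_invariant hC π hmeas.lintegral_prod_left' fun V X => ?_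
        have h : ∀ U : UGroup n, f (conj U (conj V X)) = f (conj (U * V) X) := fun U => by
          rw [conj_mul]
        change ∫⁻ U, f (conj U (conj V X)) ∂(haarU n) = ∫⁻ U, f (conj U X) ∂(haarU n)
        simp_rw [h]
        exact lintegral_mul_right_eq_self (fun U => f (conj U X)) V
    _ = ∫⁻ U, ∫⁻ Q, f (conj U Q) ∂(sortedMeasure C π) ∂(haarU n) :=
        (lintegral_lintegral_swap hmeas.aemeasurable).symm

end Polar

/-! ### Invariance of `κ` under the torus -/

section TorusInvariance

variable {d n : ℕ}

theorem map_tangentSpaceOf_le {E : Type*} [NormedAddCommGroup E] [NormedSpace ℝ E] {s : Set E}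
    (c : E →L[ℝ] E) (hc : ∀ x ∈ s, c x ∈ s) (x : E) :
    (tangentSpaceOf s x).map (c : E →ₗ[ℝ] E) ≤ tangentSpaceOf s (c x) := by
  rw [tangentSpaceOf, Submodule.map_span, Submodule.span_le]
  rintro _ ⟨Z, ⟨γ, h1, h2, h3, h4⟩, rfl⟩
  refine Submodule.subset_span ⟨fun t => c (γ t), c.contDiff.contDiffAt.comp 0 h1,
    h2.mono fun t ht => hc _ ht, congrArg c h3, ?_⟩
  exact c.hasFDerivAt.comp_hasDerivAt 0 h4

/-- Conjugation by a unitary matrix, as a real linear isometry. -/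
def conjIso (U : UGroup n) : Tuple d n ≃ₗᵢ[ℝ] Tuple d n where
  toFun := conj U
  map_add' X Y := tuple_ext fun r => by
    rw [comp_conj]
    change _ = comp (conj U X) r + comp (conj U Y) r
    rw [comp_conj, comp_conj, ← add_mul, ← mul_add]
    rfl
  map_smul' c X := tuple_ext fun r => by
    rw [comp_conj]
    change _ = c • comp (conj U X) r
    rw [comp_conj, ← smul_mul_assoc, ← mul_smul_comm]
    rfl
  invFun := conj U⁻¹
  left_inv := conj_inv_conj U
  right_inv := conj_conj_inv U
  norm_map' := norm_conj U

theorem tangentSpaceOf_conj {t : UGroup n} (ht : t ∈ torus n) (Q : Tuple d n) :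
    tangentSpaceOf (triangular d n) (conj t Q) =
      (tangentSpaceOf (triangular d n) Q).map (((conjIso t).toLinearEquiv : Tuple d n ≃ₗ[ℝ] Tuple d n) :
        Tuple d n →ₗ[ℝ] Tuple d n) := by
  refine le_antisymm ?_ ?_
  · have h := map_tangentSpaceOf_le ((conjIso t⁻¹ : Tuple d n ≃ₗᵢ[ℝ] Tuple d n) :
      Tuple d n →L[ℝ] Tuple d n) (fun X hX => conj_torus_mem_triangular (inv_mem ht) hX) (conj t Q)
    intro Z hZ
    refine ⟨conj t⁻¹ Z, ?_, conj_conj_inv t Z⟩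
    have h' := h ⟨Z, hZ, rfl⟩
    change conj t⁻¹ Z ∈ tangentSpaceOf (triangular d n) (conj t⁻¹ (conj t Q)) at h'
    rwa [conj_inv_conj] at h'
  · exact map_tangentSpaceOf_le ((conjIso t : Tuple d n ≃ₗᵢ[ℝ] Tuple d n) :
      Tuple d n →L[ℝ] Tuple d n) (fun X hX => conj_torus_mem_triangular ht hX) Q

theorem Pperp_conj {t : UGroup n} (ht : t ∈ torus n) (Q X : Tuple d n) :
    Pperp (conj t Q) (conj t X) = conj t (Pperp Q X) := by
  let V := tangentSpaceOf (triangular d n) Q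
  have hV : ∀ Y, Pperp Q Y = Y - V.starProjection Y := fun Y => by
    change Vᗮ.starProjection Y = _
    rw [Submodule.starProjection_orthogonal]
    rfl
  have hV' : ∀ Y, Pperp (conj t Q) Y = Y - (V.map (((conjIso t).toLinearEquiv : Tuple d n ≃ₗ[ℝ] Tuple d n) :
      Tuple d n →ₗ[ℝ] Tuple d n)).starProjection Y := fun Y => by
    have h : ∀ (A B : Submodule ℝ (Tuple d n)), A = B → Aᗮ.starProjection Y =
        Y - B.starProjection Y := by
      rintro A _ rfl
      rw [Submodule.starProjection_orthogonal]
      rfl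
    exact h _ _ (tangentSpaceOf_conj ht Q)
  rw [hV, hV', ← conj_sub]
  congr 1
  rw [Submodule.starProjection_map_apply (conjIso t) V]
  change conj t (V.starProjection (conj t⁻¹ (conj t X))) = _
  rw [conj_inv_conj]

theorem norm_torus_apply {t : UGroup n} (ht : t ∈ torus n) (i : Fin n) :
    ‖(t : Matrix (Fin n) (Fin n) ℂ) i i‖ = 1 := by
  have h := congrArg norm (torus_mul_star ht i)
  rw [norm_mul, norm_star, norm_one] at h
  nlinarith [norm_nonneg ((t : Matrix (Fin n) (Fin n) ℂ) i i)]

/-- The conjugate of a skew-Hermitian matrix with zero diagonal by a diagonal unitary matrix. -/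
def torusConj {t : UGroup n} (ht : t ∈ torus n) : skewZeroDiag n →ₗᵢ[ℝ] skewZeroDiag n where
  toFun S := ⟨WithLp.toLp 2 fun k => (t : Matrix (Fin n) (Fin n) ℂ) k.1 k.1 * skewMat S k.1 k.2 *
      star ((t : Matrix (Fin n) (Fin n) ℂ) k.2 k.2), by
    refine ⟨fun i j => ?_, fun i => ?_⟩
    · have h : star (skewMat S j i) = -skewMat S i j := S.2.1 i j
      simp only [star_mul, star_star, h]
      ring
    · have h : skewMat S i i = 0 := S.2.2 i
      simp only [h, mul_zero, zero_mul]⟩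
  map_add' S T := by
    refine Subtype.ext (PiLp.ext fun k => ?_)
    simp only [skewMat, Matrix.of_apply, Submodule.coe_add, PiLp.add_apply]
    ring
  map_smul' c S := by
    refine Subtype.ext (PiLp.ext fun k => ?_)
    simp only [skewMat, Matrix.of_apply, Submodule.coe_smul, PiLp.smul_apply, RingHom.id_apply,
      Complex.real_smul]
    ring
  norm_map' S := by
    change ‖(WithLp.toLp 2 _ : EuclideanSpace ℂ (Fin n × Fin n))‖ =
      ‖(S : EuclideanSpace ℂ (Fin n × Fin n))‖
    rw [EuclideanSpace.norm_eq, EuclideanSpace.norm_eq]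
    congr 1
    refine Finset.sum_congr rfl fun k _ => ?_
    simp only [norm_mul, norm_star, norm_torus_apply ht, one_mul, mul_one]
    rfl

theorem skewMat_torusConj {t : UGroup n} (ht : t ∈ torus n) (S : skewZeroDiag n) :
    skewMat (torusConj ht S) = (t : Matrix (Fin n) (Fin n) ℂ) * skewMat S *
      star (t : Matrix (Fin n) (Fin n) ℂ) := by
  ext i j
  have h := conj_torus_apply ht (ofComp fun _ : Fin 1 => skewMat S) 0 i j
  rw [comp_conj, comp_ofComp] at h
  exact h.symm

theorem ad_torusConj {t : UGroup n} (ht : t ∈ torus n) (Q : Tuple d n) (S : skewZeroDiag n) :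
    ad (conj t Q) (torusConj ht S) = conj t (ad Q S) := by
  refine tuple_ext fun r => ?_
  change comp (conj t Q) r * skewMat (torusConj ht S) - skewMat (torusConj ht S) *
    comp (conj t Q) r = comp (conj t (ad Q S)) r
  rw [skewMat_torusConj, comp_conj, comp_conj, unitary_conj_mul, unitary_conj_mul, ← sub_mul,
    ← mul_sub]
  rfl

theorem inner_torusConj {t : UGroup n} (ht : t ∈ torus n) (S T : skewZeroDiag n) :
    inner ℝ (torusConj ht S) (torusConj ht T) = inner ℝ S T := by
  rw [real_inner_eq_norm_add_mul_self_sub_norm_mul_self_sub_norm_mul_self_div_two,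
    real_inner_eq_norm_add_mul_self_sub_norm_mul_self_sub_norm_mul_self_div_two, ← map_add,
    (torusConj ht).norm_map, (torusConj ht).norm_map, (torusConj ht).norm_map]

/-- All ingredients of `Λ_Q` are equivariant: the torus preserves the triangular tuples, hence
carries tangent spaces and projections along, and it acts by isometries. -/
theorem Lam_torusConj {t : UGroup n} (ht : t ∈ torus n) (Q : Tuple d n) (S : skewZeroDiag n) :
    Lam (conj t Q) (torusConj ht S) = torusConj ht (Lam Q S) := by
  have hsurj : Function.Surjective (torusConj ht) :=
    LinearMap.surjective_of_injective (f := (torusConj ht).toLinearMap) (torusConj ht).injective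
  refine ext_inner_right ℝ fun T => ?_
  obtain ⟨T, rfl⟩ := hsurj T
  rw [inner_Lam, ad_torusConj, ad_torusConj, Pperp_conj ht]
  refine ((conjIso t).inner_map_map (Pperp Q (ad Q S)) (ad Q T)).trans ?_
  rw [← inner_Lam]
  exact (inner_torusConj ht (Lam Q S) T).symm

theorem kappa_conj {t : UGroup n} (ht : t ∈ torus n) (C : ℝ) (Q : Tuple d n) :
    kappa C (conj t Q) = kappa C Q := by
  let e : skewZeroDiag n ≃ₗ[ℝ] skewZeroDiag n :=
    LinearEquiv.ofInjectiveEndo (torusConj ht).toLinearMap (torusConj ht).injective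
  have h : Lam (conj t Q) = e.toLinearMap ∘ₗ Lam Q ∘ₗ e.symm.toLinearMap := by
    ext1 S
    obtain ⟨T, rfl⟩ := e.surjective S
    have h1 := Lam_torusConj ht Q T
    simp only [LinearMap.comp_apply, LinearEquiv.coe_coe, LinearEquiv.symm_apply_apply]
    exact h1
  rw [kappa, kappa, h, LinearMap.det_conj]

end TorusInvariance

/-! ### Sections, the factor `n!` and coordinates -/

section Sections

variable {d n : ℕ}

theorem lintegral_sortedMeasure (C : ℝ) (π : Equiv.Perm (Fin n)) {g : Tuple (d + 1) n → ℝ≥0∞}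
    (hg : Measurable g) : ∫⁻ Q, g Q ∂(sortedMeasure C π) =
      ∫⁻ Q in sorted d n π, kappaFun C Q * g Q ∂(dQ (d + 1) n) := by
  rw [sortedMeasure, lintegral_withDensity_eq_lintegral_mul _ (measurable_kappaFun C) hg]
  rfl

theorem setLIntegral_sortedMeasure (C : ℝ) (π : Equiv.Perm (Fin n))
    {g : Tuple (d + 1) n → ℝ≥0∞} (hg : Measurable g) {A : Set (Tuple (d + 1) n)}
    (hA : MeasurableSet A) : ∫⁻ Q in A, g Q ∂(sortedMeasure C π) =
      ∫⁻ Q in A ∩ sorted d n π, kappaFun C Q * g Q ∂(dQ (d + 1) n) := by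
  rw [sortedMeasure, setLIntegral_withDensity_eq_setLIntegral_mul _ (measurable_kappaFun C) hg hA,
    Measure.restrict_restrict hA]
  rfl

theorem dQ_restrict_sorted (π : Equiv.Perm (Fin n)) :
    (dQ (d + 1) n).restrict (sorted d n π) =
      (μHE[n ^ 2 + (2 * (d + 1) - 1) * n]).restrict (sorted d n π) := by
  rw [dQ, Measure.restrict_restrict (measurableSet_sorted π),
    Set.inter_eq_left.2 (sorted_subset π)]

theorem measurePreserving_conj_sorted {t : UGroup n} (ht : t ∈ torus n) (π : Equiv.Perm (Fin n)) :
    MeasurePreserving (conj t) ((dQ (d + 1) n).restrict (sorted d n π))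
      ((dQ (d + 1) n).restrict (sorted d n π)) := by
  have h := ((conjIso t : Tuple (d + 1) n ≃ₗᵢ[ℝ]
    Tuple (d + 1) n).toIsometryEquiv.measurePreserving_euclideanHausdorffMeasure
      (n ^ 2 + (2 * (d + 1) - 1) * n)).restrict_preimage (measurableSet_sorted (d := d) π)
  have hpre : conj t ⁻¹' sorted d n π = sorted d n π := by
    ext Q
    refine ⟨fun hQ => ?_, fun hQ => conj_torus_mem_sorted ht hQ⟩
    rw [← conj_inv_conj t Q]
    exact conj_torus_mem_sorted (inv_mem ht) hQ
  change MeasurePreserving (conj t) (Measure.restrict _ (conj t ⁻¹' sorted d n π)) _ at h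
  rwa [hpre, ← dQ_restrict_sorted] at h

theorem lintegral_sortedMeasure_conj {t : UGroup n} (ht : t ∈ torus n) (C : ℝ)
    (π : Equiv.Perm (Fin n)) {g : Tuple (d + 1) n → ℝ≥0∞} (hg : Measurable g) :
    ∫⁻ Q, g (conj t Q) ∂(sortedMeasure C π) = ∫⁻ Q, g Q ∂(sortedMeasure C π) := by
  have hgc : Measurable fun Q => g (conj t Q) := hg.comp (measurable_conj t)
  have hkg : Measurable fun Q => kappaFun C Q * g Q := (measurable_kappaFun C).mul hg
  rw [lintegral_sortedMeasure C π hgc, lintegral_sortedMeasure C π hg,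
    ← (measurePreserving_conj_sorted ht π).lintegral_comp hkg]
  refine setLIntegral_congr_fun (measurableSet_sorted π) fun Q hQ => ?_
  rw [kappaFun_of_mem (sorted_subset π hQ),
    kappaFun_of_mem (sorted_subset π (conj_torus_mem_sorted ht hQ)), kappa_conj ht]

theorem exists_section_mk_eq {σ : UGroup n ⧸ torus n → UGroup n} (hσ : IsSection σ)
    (U : UGroup n) : ∃ t ∈ torus n, σ (QuotientGroup.mk U) = U * t :=
  ⟨U⁻¹ * σ (QuotientGroup.mk U), QuotientGroup.eq.1 (hσ _).symm, by group⟩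

/-- The section differs from `U` by a torus element, and conjugation by it preserves `κ dQ` on
sorted tuples. The inner integral is thus independent of the representative. -/
theorem lintegral_section_mk {σ : UGroup n ⧸ torus n → UGroup n} (hσ : IsSection σ) (C : ℝ)
    (π : Equiv.Perm (Fin n)) {h : Tuple (d + 1) n → ℝ≥0∞} (hh : Measurable h) (U : UGroup n) :
    ∫⁻ Q, h (conj (σ (QuotientGroup.mk U)) Q) ∂(sortedMeasure C π) =
      ∫⁻ Q, h (conj U Q) ∂(sortedMeasure C π) := by
  obtain ⟨t, ht, htU⟩ := exists_section_mk_eq hσ U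
  rw [htU]
  simp_rw [conj_mul]
  exact lintegral_sortedMeasure_conj ht C π (hh.comp (measurable_conj U))

/-- The section itself may fail to be measurable: the integral descends from a measurable function
on `U(n)`, which is enough for the quotient σ-algebra. -/
theorem measurable_lintegral_section {σ : UGroup n ⧸ torus n → UGroup n} (hσ : IsSection σ) (C : ℝ)
    (π : Equiv.Perm (Fin n)) {h : Tuple (d + 1) n → ℝ≥0∞} (hh : Measurable h) :
    Measurable fun u => ∫⁻ Q, h (conj (σ u) Q) ∂(sortedMeasure C π) := by
  have hmeas : Measurable (Function.uncurry fun (U : UGroup n) (X : Tuple (d + 1) n) =>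
      h (conj U X)) := hh.comp continuous_conj.measurable
  have hmk : (fun U : UGroup n => ∫⁻ Q, h (conj (σ (QuotientGroup.mk U)) Q) ∂(sortedMeasure C π)) =
      fun U => ∫⁻ Q, h (conj U Q) ∂(sortedMeasure C π) :=
    funext fun U => lintegral_section_mk hσ C π hh U
  refine measurable_from_quotient.2 ?_
  change Measurable fun U : UGroup n =>
    ∫⁻ Q, h (conj (σ (QuotientGroup.mk U)) Q) ∂(sortedMeasure C π)
  rw [hmk]
  exact hmeas.lintegral_prod_right'

/-- Integration over the generic tuples in the coordinates given by a section and a sorted upper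
triangular tuple. -/
theorem lintegral_genMeasure_section {C : ℝ} (hC : IsChartRatio n C) (π : Equiv.Perm (Fin n))
    {σ : UGroup n ⧸ torus n → UGroup n} (hσ : IsSection σ)
    {h : Tuple (d + 1) n → ℝ≥0∞} (hh : Measurable h) :
    ∫⁻ X, h X ∂(genMeasure d n) =
      ∫⁻ u, ∫⁻ Q, h (conj (σ u) Q) ∂(sortedMeasure C π) ∂(nu n) := by
  rw [lintegral_genMeasure hC π hh, nu,
    lintegral_map (measurable_lintegral_section hσ C π hh) measurable_mk]
  exact lintegral_congr fun U => (lintegral_section_mk hσ C π hh U).symm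

/-- Irreducibility enters the integral formulas only through this identity. -/
theorem dX_eq_genMeasure (h : CommutingIrreducible (d + 1) n) :
    dX (d + 1) n = genMeasure d n := by
  have h0 := euclideanHausdorffMeasure_commuting_diff_generic h
  refine (Measure.restrict_congr_set ?_).symm
  refine (ae_eq_set.2 ⟨?_, h0⟩)
  rw [Set.sdiff_eq_empty.2 fun X hX => hX.1, measure_empty]

/-- A function on the commuting tuples, extended by zero. -/
def extendZero (w : Tuple d n → ℝ≥0) : Tuple d n → ℝ≥0∞ :=
  (commuting d n).indicator fun X => (w X : ℝ≥0∞)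

theorem extendZero_of_mem {w : Tuple d n → ℝ≥0} {X : Tuple d n} (hX : X ∈ commuting d n) :
    extendZero w X = w X := Set.indicator_of_mem hX _

theorem measurable_extendZero {w : Tuple d n → ℝ≥0} (hw : IsWeight w) :
    Measurable (extendZero w) := by
  refine measurable_of_restrict_of_restrict_compl isClosed_commuting.measurableSet ?_ ?_
  · have : (commuting d n).domRestrict (extendZero w) =
        fun X : commuting d n => ((w X : ℝ≥0) : ℝ≥0∞) :=
      funext fun X => extendZero_of_mem X.2
    rw [this]
    exact hw.measurable.coe_nnreal_ennreal
  · have : (commuting d n)ᶜ.domRestrict (extendZero w) = fun _ => 0 :=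
      funext fun X => (Set.indicator_of_notMem X.2 _ : extendZero w X = 0)
    rw [this]
    exact measurable_const

theorem lintegral_dX_eq (h : CommutingIrreducible (d + 1) n) (w : Tuple (d + 1) n → ℝ≥0)
    (f : Tuple (d + 1) n → ℝ≥0∞) {E : Set (Tuple (d + 1) n)} (hE : MeasurableSet E) :
    ∫⁻ X in E, f X * (w X : ℝ≥0∞) ∂(dX (d + 1) n) =
      ∫⁻ X in E, f X * extendZero w X ∂(genMeasure d n) := by
  rw [dX_eq_genMeasure h, genMeasure, Measure.restrict_restrict hE]
  refine setLIntegral_congr_fun (hE.inter measurableSet_generic) fun X hX => ?_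
  rw [extendZero_of_mem hX.2.1]

theorem mul_extendZero_conj {w : Tuple (d + 1) n → ℝ≥0} (hw : IsWeight w) (C : ℝ)
    (f : Tuple (d + 1) n → ℝ≥0∞) (U : UGroup n) {Q : Tuple (d + 1) n}
    (hQ : Q ∈ triangular (d + 1) n ∩ generic (d + 1) n) :
    kappaFun C Q * (f (conj U Q) * extendZero w (conj U Q)) =
      f (conj U Q) * (ENNReal.ofReal (kappa C Q) * (w Q : ℝ≥0∞)) := by
  rw [extendZero_of_mem (conj_mem_commuting hQ.1.1), hw.invariant U Q hQ.1.1, kappaFun_of_mem hQ]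
  ring

/-- The generic triangular tuples are the disjoint union of the sorted ones over all `π`. Invariance
of `w` lets it be evaluated at the conjugated tuple. -/
theorem setLIntegral_dQ_eq_sum {w : Tuple (d + 1) n → ℝ≥0} (hw : IsWeight w) (C : ℝ)
    {f : Tuple (d + 1) n → ℝ≥0∞} (hf : Measurable f) (U : UGroup n) {A : Set (Tuple (d + 1) n)}
    (hA : MeasurableSet A) (hAT : A ⊆ triangular (d + 1) n ∩ generic (d + 1) n) :
    ∫⁻ Q in A, f (conj U Q) * (ENNReal.ofReal (kappa C Q) * (w Q : ℝ≥0∞)) ∂(dQ (d + 1) n) =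
      ∑ π : Equiv.Perm (Fin n), ∫⁻ Q in A, f (conj U Q) * extendZero w (conj U Q)
        ∂(sortedMeasure C π) := by
  have hm : Measurable fun Q : Tuple (d + 1) n => f (conj U Q) * extendZero w (conj U Q) :=
    (hf.mul (measurable_extendZero hw)).comp (measurable_conj U)
  have hA' : A = ⋃ π, A ∩ sorted d n π := by
    rw [← Set.inter_iUnion, iUnion_sorted, Set.inter_eq_left.2 hAT]
  conv_lhs => rw [hA']
  rw [lintegral_iUnion (fun π => hA.inter (measurableSet_sorted π))
    (fun π π' hne => (pairwise_disjoint_sorted hne).mono Set.inter_subset_right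
      Set.inter_subset_right), tsum_fintype]
  refine Finset.sum_congr rfl fun π _ => ?_
  rw [setLIntegral_sortedMeasure C π hm hA]
  exact setLIntegral_congr_fun (hA.inter (measurableSet_sorted π)) fun Q hQ =>
    (mul_extendZero_conj hw C f U (hAT hQ.1)).symm

theorem dQ_restrict_triangular_generic :
    (dQ d n).restrict (triangular d n ∩ generic d n) = dQ d n := by
  rw [dQ, Measure.restrict_restrict measurableSet_triangular_generic, Set.inter_self]

theorem sortedMeasure_restrict (C : ℝ) (π : Equiv.Perm (Fin n)) :
    (sortedMeasure C π : Measure (Tuple (d + 1) n)).restrict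
      (triangular (d + 1) n ∩ generic (d + 1) n) = sortedMeasure C π := by
  rw [sortedMeasure, restrict_withDensity measurableSet_triangular_generic,
    Measure.restrict_restrict measurableSet_triangular_generic,
    Set.inter_eq_right.2 (sorted_subset π)]

/-- The integral over all commuting tuples. -/
theorem lintegral_dX_section {C : ℝ} (hC : IsChartRatio n C) (h : CommutingIrreducible (d + 1) n)
    {w : Tuple (d + 1) n → ℝ≥0} (hw : IsWeight w) {σ : UGroup n ⧸ torus n → UGroup n}
    (hσ : IsSection σ) {f : Tuple (d + 1) n → ℝ≥0∞} (hf : Measurable f) :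
    ∫⁻ X, f X * (w X : ℝ≥0∞) ∂(dX (d + 1) n) = ((Nat.factorial n : ℕ) : ℝ≥0∞)⁻¹ *
      ∫⁻ u, ∫⁻ Q, f (conj (σ u) Q) * (ENNReal.ofReal (kappa C Q) * (w Q : ℝ≥0∞))
        ∂(dQ (d + 1) n) ∂(nu n) := by
  have hm := hf.mul (measurable_extendZero hw)
  have h1 := lintegral_dX_eq h w f MeasurableSet.univ
  rw [setLIntegral_univ, setLIntegral_univ] at h1
  have h2 : ∀ u, ∫⁻ Q, f (conj (σ u) Q) * (ENNReal.ofReal (kappa C Q) * (w Q : ℝ≥0∞))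
      ∂(dQ (d + 1) n) = ∑ π : Equiv.Perm (Fin n),
        ∫⁻ Q, (f * extendZero w) (conj (σ u) Q) ∂(sortedMeasure C π) := fun u => by
    rw [← dQ_restrict_triangular_generic, setLIntegral_dQ_eq_sum hw C hf (σ u)
      measurableSet_triangular_generic le_rfl]
    simp_rw [sortedMeasure_restrict]
    rfl
  simp_rw [h2]
  rw [lintegral_finsetSum _ fun π _ => measurable_lintegral_section hσ C π hm]
  -- Each ordering contributes the full integral over the generic tuples; the `n!` equal terms
  -- cancel the factor in front.
  simp_rw [← lintegral_genMeasure_section hC _ hσ hm]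
  rw [Finset.sum_const, Finset.card_univ, Fintype.card_perm, Fintype.card_fin, nsmul_eq_mul,
    ← mul_assoc, ENNReal.inv_mul_cancel (Nat.cast_ne_zero.2 (Nat.factorial_ne_zero n))
      (ENNReal.natCast_ne_top _), one_mul, h1]
  rfl

/-! ### Coordinates -/

/-- The coordinates given by a section. -/
abbrev sectionMap (σ : UGroup n ⧸ torus n → UGroup n)
    (p : Tuple d n × (UGroup n ⧸ torus n)) : Tuple d n := conj (σ p.2) p.1

theorem conj_section_injective {σ : UGroup n ⧸ torus n → UGroup n} (hσ : IsSection σ)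
    {π : Equiv.Perm (Fin n)} {Q Q' : Tuple (d + 1) n} (hQ : Q ∈ sorted d n π)
    (hQ' : Q' ∈ sorted d n π) {u u' : UGroup n ⧸ torus n}
    (h : conj (σ u) Q = conj (σ u') Q') : u = u' ∧ Q = Q' := by
  have hu : u' = u := by
    rw [← hσ u, ← hσ u']
    exact QuotientGroup.eq.2 (mem_torus_of_conj_eq hQ hQ' h)
  subst hu
  refine ⟨rfl, ?_⟩
  rw [← conj_inv_conj (σ u') Q, h, conj_inv_conj]

/-- The quotient is replaced by the Borel set `M` of chosen representatives in the Polish space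
`U(n)`. The conjugation map is continuous, and it is injective there because sorted tuples determine
the coset, hence the representative. -/
theorem measurableSet_sectionMap_image {σ : UGroup n ⧸ torus n → UGroup n} (hσ : IsSection σ)
    (hσm : Measurable σ) (π : Equiv.Perm (Fin n)) {A : Set (Tuple (d + 1) n)}
    {N : Set (UGroup n ⧸ torus n)} (hA : MeasurableSet A) (hN : MeasurableSet N) :
    MeasurableSet (sectionMap σ '' ((A ∩ sorted d n π) ×ˢ N)) := by
  let M : Set (UGroup n) := {U | QuotientGroup.mk U ∈ N ∧ σ (QuotientGroup.mk U) = U}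
  have hM : MeasurableSet M := (measurable_mk hN).inter
    (measurableSet_eq_fun (hσm.comp measurable_mk) measurable_id)
  have h : sectionMap σ '' ((A ∩ sorted d n π) ×ˢ N) =
      (fun p : UGroup n × Tuple (d + 1) n => conj p.1 p.2) '' (M ×ˢ (A ∩ sorted d n π)) := by
    ext X
    constructor
    · rintro ⟨⟨Q, u⟩, ⟨hQ, hu⟩, rfl⟩
      refine ⟨(σ u, Q), ⟨⟨?_, ?_⟩, hQ⟩, rfl⟩
      · change (QuotientGroup.mk (σ u) : UGroup n ⧸ torus n) ∈ N
        rw [hσ u]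
        exact hu
      · change σ (QuotientGroup.mk (σ u)) = σ u
        rw [hσ u]
    · rintro ⟨⟨U, Q⟩, ⟨⟨hU, hU'⟩, hQ⟩, rfl⟩
      refine ⟨(Q, QuotientGroup.mk U), ⟨hQ, hU⟩, ?_⟩
      change conj (σ (QuotientGroup.mk U)) Q = conj U Q
      have hU'' : σ (QuotientGroup.mk U) = U := hU'
      rw [hU'']
  rw [h]
  refine MeasurableSet.image_of_continuousOn_injOn
    (hM.prod (hA.inter (measurableSet_sorted π))) continuous_conj.continuousOn ?_
  rintro ⟨U, Q⟩ ⟨⟨-, hU⟩, hQ⟩ ⟨U', Q'⟩ ⟨⟨-, hU'⟩, hQ'⟩ heq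
  have hU1 : σ (QuotientGroup.mk U) = U := hU
  have hU1' : σ (QuotientGroup.mk U') = U' := hU'
  have heq' : conj U Q = conj U' Q' := heq
  rw [← hU1, ← hU1'] at heq'
  obtain ⟨h1, h2⟩ := conj_section_injective hσ hQ.2 hQ'.2 heq'
  refine Prod.ext ?_ h2
  change U = U'
  rw [← hU1, ← hU1', h1]

theorem ae_sortedMeasure_mem (C : ℝ) (π : Equiv.Perm (Fin n)) :
    ∀ᵐ Q ∂(sortedMeasure C π : Measure (Tuple (d + 1) n)), Q ∈ sorted d n π :=
  (withDensity_absolutelyContinuous _ _).ae_le (ae_restrict_mem (measurableSet_sorted π))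

/-- For one ordering the coordinates are injective, so the indicator of the image, evaluated at
`σ(u) Q σ(u)*`, is the product of those of `N` and `A` for almost every `Q`. -/
theorem setLIntegral_sectionMap_image_sorted {C : ℝ} (hC : IsChartRatio n C)
    (π : Equiv.Perm (Fin n)) {σ : UGroup n ⧸ torus n → UGroup n} (hσ : IsSection σ)
    (hσm : Measurable σ) {A : Set (Tuple (d + 1) n)} {N : Set (UGroup n ⧸ torus n)}
    (hA : MeasurableSet A) (hN : MeasurableSet N) {h : Tuple (d + 1) n → ℝ≥0∞}
    (hh : Measurable h) :
    ∫⁻ X in sectionMap σ '' ((A ∩ sorted d n π) ×ˢ N), h X ∂(genMeasure d n) =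
      ∫⁻ u in N, ∫⁻ Q in A, h (conj (σ u) Q) ∂(sortedMeasure C π) ∂(nu n) := by
  have hE := measurableSet_sectionMap_image (d := d) hσ hσm π hA hN
  rw [← lintegral_indicator hE, lintegral_genMeasure_section hC π hσ (hh.indicator hE),
    ← lintegral_indicator hN]
  refine lintegral_congr fun u => ?_
  by_cases hu : u ∈ N
  · rw [Set.indicator_of_mem hu, ← lintegral_indicator hA]
    refine lintegral_congr_ae ((ae_sortedMeasure_mem C π).mono fun Q hQ => ?_)
    by_cases hQA : Q ∈ A
    · simp only
      rw [Set.indicator_of_mem hQA, Set.indicator_of_mem]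
      exact ⟨(Q, u), ⟨⟨hQA, hQ⟩, hu⟩, rfl⟩
    · simp only
      rw [Set.indicator_of_notMem hQA, Set.indicator_of_notMem]
      rintro ⟨⟨Q', u'⟩, ⟨hQ', -⟩, heq⟩
      exact hQA ((conj_section_injective hσ hQ'.2 hQ heq).2 ▸ hQ'.1)
  · rw [Set.indicator_of_notMem hu]
    refine (lintegral_congr_ae ((ae_sortedMeasure_mem C π).mono fun Q hQ => ?_)).trans
      lintegral_zero
    rw [Set.indicator_of_notMem]
    rintro ⟨⟨Q', u'⟩, ⟨hQ', hu'⟩, heq⟩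
    exact hu ((conj_section_injective hσ hQ'.2 hQ heq).1 ▸ hu')

/-- Measurability of `σ` is needed here: `A` need not be stable under the torus, so the integral can
depend on the representative. -/
theorem measurable_setLIntegral_section {σ : UGroup n ⧸ torus n → UGroup n}
    (hσm : Measurable σ) (C : ℝ) (π : Equiv.Perm (Fin n)) (A : Set (Tuple (d + 1) n))
    {h : Tuple (d + 1) n → ℝ≥0∞} (hh : Measurable h) :
    Measurable fun u => ∫⁻ Q in A, h (conj (σ u) Q) ∂(sortedMeasure C π) := by
  have hmeas : Measurable (Function.uncurry fun (U : UGroup n) (X : Tuple (d + 1) n) =>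
      h (conj U X)) := hh.comp continuous_conj.measurable
  exact hmeas.lintegral_prod_right'.comp hσm

/-- The integral over the image of a set on which the coordinates are injective. -/
theorem setLIntegral_dX_sectionMap_image {C : ℝ} (hC : IsChartRatio n C)
    (h : CommutingIrreducible (d + 1) n) {w : Tuple (d + 1) n → ℝ≥0} (hw : IsWeight w)
    {σ : UGroup n ⧸ torus n → UGroup n} (hσ : IsSection σ) (hσm : Measurable σ)
    {A : Set (Tuple (d + 1) n)} {N : Set (UGroup n ⧸ torus n)}
    (hA : MeasurableSet A) (hN : MeasurableSet N)
    (hAT : A ⊆ triangular (d + 1) n ∩ generic (d + 1) n)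
    (hinj : Set.InjOn (sectionMap σ) (A ×ˢ N)) {f : Tuple (d + 1) n → ℝ≥0∞} (hf : Measurable f) :
    ∫⁻ X in sectionMap σ '' (A ×ˢ N), f X * (w X : ℝ≥0∞) ∂(dX (d + 1) n) =
      ∫⁻ u in N, ∫⁻ Q in A, f (conj (σ u) Q) * (ENNReal.ofReal (kappa C Q) * (w Q : ℝ≥0∞))
        ∂(dQ (d + 1) n) ∂(nu n) := by
  have hm := hf.mul (measurable_extendZero hw)
  have hE := fun π => measurableSet_sectionMap_image (d := d) hσ hσm π hA hN
  have hsub : ∀ π, (A ∩ sorted d n π) ×ˢ N ⊆ A ×ˢ N := fun π =>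
    Set.prod_mono Set.inter_subset_left le_rfl
  have hU : sectionMap σ '' (A ×ˢ N) = ⋃ π, sectionMap σ '' ((A ∩ sorted d n π) ×ˢ N) := by
    rw [← Set.image_iUnion, ← Set.iUnion_prod_const, ← Set.inter_iUnion, iUnion_sorted,
      Set.inter_eq_left.2 hAT]
  -- Injectivity on `A × N` is needed only to separate different orderings; within one ordering it
  -- is automatic.
  have hdisj : Pairwise (Function.onFun Disjoint fun π =>
      sectionMap σ '' ((A ∩ sorted d n π) ×ˢ N)) := by
    intro π π' hne
    refine Set.disjoint_image_image fun p hp p' hp' heq => ?_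
    have hpp := hinj (hsub π hp) (hsub π' hp') heq
    subst hpp
    exact Set.disjoint_left.1 (pairwise_disjoint_sorted hne) hp.1.2 hp'.1.2
  have h2 : ∀ u, ∫⁻ Q in A, f (conj (σ u) Q) * (ENNReal.ofReal (kappa C Q) * (w Q : ℝ≥0∞))
      ∂(dQ (d + 1) n) = ∑ π : Equiv.Perm (Fin n),
        ∫⁻ Q in A, (f * extendZero w) (conj (σ u) Q) ∂(sortedMeasure C π) := fun u =>
    setLIntegral_dQ_eq_sum hw C hf (σ u) hA hAT
  simp_rw [h2]
  rw [lintegral_finsetSum _ fun π _ => measurable_setLIntegral_section hσm C π A hm, hU,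
    lintegral_dX_eq h w f (MeasurableSet.iUnion hE), lintegral_iUnion hE hdisj, tsum_fintype]
  exact Finset.sum_congr rfl fun π _ =>
    setLIntegral_sectionMap_image_sorted hC π hσ hσm hA hN hm

theorem IsChartRatio.tendsto_toReal {C : ℝ} (hC : IsChartRatio n C) :
    Tendsto (fun ε : ℝ => (volume (Metric.ball (0 : skewZeroDiag n) ε)).toReal /
      (nu n (expBall n ε)).toReal) (𝓝[>] 0) (𝓝 C) := by
  have h1 := ((continuous_inv (G := ℝ≥0∞)).tendsto _).comp hC.2
  rw [inv_inv] at h1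
  have h2 := (ENNReal.tendsto_toReal ENNReal.ofReal_ne_top).comp h1
  rw [ENNReal.toReal_ofReal hC.1.le] at h2
  refine h2.congr fun ε => ?_
  simp [ENNReal.toReal_div]

theorem exists_isChartRatio (n : ℕ) : ∃ C, IsChartRatio n C := exists_tendsto_nu_div n

end Sections

end CommTuple

end

theorem proposition4p3 (n : ℕ) :
    ∃ C : ℝ, 0 < C ∧
      -- `C` is the ratio at the origin of Lebesgue measure `dS` to `ν` in the chart `S ↦ [e^S]`
      Tendsto (fun ε : ℝ =>
          (volume (Metric.ball (0 : CommTuple.skewZeroDiag n) ε)).toReal /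
            (CommTuple.nu n (CommTuple.expBall n ε)).toReal) (𝓝[>] 0) (𝓝 C) ∧
      ∀ d : ℕ, 1 ≤ d → CommTuple.CommutingIrreducible d n →
      ∀ w : CommTuple.Tuple d n → ℝ≥0, CommTuple.IsWeight w →
        -- the global formula; a generic `X` has `n!` upper triangular factorizations
        (∀ σ : CommTuple.UGroup n ⧸ CommTuple.torus n → CommTuple.UGroup n,
          CommTuple.IsSection σ →
          ∀ f : CommTuple.Tuple d n → ℝ≥0∞, Measurable f →
            ∫⁻ X, f X * (w X : ℝ≥0∞) ∂(CommTuple.dX d n) =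
              ((Nat.factorial n : ℕ) : ℝ≥0∞)⁻¹ *
                ∫⁻ u, ∫⁻ Q, f (CommTuple.conj (σ u) Q) *
                    (ENNReal.ofReal (CommTuple.kappa C Q) * (w Q : ℝ≥0∞))
                  ∂(CommTuple.dQ d n) ∂(CommTuple.nu n)) ∧
        -- the formula in coordinates, wherever `X = U Q U*` determines `Q` and the coset of `U`
        (∀ σ : CommTuple.UGroup n ⧸ CommTuple.torus n → CommTuple.UGroup n,
          CommTuple.IsSection σ → Measurable σ →
          ∀ (A : Set (CommTuple.Tuple d n)) (N : Set (CommTuple.UGroup n ⧸ CommTuple.torus n)),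
            MeasurableSet A → MeasurableSet N →
            A ⊆ CommTuple.triangular d n ∩ CommTuple.generic d n →
            Set.InjOn (fun p : CommTuple.Tuple d n × (CommTuple.UGroup n ⧸ CommTuple.torus n) =>
              CommTuple.conj (σ p.2) p.1) (A ×ˢ N) →
            ∀ f : CommTuple.Tuple d n → ℝ≥0∞, Measurable f →
              ∫⁻ X in (fun p : CommTuple.Tuple d n ×
                    (CommTuple.UGroup n ⧸ CommTuple.torus n) =>
                  CommTuple.conj (σ p.2) p.1) '' (A ×ˢ N),
                f X * (w X : ℝ≥0∞) ∂(CommTuple.dX d n) =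
              ∫⁻ u in N, ∫⁻ Q in A, f (CommTuple.conj (σ u) Q) *
                  (ENNReal.ofReal (CommTuple.kappa C Q) * (w Q : ℝ≥0∞))
                ∂(CommTuple.dQ d n) ∂(CommTuple.nu n)) := by
  obtain ⟨C, hC⟩ := CommTuple.exists_isChartRatio n
  refine ⟨C, hC.1, hC.tendsto_toReal, ?_⟩
  intro d hd hirr w hw
  -- The constant is fixed before `d`, as it depends on `n` alone.
  obtain ⟨d, rfl⟩ : ∃ d', d = d' + 1 := ⟨d - 1, by omega⟩
  exact ⟨fun σ hσ f hf => CommTuple.lintegral_dX_section hC hirr hw hσ hf,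
    fun σ hσ hσm A N hA hN hAT hinj f hf =>
      CommTuple.setLIntegral_dX_sectionMap_image hC hirr hw hσ hσm hA hN hAT hinj hf⟩
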